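/- **Proposition 3.1 (preservation of the first-class property).** Let $Y\to X$ be a bundle with $m$ field components over an $n$-dimensional manifold $X$ ($n\ge 1$) with volume form $\omega$, and let $Z=\bigwedge^n_1(Y)/\bigwedge^n_0(Y)$ be the extended polymomentum phase space, where $\bigwedge^p_q$ denotes the $p$-forms annihilated by any $q+1$ vertical vectors. $Z$ has an atlas of natural coordinates $(x^\mu,y^a,p_a^\mu)$ with $\omega=dx^1\wedge\dots\wedge dx^n$, in which the canonical class is $\Theta=[\,p_a^\mu\,dy^a\wedge\omega_\mu \bmod \bigwedge^n_0\,]$, $\omega_\mu=\partial_\mu\lrcorner\,\omega$. The polysymplectic structure is $\Omega=[\,d\Theta \bmod \bigwedge^{n+1}_1\,]$. All forms and multivector fields on $Z$ are smooth; a form is *semi-basic* (horizontal over $X$) if it is annihilated by every vector vertical over $X$, and a $k$-vector field is *vertical* if it annihilates every semi-basic $k$-form. A semi-basic $p$-form $F$ on $Z$, $0\le p\le n-1$, is *Hamiltonian* if there is a vertical multivector field $X_F$ of degree $n-p$ with $X_F\lrcorner\,\Omega=dF$; since $\Omega$ is a class modulo $\bigwedge^{n+1}_1$, this is an equality modulo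 semi-basic forms. The Poisson–Gerstenhaber bracket of a Hamiltonian $p$-form $F$ and a Hamiltonian $q$-form $G$ is the form $$\{[F,G]\}=(-1)^{n-p}\,X_F\lrcorner\, dG$$ of degree $p+q-n+1$ (it is zero, and there is nothing to state, when this number is negative). The co-exterior product is $A\bullet B=*^{-1}(*A\wedge *B)$, where $*$ is the Hodge star on semi-basic forms of a metric on $X$ of any signature with volume form $\omega$; up to the overall sign of the metric, $\bullet$ depends only on $\omega$. Let $\mathfrak C_1,\dots,\mathfrak C_N$ be Hamiltonian $(n-1)$-forms on $Z$ (the constraints). A semi-basic $p$-form $K$, $0\le p\le n-1$, *vanishes weakly*, $K\approx0$, if $$K=\sum_{j=1}^N f^j\bullet\mathfrak C_j\quad\text{for some semi-basic }(p+1)\text{-forms } f^1,\dots,f^N \text{ on } Z .$$ A Hamiltonian form $F$ is *first class* if $\{[F,\mathfrak C_j]\}\approx 0$ for every $j$. Then, if $F$ and $G$ are first-class Hamiltonian forms of degrees $p,q\in\{0,\dots,n-1\}$ with $p+q\ge n-1$, their bracket $\{[F,G]\}$ is first class: it is a semi-basic Hamiltonian form, and $\{[\{[F,G]\},\mathfrak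 C_j]\}\approx 0$ for every $j$. -/

import Mathlib

open scoped Manifold ContDiff

noncomputable section

namespace DeDonderWeyl

/-! ### Exterior algebra on the coordinate space

The base dimension is `n = d + 1` (so that `(n-1)`-forms are `d`-forms) and there are `m` field
components. A point of the coordinate space is `(x^μ, y^a, p_a^μ)`. -/

/-- The space of coordinates `(x^μ, y^a, p_a^μ)`. -/
abbrev Coord (d m : ℕ) : Type :=
  (Fin (d + 1) → ℝ) × (Fin m → ℝ) × (Fin m → Fin (d + 1) → ℝ)

/-- Exterior `k`-covectors at a point. -/
abbrev Covec (d m k : ℕ) : Type := Coord d m [⋀^Fin k]→L[ℝ] ℝ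

/-- `k`-vectors at a point. In finite dimension `⋀^k T` is canonically the dual of the space of
exterior `k`-covectors; the decomposable `k`-vector `w₁ ∧ ⋯ ∧ w_k` is `α ↦ α (w₁, …, w_k)`. -/
abbrev Multivec (d m k : ℕ) : Type := Covec d m k →L[ℝ] ℝ

variable {d m : ℕ}

theorem continuous_alternating {k : ℕ} (f : Coord d m [⋀^Fin k]→ₗ[ℝ] ℝ) : Continuous f := by
  let b := Module.finBasis ℝ (Coord d m)
  have h : ∀ v : Fin k → Coord d m,
      f v = ∑ r : Fin k → Fin (Module.finrank ℝ (Coord d m)),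
        (∏ i, b.repr (v i) (r i)) • f (fun i => b (r i)) := by
    intro v
    have hv : v = fun i => ∑ j, b.repr (v i) j • b j := by
      funext i
      exact (b.sum_repr (v i)).symm
    have h1 := f.toMultilinearMap.map_sum (fun i j => b.repr (v i) j • b j)
    rw [← hv] at h1
    refine h1.trans (Finset.sum_congr rfl fun r _ => ?_)
    exact f.toMultilinearMap.map_smul_univ (fun i => b.repr (v i) (r i)) (fun i => b (r i))
  have h2 : (f : (Fin k → Coord d m) → ℝ) = fun v =>
      ∑ r : Fin k → Fin (Module.finrank ℝ (Coord d m)),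
        (∏ i, b.repr (v i) (r i)) • f (fun i => b (r i)) := funext h
  rw [h2]
  have hc : ∀ j, Continuous fun x : Coord d m => b.repr x j := fun j =>
    LinearMap.continuous_of_finiteDimensional (b.coord j)
  simp only [smul_eq_mul]
  refine continuous_finsetSum _ fun r _ => Continuous.mul ?_ continuous_const
  exact continuous_finsetProd _ fun i _ => (hc (r i)).comp (continuous_apply i)

/-- An algebraic exterior covector, as a (automatically) continuous one. -/
def mkCovec {k : ℕ} (f : Coord d m [⋀^Fin k]→ₗ[ℝ] ℝ) : Covec d m k :=
  { f with cont := continuous_alternating f }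

/-- The wedge product, `(α ∧ β)(v) = ∑ sign(σ) α(v_{σ(1)}, …) β(v_{σ(a+1)}, …)`, the sum being over
shuffles; the proof of `a + b = N` fixes the name `N` of the degree. -/
def wedge {a b N : ℕ} (h : a + b = N) (α : Covec d m a) (β : Covec d m b) : Covec d m N :=
  mkCovec <| ((LinearMap.mul' ℝ ℝ).compAlternatingMap
    (α.toAlternatingMap.domCoprod β.toAlternatingMap)).domDomCongr
      (finSumFinEquiv.trans (finCongr h))

/-- The list `u₁, …, u_k, v₁, …, v_l`. -/
def appendVec {k l N : ℕ} (h : k + l = N) (u : Fin k → Coord d m) (v : Fin l → Coord d m) :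
    Fin N → Coord d m :=
  fun j => Fin.append u v (Fin.cast h.symm j)

theorem appendVec_update_left {k l N : ℕ} (h : k + l = N) (u : Fin k → Coord d m)
    (v : Fin l → Coord d m) (i : Fin k) (x : Coord d m) :
    appendVec h (Function.update u i x) v =
      Function.update (appendVec h u v) (Fin.cast h (Fin.castAdd l i)) x := by
  subst h
  funext j
  simp only [appendVec, Fin.cast_eq_self]
  induction j using Fin.addCases with
  | left j =>
    by_cases hj : j = i
    · subst hj; simp
    · have hne : Fin.castAdd l j ≠ Fin.castAdd l i := by simpa [Fin.ext_iff] using hj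
      rw [Function.update_of_ne hne]
      simp [hj, appendVec]
  | right j =>
    have hne : Fin.natAdd k j ≠ Fin.castAdd l i := by
      intro hh
      have := congrArg Fin.val hh
      simp at this
      omega
    rw [Function.update_of_ne hne]
    simp [appendVec]

theorem appendVec_update_right {k l N : ℕ} (h : k + l = N) (u : Fin k → Coord d m)
    (v : Fin l → Coord d m) (i : Fin l) (x : Coord d m) :
    appendVec h u (Function.update v i x) =
      Function.update (appendVec h u v) (Fin.cast h (Fin.natAdd k i)) x := by
  subst h
  funext j
  simp only [appendVec, Fin.cast_eq_self]
  induction j using Fin.addCases with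
  | right j =>
    by_cases hj : j = i
    · subst hj; simp
    · have hne : Fin.natAdd k j ≠ Fin.natAdd k i := by simpa [Fin.ext_iff] using hj
      rw [Function.update_of_ne hne]
      simp [hj, appendVec]
  | left j =>
    have hne : Fin.castAdd l j ≠ Fin.natAdd k i := by
      intro hh
      have := congrArg Fin.val hh
      simp at this
      omega
    rw [Function.update_of_ne hne]
    simp [appendVec]

/-- The `k`-covector `u ↦ η(u₁, …, u_k, v₁, …, v_l)`. -/
def evalLast {k l N : ℕ} (h : k + l = N) (η : Covec d m N) (v : Fin l → Coord d m) :
    Covec d m k :=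
  mkCovec
    { toFun := fun u => η (appendVec h u v)
      map_update_add' := by
        intro inst u i x y
        rw [Subsingleton.elim inst (instDecidableEqFin k)]
        simp only [appendVec_update_left, ContinuousAlternatingMap.map_update_add]
      map_update_smul' := by
        intro inst u i c x
        rw [Subsingleton.elim inst (instDecidableEqFin k)]
        simp only [appendVec_update_left, ContinuousAlternatingMap.map_update_smul]
      map_eq_zero_of_eq' := by
        intro u i j hij hne
        refine η.map_eq_zero_of_eq (i := Fin.cast h (Fin.castAdd l i))
          (j := Fin.cast h (Fin.castAdd l j)) _ ?_ ?_
        · simpa [appendVec] using hij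
        · simpa [Fin.ext_iff] using hne }

theorem evalLast_apply {k l N : ℕ} (h : k + l = N) (η : Covec d m N) (v : Fin l → Coord d m)
    (u : Fin k → Coord d m) :
    evalLast h η v u = η (appendVec h u v) := rfl

/-- The interior product `X ⌟ η` of a `k`-vector and a `(k+l)`-covector:
`((w₁ ∧ ⋯ ∧ w_k) ⌟ η)(v₁, …, v_l) = η(w₁, …, w_k, v₁, …, v_l)`, extended linearly. -/
def contract {k l N : ℕ} (h : k + l = N) (X : Multivec d m k) (η : Covec d m N) :
    Covec d m l :=
  mkCovec
    { toFun := fun v => X (evalLast h η v)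
      map_update_add' := by
        intro inst v i x y
        rw [Subsingleton.elim inst (instDecidableEqFin l), ← map_add]
        congr 1
        ext u
        simp only [ContinuousAlternatingMap.add_apply, evalLast_apply, appendVec_update_right,
          ContinuousAlternatingMap.map_update_add]
      map_update_smul' := by
        intro inst v i c x
        rw [Subsingleton.elim inst (instDecidableEqFin l), ← map_smul]
        congr 1
        ext u
        simp only [ContinuousAlternatingMap.smul_apply, evalLast_apply, appendVec_update_right,
          ContinuousAlternatingMap.map_update_smul]
      map_eq_zero_of_eq' := by
        intro v i j hij hne
        rw [← map_zero X]
        congr 1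
        ext u
        refine η.map_eq_zero_of_eq (i := Fin.cast h (Fin.natAdd k i))
          (j := Fin.cast h (Fin.natAdd k j)) _ ?_ ?_
        · simpa [appendVec] using hij
        · simpa [Fin.ext_iff] using hne }

/-- The decomposable `k`-vector `w₁ ∧ ⋯ ∧ w_k`. -/
def decomposable {k : ℕ} (w : Fin k → Coord d m) : Multivec d m k :=
  ContinuousAlternatingMap.apply ℝ (Coord d m) ℝ w

/-! ### Horizontal covectors, vertical multivectors, the canonical forms -/

/-- A vector is vertical (over the base `X`) if it has no component along the `x^μ`. -/
def IsVerticalVector (v : Coord d m) : Prop := v.1 = 0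

/-- Horizontal (semi-basic) covectors, the fibre of `⋀^k_0`: those annihilated by every vertical
vector. -/
def IsHorizontal {k : ℕ} (α : Covec d m k) : Prop :=
  ∀ (v : Fin k → Coord d m) (i : Fin k), IsVerticalVector (v i) → α v = 0

/-- A `k`-vector is vertical if it annihilates the horizontal covectors. -/
def IsVertical {k : ℕ} (X : Multivec d m k) : Prop :=
  ∀ α : Covec d m k, IsHorizontal α → X α = 0

/-- The coordinate vector `∂_μ` along the base. -/
def baseVec (μ : Fin (d + 1)) : Coord d m := (Pi.single μ 1, 0, 0)

/-- The volume form `ω = dx^1 ∧ ⋯ ∧ dx^n` of the base. -/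
def volForm (d m : ℕ) : Covec d m (d + 1) :=
  mkCovec <| (Matrix.detRowAlternating (R := ℝ) (n := Fin (d + 1))).compLinearMap
    (LinearMap.fst ℝ (Fin (d + 1) → ℝ) ((Fin m → ℝ) × (Fin m → Fin (d + 1) → ℝ)))

/-- `ω_μ = ∂_μ ⌟ ω`. -/
def omegaLower (μ : Fin (d + 1)) : Covec d m d :=
  contract (Nat.add_comm 1 d) (decomposable fun _ : Fin 1 => baseVec μ) (volForm d m)

/-- The one-form `dy^a`. -/
def dy (a : Fin m) : Covec d m 1 :=
  ContinuousAlternatingMap.ofSubsingleton ℝ (Coord d m) ℝ (0 : Fin 1)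
    ((ContinuousLinearMap.proj a).comp ((ContinuousLinearMap.fst ℝ _ _).comp
      (ContinuousLinearMap.snd ℝ (Fin (d + 1) → ℝ)
        ((Fin m → ℝ) × (Fin m → Fin (d + 1) → ℝ)))))

/-- The representative `p_a^μ dy^a ∧ ω_μ` of the canonical class `Θ` modulo `⋀^n_0`. -/
def canonicalForm (d m : ℕ) (u : Coord d m) : Covec d m (d + 1) :=
  ∑ a : Fin m, ∑ μ : Fin (d + 1), u.2.2 a μ • wedge (Nat.add_comm 1 d) (dy a) (omegaLower μ)

/-- The representative `d(p_a^μ dy^a ∧ ω_μ) = - dy^a ∧ dp_a^μ ∧ ω_μ` of the polysymplectic class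
`Ω` modulo `⋀^{n+1}_1`. -/
def polysymplecticForm (d m : ℕ) (u : Coord d m) : Covec d m (d + 1 + 1) :=
  extDeriv (canonicalForm d m) u

/-! ### Hodge star and co-exterior product of horizontal covectors

`ε` is the list of signs of a metric on the base with volume form `ω`, taken in the form
`diag(ε_1, …, ε_n)`. The co-exterior product depends on the metric only through `ω` and
`σ = ∏ ε_μ`: it is `(a ⌟ ω) • (b ⌟ ω) = σ (a ∧ b) ⌟ ω` for multivectors `a`, `b` on the base. -/

/-- The multivector obtained from a `p`-covector by raising the base indices,
`(1/p!) α^{μ_1 … μ_p} ∂_{μ_1} ∧ ⋯ ∧ ∂_{μ_p}`. -/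
def sharp (ε : Fin (d + 1) → ℤˣ) {p : ℕ} (α : Covec d m p) : Multivec d m p :=
  ((Nat.factorial p : ℝ)⁻¹) • ∑ i : Fin p → Fin (d + 1),
    ((∏ k, (((ε (i k) : ℤˣ) : ℤ) : ℝ)) * α (fun k => baseVec (i k))) •
      decomposable (fun k => baseVec (i k))

/-- The Hodge star `* α = α^♯ ⌟ ω`. -/
def hodge (ε : Fin (d + 1) → ℤˣ) {p l : ℕ} (h : p + l = d + 1) (α : Covec d m p) :
    Covec d m l :=
  contract h (sharp ε α) (volForm d m)

/-- The inverse Hodge star `*⁻¹ = σ (-1)^{r(n-r)} *` from `l`-covectors to `r`-covectors,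
`r + l = n`. -/
def hodgeInv (ε : Fin (d + 1) → ℤˣ) {r l : ℕ} (h : r + l = d + 1) (β : Covec d m l) :
    Covec d m r :=
  ((∏ μ, (((ε μ : ℤˣ) : ℤ) : ℝ)) * (-1) ^ (r * l)) • hodge ε (by omega : l + r = d + 1) β

/-- The co-exterior product `α • β = *⁻¹(*α ∧ *β)`, of degree `r = a + b - n`. -/
def coExterior (ε : Fin (d + 1) → ℤˣ) {a b r : ℕ} (ha : a ≤ d + 1) (hb : b ≤ d + 1)
    (h : a + b = d + 1 + r) (α : Covec d m a) (β : Covec d m b) : Covec d m r :=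
  hodgeInv ε (by omega : r + (d + 1 - r) = d + 1)
    (wedge (by omega : (d + 1 - a) + (d + 1 - b) = d + 1 - r)
      (hodge ε (by omega : a + (d + 1 - a) = d + 1) α)
      (hodge ε (by omega : b + (d + 1 - b) = d + 1) β))

/-! ### The extended polymomentum phase space -/

/-- `f` is a change of natural coordinates near `u`: it preserves the fibres of `Z → X` and of
`Z → Y`, the volume form `ω` of the base, and the canonical class `[p_a^μ dy^a ∧ ω_μ]` modulo
horizontal forms (equivalently `p'_b^ν = p_a^μ (∂y^a/∂y'^b) (∂x'^ν/∂x^μ)`). -/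
structure IsNaturalChange (f : Coord d m → Coord d m) (u : Coord d m) : Prop where
  base : ∀ v : Coord d m, v.1 = 0 → (fderiv ℝ f u v).1 = 0
  config : ∀ v : Coord d m, v.1 = 0 → v.2.1 = 0 → (fderiv ℝ f u v).2.1 = 0
  volume : (volForm d m).compContinuousLinearMap (fderiv ℝ f u) = volForm d m
  canonical : IsHorizontal
    ((canonicalForm d m (f u)).compContinuousLinearMap (fderiv ℝ f u) - canonicalForm d m u)

/-- The extended polymomentum phase space `Z = ⋀^n_1(Y) / ⋀^n_0(Y)` of a bundle `Y → X` with `m`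
field components over an `n = d + 1` dimensional base with volume form `ω`, presented by its atlas
of natural coordinates `(x^μ, y^a, p_a^μ)`, the `x^μ` being chosen so that
`ω = dx^1 ∧ ⋯ ∧ dx^n`. -/
class PolymomentumPhaseSpace (d m : ℕ) (Z : Type*) [TopologicalSpace Z]
    [ChartedSpace (Coord d m) Z] : Prop extends IsManifold 𝓘(ℝ, Coord d m) ∞ Z where
  natural : ∀ e ∈ atlas (Coord d m) Z, ∀ e' ∈ atlas (Coord d m) Z,
    ∀ u ∈ (e.symm ≫ₕ e').source, IsNaturalChange (e.symm ≫ₕ e') u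

/-! ### Forms and multivector fields on the phase space

They are given by their local expressions in all charts of the atlas. Only the values on the
targets of the charts matter. -/

/-- The local expressions of a differential `k`-form. -/
abbrev FormFamily (d m : ℕ) (Z : Type*) [TopologicalSpace Z] [ChartedSpace (Coord d m) Z]
    (k : ℕ) : Type _ :=
  atlas (Coord d m) Z → Coord d m → Covec d m k

/-- The local expressions of a `k`-vector field. -/
abbrev MultivecFamily (d m : ℕ) (Z : Type*) [TopologicalSpace Z] [ChartedSpace (Coord d m) Z]
    (k : ℕ) : Type _ :=
  atlas (Coord d m) Z → Coord d m → Multivec d m k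

variable {Z : Type*} [TopologicalSpace Z] [ChartedSpace (Coord d m) Z]

/-- The local expressions are smooth and related by pullback along the coordinate changes, that is,
they form a smooth differential form on `Z`. -/
structure IsSmoothForm {k : ℕ} (F : FormFamily d m Z k) : Prop where
  smooth : ∀ e, ContDiffOn ℝ ∞ (F e) e.1.target
  compat : ∀ e e', ∀ u ∈ (e.1.symm ≫ₕ e'.1).source,
    F e u = (F e' ((e.1.symm ≫ₕ e'.1) u)).compContinuousLinearMap
      (fderiv ℝ (e.1.symm ≫ₕ e'.1) u)

/-- The local expressions are smooth and related by pushforward along the coordinate changes, that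
is, they form a smooth multivector field on `Z`. -/
structure IsSmoothMultivec {k : ℕ} (X : MultivecFamily d m Z k) : Prop where
  smooth : ∀ e, ContDiffOn ℝ ∞ (X e) e.1.target
  compat : ∀ e e', ∀ u ∈ (e.1.symm ≫ₕ e'.1).source, ∀ α : Covec d m k,
    X e' ((e.1.symm ≫ₕ e'.1) u) α =
      X e u (α.compContinuousLinearMap (fderiv ℝ (e.1.symm ≫ₕ e'.1) u))

/-- A smooth horizontal (semi-basic) form. -/
def IsHorizontalForm {k : ℕ} (F : FormFamily d m Z k) : Prop :=
  IsSmoothForm F ∧ ∀ e, ∀ u ∈ e.1.target, IsHorizontal (F e u)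

/-- `X` is a Hamiltonian multivector field of degree `n - p` of the `p`-form `F`: a vertical
multivector field with `X ⌟ Ω = dF`. As `Ω` is a class modulo `⋀^{n+1}_1`, and the interior product
of a vertical `(n-p)`-vector with an element of `⋀^{n+1}_1` is horizontal, this is an equality of
classes modulo horizontal forms. -/
structure IsHamiltonianField {p : ℕ} (hp : p ≤ d) (X : MultivecFamily d m Z (d + 1 - p))
    (F : FormFamily d m Z p) : Prop where
  isSmooth : IsSmoothMultivec X
  vertical : ∀ e, ∀ u ∈ e.1.target, IsVertical (X e u)
  eq : ∀ e, ∀ u ∈ e.1.target, IsHorizontal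
    (contract (by omega : (d + 1 - p) + (p + 1) = d + 1 + 1) (X e u) (polysymplecticForm d m u)
      - extDeriv (F e) u)

/-- Semi-basic Hamiltonian `p`-forms, `0 ≤ p ≤ n - 1`. -/
def IsHamiltonianForm {p : ℕ} (hp : p ≤ d) (F : FormFamily d m Z p) : Prop :=
  IsHorizontalForm F ∧ ∃ X : MultivecFamily d m Z (d + 1 - p), IsHamiltonianField hp X F

open Classical in
/-- A Hamiltonian multivector field `X_F` of `F` (some choice of it; zero if there is none). -/
def hamiltonianField {p : ℕ} (hp : p ≤ d) (F : FormFamily d m Z p) :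
    MultivecFamily d m Z (d + 1 - p) :=
  if h : ∃ X : MultivecFamily d m Z (d + 1 - p), IsHamiltonianField hp X F then h.choose else 0

/-- The Poisson–Gerstenhaber bracket `{[F, G]} = (-1)^{n-p} X_F ⌟ dG` of a `p`-form and a `q`-form,
of degree `r = p + q - (n - 1)`. -/
def pgBracket {p q r : ℕ} (hp : p ≤ d) (h : p + q = d + r) (F : FormFamily d m Z p)
    (G : FormFamily d m Z q) : FormFamily d m Z r :=
  fun e u => (-1 : ℝ) ^ (d + 1 - p) •
    contract (by omega : (d + 1 - p) + r = q + 1) (hamiltonianField hp F e u) (extDeriv (G e) u)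

/-! ### Constraints, weak vanishing, first-class forms -/

/-- `K ≈ 0`: the `p`-form `K` is a combination `∑_j f^j • C_j` of the constraint `(n-1)`-forms with
smooth horizontal `(p+1)`-forms `f^j` as coefficients. -/
def WeaklyVanishes (ε : Fin (d + 1) → ℤˣ) {ι : Type*} [Fintype ι] (C : ι → FormFamily d m Z d)
    {p : ℕ} (hp : p ≤ d) (K : FormFamily d m Z p) : Prop :=
  ∃ f : ι → FormFamily d m Z (p + 1), (∀ j, IsHorizontalForm (f j)) ∧
    ∀ e, ∀ u ∈ e.1.target, K e u = ∑ j, coExterior ε (Nat.succ_le_succ hp) (Nat.le_succ d)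
      (by omega : (p + 1) + d = d + 1 + p) (f j e u) (C j e u)

/-- A first-class form: a semi-basic Hamiltonian form whose bracket with every constraint
`(n-1)`-form vanishes weakly. -/
def IsFirstClass (ε : Fin (d + 1) → ℤˣ) {ι : Type*} [Fintype ι] (C : ι → FormFamily d m Z d)
    {p : ℕ} (hp : p ≤ d) (F : FormFamily d m Z p) : Prop :=
  IsHamiltonianForm hp F ∧
    ∀ j, WeaklyVanishes ε C hp (pgBracket hp (Nat.add_comm p d) F (C j))

end DeDonderWeyl

end

noncomputable section

set_option maxSynthPendingDepth 3

namespace DeDonderWeyl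

variable {d m : ℕ}

/-! ### Exterior algebra -/

/-! The proof is the classical one, Jacobi plus Leibniz, with care for graded signs and for the
non-uniqueness of Hamiltonian multivector fields.

In a natural chart let e_A run over the fibre directions. A vertical multivector X of degree k+1
acts, on covectors that become horizontal after inserting any e_A, only through components X_A of
degree k. If G is semi-basic then e_A ⌟ dG = ∂_A G, so the bracket becomes (-1)^{k+1} ∑ X_A ⌟ ∂_A G
(`pgBracket_eq_localBracket`). Hamilton's equation becomes ∂_B F = (-1)^{k+1} ∑ X_A ⌟ Ω_{BA}, where
Ω_{BA} = e_A ⌟ e_B ⌟ Ω is horizontal, antisymmetric and constant, because the canonical form is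
linear in the point (`isHorizontal_contract_sub_iff`).

The bracket is Hamiltonian: differentiating Hamilton's equations and using symmetry of second
derivatives gives ∑ ∂_C X_A ⌟ Ω_{BA} = ∑ ∂_B X_A ⌟ Ω_{CA}. With antisymmetry of Ω, the derivative of
the bracket is then again of Hamiltonian form, with components given by a graded commutator of X and
Y (`HamiltonEquations.bracket`). Nondegeneracy of Ω is never needed. These components are built
chart by chart. Hamilton's equation is linear in X and invariant under natural coordinate changes,
so a partition of unity glues the local solutions (`exists_isHamiltonianField`).

Jacobi: the commutator acts on a constraint as the graded commutator of the two actions, since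
second derivatives cancel (`localBracket_jacobi`). The field chosen for the bracket need not be this
commutator, but antisymmetry shows that a bracket of two Hamiltonian forms does not depend on the
choice (`pgBracket_jacobi`).

Weak vanishing is preserved: if φ ⌟ ω = α then α • β is a fixed sign times φ ⌟ β
(`exists_coExterior_contract`). Hence • is associative up to a constant and the bracket obeys a
Leibniz rule with constant coefficients. So {F, ∑ f^j • C_j} is again a combination of the
constraints when F is first class (`IsFirstClass.weaklyVanishes_pgBracket`). Applying this to both
terms of the Jacobi identity finishes the proof. -/

theorem mkCovec_apply {k : ℕ} (f : Coord d m [⋀^Fin k]→ₗ[ℝ] ℝ) (v : Fin k → Coord d m) :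
    mkCovec f v = f v := rfl

theorem contract_apply {k l N : ℕ} (h : k + l = N) (X : Multivec d m k) (η : Covec d m N)
    (v : Fin l → Coord d m) : contract h X η v = X (evalLast h η v) := rfl

theorem decomposable_apply {k : ℕ} (w : Fin k → Coord d m) (α : Covec d m k) :
    decomposable w α = α w := rfl

theorem contract_decomposable_apply {k l N : ℕ} (h : k + l = N) (w : Fin k → Coord d m)
    (η : Covec d m N) (v : Fin l → Coord d m) :
    contract h (decomposable w) η v = η (appendVec h w v) := rfl

theorem appendVec_eq {k l N : ℕ} (h : k + l = N) (u : Fin k → Coord d m)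
    (v : Fin l → Coord d m) (j : Fin N) :
    appendVec h u v j =
      if hj : j.val < k then u ⟨j.val, hj⟩ else v ⟨j.val - k, by omega⟩ := by
  subst h
  simp only [appendVec, Fin.cast_eq_self]
  induction j using Fin.addCases with
  | left j => simp
  | right j => simp

/-- Finite dimension makes every algebraic linear or bilinear operation below continuous, hence
smooth, with no norm estimates. -/
instance finiteDimensional_covec {k : ℕ} : FiniteDimensional ℝ (Covec d m k) := by
  refine Module.Finite.of_injective (N := MultilinearMap ℝ (fun _ : Fin k => Coord d m) ℝ)
    ((AlternatingMap.toMultilinearMapLM (R := ℝ) (S := ℝ)).comp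
      (ContinuousAlternatingMap.toAlternatingMapLinear (R := ℝ) (A := ℝ))) ?_
  intro a b h
  ext v
  exact DFunLike.congr_fun h v

instance finiteDimensional_multivec {k : ℕ} : FiniteDimensional ℝ (Multivec d m k) :=
  ContinuousLinearMap.instModuleFinite

theorem evalLast_add {k l N : ℕ} (h : k + l = N) (η ζ : Covec d m N) (v : Fin l → Coord d m) :
    evalLast h (η + ζ) v = evalLast h η v + evalLast h ζ v := rfl

theorem evalLast_smul {k l N : ℕ} (h : k + l = N) (c : ℝ) (η : Covec d m N)
    (v : Fin l → Coord d m) :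
    evalLast h (c • η) v = c • evalLast h η v := rfl

/-- The interior product as a continuous bilinear map. -/
def contractL {k l N : ℕ} (h : k + l = N) :
    Multivec d m k →L[ℝ] Covec d m N →L[ℝ] Covec d m l :=
  LinearMap.toContinuousBilinearMap <| LinearMap.mk₂ ℝ (contract h)
    (fun _ _ _ => rfl) (fun _ _ _ => rfl)
    (fun X η ζ => by ext v; simp [contract_apply, evalLast_add])
    (fun c X η => by ext v; simp [contract_apply, evalLast_smul])

theorem contractL_apply {k l N : ℕ} (h : k + l = N) (X : Multivec d m k) (η : Covec d m N) :
    contractL h X η = contract h X η := rfl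

section Linear
variable {k l N : ℕ} (h : k + l = N)

theorem contract_add_left (X Y : Multivec d m k) (η : Covec d m N) :
    contract h (X + Y) η = contract h X η + contract h Y η := rfl

theorem contract_smul_left (c : ℝ) (X : Multivec d m k) (η : Covec d m N) :
    contract h (c • X) η = c • contract h X η := rfl

theorem contract_sub_left (X Y : Multivec d m k) (η : Covec d m N) :
    contract h (X - Y) η = contract h X η - contract h Y η := rfl

theorem contract_add_right (X : Multivec d m k) (η ζ : Covec d m N) :
    contract h X (η + ζ) = contract h X η + contract h X ζ := map_add (contractL h X) η ζ

theorem contract_sub_right (X : Multivec d m k) (η ζ : Covec d m N) :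
    contract h X (η - ζ) = contract h X η - contract h X ζ := map_sub (contractL h X) η ζ

theorem contract_smul_right (c : ℝ) (X : Multivec d m k) (η : Covec d m N) :
    contract h X (c • η) = c • contract h X η := map_smul (contractL h X) c η

theorem contract_neg_right (X : Multivec d m k) (η : Covec d m N) :
    contract h X (-η) = -contract h X η := map_neg (contractL h X) η

theorem contract_zero_right (X : Multivec d m k) :
    contract h X (0 : Covec d m N) = 0 := map_zero (contractL h X)

theorem contract_sum_left {κ : Type*} (s : Finset κ) (X : κ → Multivec d m k) (η : Covec d m N) :
    contract h (∑ i ∈ s, X i) η = ∑ i ∈ s, contract h (X i) η := by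
  simp only [← contractL_apply, map_sum, sum_apply]

theorem contract_sum_right {κ : Type*} (s : Finset κ) (X : Multivec d m k)
    (η : κ → Covec d m N) :
    contract h X (∑ i ∈ s, η i) = ∑ i ∈ s, contract h X (η i) := by
  simp only [← contractL_apply, map_sum]

end Linear

/-- A covector killed by all decomposable multivectors is zero, so in finite dimension these span
the dual. Identities linear in a multivector may therefore be checked on decomposables. -/
theorem multivec_induction {k : ℕ} {P : Multivec d m k → Prop}
    (dec : ∀ w, P (decomposable w)) (add : ∀ X Y, P X → P Y → P (X + Y))
    (smul : ∀ (c : ℝ) X, P X → P (c • X)) (X : Multivec d m k) : P X := by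
  have hspan : Submodule.span ℝ (Set.range fun w : Fin k → Coord d m =>
      (decomposable w : Covec d m k →ₗ[ℝ] ℝ)) = ⊤ := by
    refine Submodule.span_eq_top_of_ne_zero fun α hα => ?_
    by_contra! hne
    refine hα (ContinuousAlternatingMap.ext fun w => ?_)
    exact hne _ ⟨w, rfl⟩
  have hP0 : P 0 := by
    have := smul 0 _ (dec 0)
    rwa [zero_smul] at this
  have hP : ∀ f : Covec d m k →ₗ[ℝ] ℝ, P (LinearMap.toContinuousLinearMap f) := by
    intro f
    have hf : f ∈ Submodule.span ℝ (Set.range fun w : Fin k → Coord d m =>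
      (decomposable w : Covec d m k →ₗ[ℝ] ℝ)) := hspan ▸ Submodule.mem_top
    refine Submodule.span_induction (p := fun f _ => P (LinearMap.toContinuousLinearMap f))
      ?_ ?_ ?_ ?_ hf
    · rintro _ ⟨w, rfl⟩
      exact dec w
    · rwa [map_zero]
    · intro f g _ _ hf hg
      rw [map_add]
      exact add _ _ hf hg
    · intro c f _ hf
      rw [map_smul]
      exact smul c _ hf
  exact hP X

/-- The interior product with a vector. -/
def insertVec {l N : ℕ} (h : 1 + l = N) (v : Coord d m) (η : Covec d m N) : Covec d m l :=
  contract h (decomposable fun _ => v) η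

theorem insertVec_apply {l N : ℕ} (h : 1 + l = N) (v : Coord d m) (η : Covec d m N)
    (u : Fin l → Coord d m) : insertVec h v η u = η (appendVec h (fun _ => v) u) := rfl

theorem appendVec_one {l : ℕ} (v : Coord d m) (u : Fin l → Coord d m) :
    appendVec (Nat.add_comm 1 l) (fun _ => v) u = Fin.cons v u := by
  funext j
  rw [appendVec_eq]
  refine Fin.cases ?_ (fun j => ?_) j <;> simp

theorem insertVec_apply' {l : ℕ} (v : Coord d m) (η : Covec d m (l + 1))
    (u : Fin l → Coord d m) : insertVec (Nat.add_comm 1 l) v η u = η (Fin.cons v u) := by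
  rw [insertVec_apply, appendVec_one]

theorem insertVec_insertVec {l N M : ℕ} (h : 1 + l = N) (h' : 1 + N = M) (v w : Coord d m)
    (η : Covec d m M) : insertVec h v (insertVec h' w η) = -insertVec h w (insertVec h' v η) := by
  ext u
  rw [ContinuousAlternatingMap.neg_apply]
  simp only [insertVec_apply]
  have h01 : (⟨0, by omega⟩ : Fin M) ≠ ⟨1, by omega⟩ := by simp
  have := η.toAlternatingMap.map_swap
    (appendVec h' (fun _ => v) (appendVec h (fun _ => w) u)) h01
  refine Eq.trans ?_ this
  refine congrArg η (funext fun j => ?_)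
  simp only [Function.comp_apply, Equiv.swap_apply_def, appendVec_eq, Fin.ext_iff]
  rcases j with ⟨j, hj⟩
  rcases j with _ | _ | j <;> simp

/-- The first factor of a decomposable multivector is inserted first. Peeling it off is the step of
all inductions on degree. -/
theorem contract_decomposable_cons {k k' l N N' : ℕ} (hk : 1 + k = k') (h : k' + l = N)
    (h1 : 1 + N' = N) (h2 : k + l = N') (x : Coord d m) (w : Fin k → Coord d m)
    (η : Covec d m N) :
    contract h (decomposable (appendVec hk (fun _ => x) w)) η =
      contract h2 (decomposable w) (insertVec h1 x η) := by
  ext v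
  simp only [contract_decomposable_apply, insertVec_apply]
  refine congrArg η (funext fun j => ?_)
  simp only [appendVec_eq]
  rcases j with ⟨j, hj⟩
  rcases j with _ | j
  · have : 0 < k' := by omega
    simp [this]
  · by_cases h3 : j < k
    · have : j + 1 < k' := by omega
      simp [this, h3]
    · have : ¬ j + 1 < k' := by omega
      simp only [this, h3, dif_neg, not_false_eq_true, Nat.lt_one_iff, Nat.add_eq_zero_iff,
        one_ne_zero, and_false, Nat.add_sub_cancel]
      congr 2
      omega

theorem eq_appendVec_cons {k k' : ℕ} (hk : 1 + k = k') (w : Fin k' → Coord d m) :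
    w = appendVec hk (fun _ => w ⟨0, by omega⟩) (fun j => w ⟨j.val + 1, by omega⟩) := by
  funext j
  rw [appendVec_eq]
  rcases j with ⟨j, hj⟩
  rcases j with _ | j <;> simp

theorem contract_decomposable_zero {l N : ℕ} (h : 0 + l = N) (w : Fin 0 → Coord d m)
    (η : Covec d m N) (v : Fin l → Coord d m) :
    contract h (decomposable w) η v = η (fun j => v (Fin.cast (by omega) j)) := by
  rw [contract_decomposable_apply]
  refine congrArg η (funext fun j => ?_)
  rw [appendVec_eq]
  simp
  rfl

/-- Each of the k factors anticommutes with the insertion of `v`, which produces the sign. -/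
theorem insertVec_contract_decomposable {k : ℕ} (w : Fin k → Coord d m) :
    ∀ {l r N N' : ℕ} (h1 : k + r = N) (h2 : 1 + l = r) (h3 : 1 + N' = N) (h4 : k + l = N')
      (v : Coord d m) (η : Covec d m N),
    insertVec h2 v (contract h1 (decomposable w) η) =
      (-1 : ℝ) ^ k • contract h4 (decomposable w) (insertVec h3 v η) := by
  induction k with
  | zero =>
    intro l r N N' h1 h2 h3 h4 v η
    obtain rfl : r = N := by omega
    obtain rfl : l = N' := by omega
    ext u
    simp [contract_decomposable_zero, insertVec_apply]
  | succ k ih =>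
    intro l r N N' h1 h2 h3 h4 v η
    obtain rfl : k + r = N' := by omega
    rw [eq_appendVec_cons (Nat.add_comm 1 k) w,
      contract_decomposable_cons _ h1 (by omega : 1 + (k + r) = N) rfl,
      contract_decomposable_cons _ h4 (by omega : 1 + (k + l) = k + r) rfl,
      ih _ rfl h2 (by omega) rfl, insertVec_insertVec _ _ v]
    rw [contract_neg_right, smul_neg, pow_succ, mul_neg_one]
    exact (neg_smul ((-1 : ℝ) ^ k) (_ : Covec d m l)).symm

/-- Graded commutation of interior products, the source of almost every sign below. By linearity
both multivectors are decomposable, and the factors of `Y` are moved past `X` one at a time. -/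
theorem contract_contract {k l r N N₁ N₂ : ℕ} (h1 : k + N₁ = N) (h2 : l + r = N₁)
    (h3 : l + N₂ = N) (h4 : k + r = N₂) (X : Multivec d m k) (Y : Multivec d m l)
    (η : Covec d m N) :
    contract h2 Y (contract h1 X η) = (-1 : ℝ) ^ (k * l) • contract h4 X (contract h3 Y η) := by
  induction Y using multivec_induction with
  | add Y Z hY hZ => simp only [contract_add_left, contract_add_right, hY, hZ, smul_add]
  | smul c Y hY =>
    simp only [contract_smul_left, contract_smul_right, hY]
    rw [smul_comm]
  | dec w =>
  induction X using multivec_induction with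
  | add Y Z hY hZ => simp only [contract_add_left, contract_add_right, hY, hZ, smul_add]
  | smul c Y hY =>
    simp only [contract_smul_left, contract_smul_right, hY]
    rw [smul_comm]
  | dec x =>
  induction l generalizing r N N₁ N₂ with
  | zero =>
    obtain rfl : r = N₁ := by omega
    obtain rfl : N₂ = N := by omega
    have hz : ∀ (M : ℕ) (h : 0 + M = M) (ζ : Covec d m M),
        contract h (decomposable w) ζ = ζ := by
      intro M h ζ
      ext v
      rw [contract_decomposable_zero]
      simp
    simp [hz]
  | succ l ih =>
    rw [eq_appendVec_cons (Nat.add_comm 1 l) w,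
      contract_decomposable_cons _ h2 (by omega : 1 + (l + r) = N₁) rfl,
      contract_decomposable_cons _ h3 (by omega : 1 + (l + N₂) = N) rfl,
      insertVec_contract_decomposable _ _ _ (by omega) (by omega : k + (l + r) = l + N₂),
      contract_smul_right, ih _ _ rfl h4, smul_smul, ← pow_add]
    congr 2
    ring

theorem insertVec_contract {k l r N N' : ℕ} (h1 : k + r = N) (h2 : 1 + l = r) (h3 : 1 + N' = N)
    (h4 : k + l = N') (v : Coord d m) (X : Multivec d m k) (η : Covec d m N) :
    insertVec h2 v (contract h1 X η) = (-1 : ℝ) ^ k • contract h4 X (insertVec h3 v η) := by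
  rw [insertVec, contract_contract h1 h2 h3 h4, mul_one]
  rfl

/-- The exterior product of multivectors. -/
def mwedge {k l N : ℕ} (h : k + l = N) (X : Multivec d m k) (Y : Multivec d m l) :
    Multivec d m N :=
  Y.comp (contractL h X)

theorem mwedge_apply {k l N : ℕ} (h : k + l = N) (X : Multivec d m k) (Y : Multivec d m l)
    (α : Covec d m N) : mwedge h X Y α = Y (contract h X α) := rfl

theorem evalLast_contract {k l r N N₁ N₂ : ℕ} (h1 : k + N₁ = N) (h2 : l + r = N₁)
    (h3 : N₂ + r = N) (h4 : k + l = N₂) (X : Multivec d m k) (η : Covec d m N)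
    (v : Fin r → Coord d m) :
    evalLast h2 (contract h1 X η) v = contract h4 X (evalLast h3 η v) := by
  ext w
  rw [evalLast_apply, contract_apply, contract_apply]
  congr 1
  ext u
  simp only [evalLast_apply]
  refine congrArg η (funext fun j => ?_)
  simp only [appendVec_eq]
  by_cases h5 : j.val < k
  · have : j.val < N₂ := by omega
    simp [h5, this]
  · by_cases h6 : j.val < N₂
    · have : j.val - k < l := by omega
      simp [h5, this, h6]
    · have : ¬ j.val - k < l := by omega
      simp only [h5, this, h6, dif_neg, not_false_eq_true]
      congr 2
      omega

theorem contract_mwedge {k l r N N₁ N₂ : ℕ} (h1 : k + N₁ = N) (h2 : l + r = N₁)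
    (h3 : N₂ + r = N) (h4 : k + l = N₂) (X : Multivec d m k) (Y : Multivec d m l)
    (η : Covec d m N) :
    contract h3 (mwedge h4 X Y) η = contract h2 Y (contract h1 X η) := by
  ext v
  rw [contract_apply, contract_apply, mwedge_apply, evalLast_contract h1 h2 h3 h4]

/-- The push-forward of a multivector by a linear map. -/
def push {k : ℕ} (A : Coord d m →L[ℝ] Coord d m) (X : Multivec d m k) : Multivec d m k :=
  X.comp (LinearMap.toContinuousLinearMap
    (ContinuousAlternatingMap.compContinuousLinearMapₗ (R := ℝ) (N := ℝ) (ι := Fin k) A))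

theorem push_apply {k : ℕ} (A : Coord d m →L[ℝ] Coord d m) (X : Multivec d m k)
    (α : Covec d m k) : push A X α = X (α.compContinuousLinearMap A) := rfl

/-- Naturality of the interior product; it makes contractions of tensorial families compatible
between charts. -/
theorem contract_push {k l N : ℕ} (h : k + l = N) (A : Coord d m →L[ℝ] Coord d m)
    (X : Multivec d m k) (η : Covec d m N) :
    (contract h (push A X) η).compContinuousLinearMap A =
      contract h X (η.compContinuousLinearMap A) := by
  ext v
  rw [ContinuousAlternatingMap.compContinuousLinearMap_apply, contract_apply, contract_apply,
    push_apply]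
  congr 1
  ext u
  simp only [ContinuousAlternatingMap.compContinuousLinearMap_apply, evalLast_apply]
  refine congrArg η (funext fun j => ?_)
  simp only [appendVec_eq, Function.comp_apply]
  split_ifs <;> rfl

/-! ### Horizontal covectors -/

section Horizontal
variable {k l N : ℕ}

theorem isHorizontal_zero : IsHorizontal (0 : Covec d m k) := fun _ _ _ => rfl

theorem IsHorizontal.add {α β : Covec d m k} (hα : IsHorizontal α) (hβ : IsHorizontal β) :
    IsHorizontal (α + β) := fun v i hv => by
  rw [ContinuousAlternatingMap.add_apply, hα v i hv, hβ v i hv, add_zero]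

theorem IsHorizontal.smul {α : Covec d m k} (c : ℝ) (hα : IsHorizontal α) :
    IsHorizontal (c • α) := fun v i hv => by
  rw [ContinuousAlternatingMap.smul_apply, hα v i hv, smul_zero]

theorem isHorizontal_sum {κ : Type*} (s : Finset κ) {α : κ → Covec d m k}
    (hα : ∀ i ∈ s, IsHorizontal (α i)) : IsHorizontal (∑ i ∈ s, α i) := fun v i hv => by
  rw [ContinuousAlternatingMap.sum_apply]
  exact Finset.sum_eq_zero fun j hj => hα j hj v i hv

theorem IsHorizontal.evalLast {h : k + l = N} {α : Covec d m N} (hα : IsHorizontal α)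
    (v : Fin l → Coord d m) : IsHorizontal (evalLast h α v) := fun u i hu => by
  rw [evalLast_apply]
  refine hα _ ⟨i.val, by omega⟩ ?_
  rw [appendVec_eq]
  simpa using hu

theorem IsHorizontal.contract {h : k + l = N} {α : Covec d m N} (hα : IsHorizontal α)
    (X : Multivec d m k) : IsHorizontal (contract h X α) := fun v i hv => by
  rw [contract_apply, ← map_zero X]
  congr 1
  ext u
  rw [evalLast_apply]
  refine hα _ ⟨k + i.val, by omega⟩ ?_
  rw [appendVec_eq]
  simpa using hv

theorem IsHorizontal.apply_congr {α : Covec d m k} (hα : IsHorizontal α)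
    {v w : Fin k → Coord d m} (hvw : ∀ i, (v i).1 = (w i).1) : α v = α w := by
  -- The arguments are replaced one at a time; each replacement changes one slot by a vertical
  -- vector.
  have key : ∀ s : Finset (Fin k), α (s.piecewise w v) = α v := by
    intro s
    induction s using Finset.induction_on with
    | empty => simp
    | insert i s his ih =>
      rw [Finset.piecewise_insert, ← ih]
      have h1 : w i = (s.piecewise w v) i + (w i - v i) := by
        rw [Finset.piecewise_eq_of_notMem _ _ _ his]
        abel
      rw [h1, ContinuousAlternatingMap.map_update_add, Function.update_eq_self,
        hα (Function.update (s.piecewise w v) i (w i - v i)) i (by simp [IsVerticalVector, hvw]),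
        add_zero]
  rw [← key Finset.univ, Finset.piecewise_univ]

theorem IsHorizontal.ext {α β : Covec d m k} (hα : IsHorizontal α) (hβ : IsHorizontal β)
    (h : ∀ I : Fin k → Fin (d + 1), α (fun i => baseVec (I i)) = β (fun i => baseVec (I i))) :
    α = β := by
  ext v
  let w : Fin k → Coord d m := fun i => ∑ μ, (v i).1 μ • baseVec μ
  have hw : ∀ i, (v i).1 = (w i).1 := by
    intro i
    funext ν
    simp [w, baseVec, Prod.fst_sum, Finset.sum_apply, Pi.single_apply]
  rw [hα.apply_congr hw, hβ.apply_congr hw]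
  have h1 := α.toMultilinearMap.map_sum (fun i μ => (v i).1 μ • (baseVec μ : Coord d m))
  have h2 := β.toMultilinearMap.map_sum (fun i μ => (v i).1 μ • (baseVec μ : Coord d m))
  refine h1.trans (Eq.trans (Finset.sum_congr rfl fun I _ => ?_) h2.symm)
  have h3 := α.toMultilinearMap.map_smul_univ (fun i => (v i).1 (I i)) (fun i => baseVec (I i))
  have h4 := β.toMultilinearMap.map_smul_univ (fun i => (v i).1 (I i)) (fun i => baseVec (I i))
  exact h3.trans ((congrArg _ (h I)).trans h4.symm)

end Horizontal

/-! ### Coordinate covectors on the base and the Hodge star -/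

/-- The coordinate covector `dx^{I_1} ∧ ⋯ ∧ dx^{I_k}`. -/
def dxList {k : ℕ} (I : Fin k → Fin (d + 1)) : Covec d m k :=
  mkCovec <| MultilinearMap.alternatization <|
    (MultilinearMap.mkPiAlgebra ℝ (Fin k) ℝ).compLinearMap fun i =>
      (LinearMap.proj (I i)).comp
        (LinearMap.fst ℝ (Fin (d + 1) → ℝ) ((Fin m → ℝ) × (Fin m → Fin (d + 1) → ℝ)))

theorem dxList_apply {k : ℕ} (I : Fin k → Fin (d + 1)) (v : Fin k → Coord d m) :
    dxList I v = ∑ σ : Equiv.Perm (Fin k), (Equiv.Perm.sign σ : ℤ) * ∏ i, (v (σ i)).1 (I i) := by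
  rw [dxList, mkCovec_apply, MultilinearMap.alternatization_apply]
  refine Finset.sum_congr rfl fun σ _ => ?_
  rw [Units.smul_def, zsmul_eq_mul]
  simp [MultilinearMap.domDomCongr_apply]

/-- The list of coordinate vectors `∂_{I_1}, …, ∂_{I_k}`. -/
def baseVecs {k : ℕ} (I : Fin k → Fin (d + 1)) : Fin k → Coord d m := fun i => baseVec (I i)

theorem dxList_baseVecs {k : ℕ} (I J : Fin k → Fin (d + 1)) :
    (dxList I : Covec d m k) (baseVecs J) =
      ∑ σ : Equiv.Perm (Fin k), if J = I ∘ σ.symm then ((Equiv.Perm.sign σ : ℤ) : ℝ) else 0 := by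
  rw [dxList_apply]
  refine Finset.sum_congr rfl fun σ _ => ?_
  have : ∏ i, ((baseVecs J (σ i) : Coord d m)).1 (I i) = if J = I ∘ σ.symm then 1 else 0 := by
    split_ifs with h
    · subst h
      simp [baseVecs, baseVec]
    · obtain ⟨j, hj⟩ := Function.ne_iff.mp h
      refine Finset.prod_eq_zero (Finset.mem_univ (σ.symm j)) ?_
      simp only [baseVecs, baseVec, Equiv.apply_symm_apply]
      rw [Pi.single_eq_of_ne]
      exact fun h => hj h.symm
  rw [this]
  simp

theorem isHorizontal_dxList {k : ℕ} (I : Fin k → Fin (d + 1)) :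
    IsHorizontal (dxList I : Covec d m k) := fun v i hv => by
  rw [dxList_apply]
  refine Finset.sum_eq_zero fun σ _ => ?_
  rw [Finset.prod_eq_zero (Finset.mem_univ (σ.symm i)), mul_zero]
  rw [Equiv.apply_symm_apply, show (v i).1 = 0 from hv, Pi.zero_apply]

theorem volForm_eq : volForm d m = dxList id := by
  ext v
  rw [dxList_apply, volForm, mkCovec_apply]
  exact Matrix.det_apply' _

theorem isHorizontal_volForm : IsHorizontal (volForm d m) := volForm_eq ▸ isHorizontal_dxList _

theorem dxList_comp_perm {k : ℕ} (I : Fin k → Fin (d + 1)) (hI : Function.Injective I)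
    (σ : Equiv.Perm (Fin k)) :
    (dxList I : Covec d m k) (baseVecs (I ∘ σ)) = ((Equiv.Perm.sign σ : ℤ) : ℝ) := by
  rw [dxList_baseVecs, Finset.sum_eq_single σ.symm]
  · rw [if_pos (by rw [Equiv.symm_symm]), Equiv.Perm.sign_symm]
  · intro τ _ hτ
    rw [if_neg]
    intro h
    apply hτ
    refine Equiv.ext fun i => ?_
    have h2 := hI (congrFun h (τ i))
    simp only [Equiv.symm_apply_apply] at h2
    rw [Equiv.eq_symm_apply, h2]
  · simp

/-- The sign `ε_{I_1} ⋯ ε_{I_k}`. -/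
def signProd (ε : Fin (d + 1) → ℤˣ) {k : ℕ} (I : Fin k → Fin (d + 1)) : ℝ :=
  ∏ i, (((ε (I i) : ℤˣ) : ℤ) : ℝ)

theorem signProd_mul_self (ε : Fin (d + 1) → ℤˣ) {k : ℕ} (I : Fin k → Fin (d + 1)) :
    signProd ε I * signProd ε I = 1 := by
  rw [signProd, ← Finset.prod_mul_distrib]
  refine Finset.prod_eq_one fun i _ => ?_
  rcases Int.units_eq_one_or (ε (I i)) with h | h <;> simp [h]

/-- Only the rearrangements of `I` contribute. The sign from `dxList` cancels the one from permuting
the arguments of `β`, so all k! permutations give the same term. -/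
theorem sum_dxList_mul {k : ℕ} (ε : Fin (d + 1) → ℤˣ) (I : Fin k → Fin (d + 1))
    (β : Covec d m k) :
    ∑ J : Fin k → Fin (d + 1), signProd ε J * (dxList I : Covec d m k) (baseVecs J) *
      β (baseVecs J) = (Nat.factorial k : ℝ) * (signProd ε I * β (baseVecs I)) := by
  simp only [dxList_baseVecs, Finset.mul_sum, Finset.sum_mul]
  rw [Finset.sum_comm]
  have : ∀ σ : Equiv.Perm (Fin k), ∑ J : Fin k → Fin (d + 1),
      (signProd ε J * if J = I ∘ σ.symm then ((Equiv.Perm.sign σ : ℤ) : ℝ) else 0) *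
        β (baseVecs J) = signProd ε I * β (baseVecs I) := by
    intro σ
    rw [Finset.sum_eq_single (I ∘ σ.symm)]
    · rw [if_pos rfl]
      have h1 : signProd ε (I ∘ σ.symm) = signProd ε I :=
        Equiv.prod_comp σ.symm fun i => (((ε (I i) : ℤˣ) : ℤ) : ℝ)
      have h2 : β (baseVecs (I ∘ σ.symm)) =
          ((Equiv.Perm.sign σ : ℤ) : ℝ) * β (baseVecs I) := by
        have := β.toAlternatingMap.map_perm (baseVecs I) σ.symm
        rw [← Equiv.Perm.inv_def, Equiv.Perm.sign_inv, Units.smul_def, zsmul_eq_mul] at this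
        exact this
      have h3 : ((Equiv.Perm.sign σ : ℤ) : ℝ) * ((Equiv.Perm.sign σ : ℤ) : ℝ) = 1 := by
        rcases Int.units_eq_one_or (Equiv.Perm.sign σ) with h | h <;> simp [h]
      rw [h1, h2]
      linear_combination (signProd ε I * β (baseVecs I)) * h3
    · intro J _ hJ
      rw [if_neg hJ]
      ring
    · simp
  rw [Finset.sum_congr rfl fun σ _ => this σ]
  simp [Fintype.card_perm]

theorem sharp_apply {p : ℕ} (ε : Fin (d + 1) → ℤˣ) (α β : Covec d m p) :
    sharp ε α β = ((Nat.factorial p : ℝ)⁻¹) *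
      ∑ J : Fin p → Fin (d + 1), signProd ε J * α (baseVecs J) * β (baseVecs J) := by
  rw [sharp, smul_apply, sum_apply]
  rfl

theorem sharp_dxList {p : ℕ} (ε : Fin (d + 1) → ℤˣ) (I : Fin p → Fin (d + 1)) :
    sharp ε (dxList I : Covec d m p) = signProd ε I • decomposable (baseVecs I) := by
  ext β
  rw [sharp_apply, sum_dxList_mul, ← mul_assoc, inv_mul_cancel₀ (by positivity), one_mul]
  rfl

theorem IsHorizontal.eq_sum {k : ℕ} {α : Covec d m k} (hα : IsHorizontal α) :
    α = ∑ I : Fin k → Fin (d + 1),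
      (((Nat.factorial k : ℝ)⁻¹) * α (baseVecs I)) • dxList I := by
  refine hα.ext (isHorizontal_sum _ fun I _ => (isHorizontal_dxList I).smul _) fun K => ?_
  -- Trivial signs turn the weighted sum into a plain expansion in the coordinate covectors.
  have h := sum_dxList_mul (1 : Fin (d + 1) → ℤˣ) K α
  have h1 : ∀ {l : ℕ} (J : Fin l → Fin (d + 1)), signProd 1 J = 1 := by
    intro l J
    simp [signProd]
  simp only [h1, one_mul] at h
  have h2 : α (baseVecs K) = ((Nat.factorial k : ℝ)⁻¹) *
      ∑ J, (dxList K : Covec d m k) (baseVecs J) * α (baseVecs J) := by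
    rw [h, ← mul_assoc, inv_mul_cancel₀ (by positivity), one_mul]
  rw [ContinuousAlternatingMap.sum_apply]
  refine h2.trans ?_
  rw [Finset.mul_sum]
  refine Finset.sum_congr rfl fun J _ => ?_
  rw [ContinuousAlternatingMap.smul_apply, smul_eq_mul]
  -- Transposing a matrix preserves its determinant: reindex the permutations by inversion.
  have h3 : (dxList K : Covec d m k) (baseVecs J) = (dxList J : Covec d m k) (baseVecs K) := by
    rw [dxList_baseVecs, dxList_baseVecs, ← Equiv.sum_comp (Equiv.inv (Equiv.Perm (Fin k)))]
    refine Finset.sum_congr rfl fun σ _ => ?_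
    rw [Equiv.inv_apply, Equiv.Perm.sign_inv]
    have : J = K ∘ (σ⁻¹).symm ↔ K = J ∘ σ.symm := by
      rw [Equiv.eq_comp_symm, eq_comm]
      rfl
    simp only [this]
  rw [h3]
  change _ = _ * _ * (dxList J : Covec d m k) (baseVecs K)
  ring

/-! ### Hodge duality and the co-exterior product -/

/-- Concatenation of lists of base indices. -/
def appendIdx {k l N : ℕ} (h : k + l = N) (I : Fin k → Fin (d + 1)) (J : Fin l → Fin (d + 1)) :
    Fin N → Fin (d + 1) := fun j => Fin.append I J (Fin.cast h.symm j)

theorem appendIdx_eq {k l N : ℕ} (h : k + l = N) (I : Fin k → Fin (d + 1))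
    (J : Fin l → Fin (d + 1)) (j : Fin N) :
    appendIdx h I J j =
      if hj : j.val < k then I ⟨j.val, hj⟩ else J ⟨j.val - k, by omega⟩ := by
  subst h
  simp only [appendIdx, Fin.cast_eq_self]
  induction j using Fin.addCases with
  | left j => simp
  | right j => simp

theorem baseVecs_appendIdx {k l N : ℕ} (h : k + l = N) (I : Fin k → Fin (d + 1))
    (J : Fin l → Fin (d + 1)) :
    (baseVecs (appendIdx h I J) : Fin N → Coord d m) = appendVec h (baseVecs I) (baseVecs J) := by
  funext j
  rw [appendVec_eq, baseVecs, appendIdx_eq]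
  split_ifs <;> rfl

theorem signProd_appendIdx (ε : Fin (d + 1) → ℤˣ) {k l N : ℕ} (h : k + l = N)
    (I : Fin k → Fin (d + 1)) (J : Fin l → Fin (d + 1)) :
    signProd ε (appendIdx h I J) = signProd ε I * signProd ε J := by
  subst h
  simp [signProd, appendIdx, Fin.prod_univ_add]

theorem appendIdx_injective {k l N : ℕ} (h : k + l = N) {I : Fin k → Fin (d + 1)}
    {J : Fin l → Fin (d + 1)} (hI : Function.Injective I) (hJ : Function.Injective J)
    (hIJ : ∀ i j, I i ≠ J j) : Function.Injective (appendIdx h I J) := by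
  subst h
  intro i j hij
  simp only [appendIdx, Fin.cast_eq_self] at hij
  induction i using Fin.addCases with
  | left i =>
    induction j using Fin.addCases with
    | left j => simp only [Fin.append_left] at hij; rw [hI hij]
    | right j => simp only [Fin.append_left, Fin.append_right] at hij; exact absurd hij (hIJ i j)
  | right i =>
    induction j using Fin.addCases with
    | left j =>
      simp only [Fin.append_left, Fin.append_right] at hij
      exact absurd hij.symm (hIJ j i)
    | right j => simp only [Fin.append_right] at hij; rw [hJ hij]

theorem exists_complement {k l : ℕ} (h : k + l = d + 1) {I : Fin k → Fin (d + 1)}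
    (hI : Function.Injective I) :
    ∃ J : Fin l → Fin (d + 1), Function.Injective J ∧ (∀ i j, I i ≠ J j) ∧
      ∀ μ, (∀ i, I i ≠ μ) → ∃ j, J j = μ := by
  classical
  have hcard : Fintype.card {μ // μ ∉ Set.range I} = l := by
    have h1 := Fintype.card_compl_set (Set.range I)
    rw [Set.card_range_of_injective hI] at h1
    simp only [Fintype.card_fin] at h1
    have h2 : Fintype.card {μ // μ ∉ Set.range I} = Fintype.card ↑(Set.range I)ᶜ :=
      Fintype.card_congr (Equiv.refl _)
    omega
  let e := Fintype.equivFinOfCardEq hcard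
  refine ⟨fun j => (e.symm j).1, Subtype.val_injective.comp e.symm.injective, ?_, ?_⟩
  · intro i j hij
    exact (e.symm j).2 ⟨i, hij⟩
  · intro μ hμ
    refine ⟨e ⟨μ, fun ⟨i, hi⟩ => hμ i hi⟩, by simp⟩

theorem volForm_baseVecs_mul_self {T : Fin (d + 1) → Fin (d + 1)} (hT : Function.Injective T) :
    volForm d m (baseVecs T) * volForm d m (baseVecs T) = 1 := by
  let σ : Equiv.Perm (Fin (d + 1)) := Equiv.ofBijective T (Finite.injective_iff_bijective.mp hT)
  have h : volForm d m (baseVecs T) = ((Equiv.Perm.sign σ : ℤ) : ℝ) := by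
    rw [volForm_eq]
    exact dxList_comp_perm id Function.injective_id σ
  rw [h]
  rcases Int.units_eq_one_or (Equiv.Perm.sign σ) with h | h <;> simp [h]

/-- Both sides are tested on coordinate vectors `K`. If `K` rearranges `J` they carry the same sign.
Otherwise both vanish: were the list `I`, `K` free of repetitions, `K` would avoid `I`, and `J`
covers what `I` misses, so `K` would rearrange `J`. -/
theorem contract_baseVecs_volForm {k l : ℕ} (h : k + l = d + 1) {I : Fin k → Fin (d + 1)}
    {J : Fin l → Fin (d + 1)} (hJ : Function.Injective J)
    (hcov : ∀ μ, (∀ i, I i ≠ μ) → ∃ j, J j = μ) :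
    contract h (decomposable (baseVecs I)) (volForm d m) =
      volForm d m (baseVecs (appendIdx h I J)) • dxList J := by
  refine (isHorizontal_volForm.contract _).ext ((isHorizontal_dxList _).smul _) fun K => ?_
  change contract h (decomposable (baseVecs I)) (volForm d m) (baseVecs K) =
    volForm d m (baseVecs (appendIdx h I J)) * (dxList J : Covec d m l) (baseVecs K)
  by_cases hK : ∃ σ : Equiv.Perm (Fin l), K = J ∘ σ
  · obtain ⟨σ, rfl⟩ := hK
    rw [dxList_comp_perm J hJ, baseVecs_appendIdx, ← contract_decomposable_apply]
    have := (contract h (decomposable (baseVecs I)) (volForm d m)).toAlternatingMap.map_perm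
      (baseVecs J) σ
    rw [Units.smul_def, zsmul_eq_mul, mul_comm] at this
    exact this
  · have h1 : (dxList J : Covec d m l) (baseVecs K) = 0 := by
      rw [dxList_baseVecs]
      refine Finset.sum_eq_zero fun σ _ => if_neg fun h => hK ⟨σ.symm, h⟩
    rw [h1, mul_zero]
    rw [contract_decomposable_apply, ← baseVecs_appendIdx]
    refine (volForm d m).map_eq_zero_of_not_injective _ fun hinj => hK ?_
    have hinj' : Function.Injective (appendIdx h I K) := fun i j hij => hinj (by
      simp only [baseVecs, hij])
    have hKI : ∀ i j, I i ≠ K j := by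
      intro i j hij
      have h2 : appendIdx h I K ⟨i.val, by omega⟩ = appendIdx h I K ⟨k + j.val, by omega⟩ := by
        rw [appendIdx_eq, appendIdx_eq]
        simp [hij]
      have := congrArg Fin.val (hinj' h2)
      simp only at this
      omega
    have hKinj : Function.Injective K := by
      intro i j hij
      have h2 : appendIdx h I K ⟨k + i.val, by omega⟩ = appendIdx h I K ⟨k + j.val, by omega⟩ := by
        rw [appendIdx_eq, appendIdx_eq]
        simp [hij]
      have := congrArg Fin.val (hinj' h2)
      simp only at this
      exact Fin.ext (by omega)
    choose f hf using fun j => hcov (K j) fun i => hKI i j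
    have hfinj : Function.Injective f := fun i j hij => hKinj (by rw [← hf i, ← hf j, hij])
    exact ⟨Equiv.ofBijective f (Finite.injective_iff_bijective.mp hfinj),
      funext fun j => (hf j).symm⟩

theorem volForm_appendIdx_comm {k l : ℕ} (h : k + l = d + 1) (h' : l + k = d + 1)
    (I : Fin k → Fin (d + 1)) (J : Fin l → Fin (d + 1)) :
    volForm d m (baseVecs (appendIdx h' J I)) =
      (-1) ^ (k * l) * volForm d m (baseVecs (appendIdx h I J)) := by
  -- With no free slots left, graded commutation of the two contractions is exactly the block-swap
  -- sign.
  have key := contract_contract h' (by omega : k + 0 = k) h (by omega : l + 0 = l)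
    (decomposable (baseVecs J)) (decomposable (baseVecs I)) (volForm d m)
  have key2 := DFunLike.congr_fun key Fin.elim0
  rw [ContinuousAlternatingMap.smul_apply, smul_eq_mul, mul_comm l k] at key2
  have h3 : ∀ {p : ℕ} (v : Fin p → Coord d m),
      appendVec (Nat.add_zero p) v (Fin.elim0 : Fin 0 → Coord d m) = v := by
    intro p v
    funext j
    simp [appendVec_eq]
  simp only [contract_decomposable_apply, h3] at key2
  rw [baseVecs_appendIdx, baseVecs_appendIdx]
  exact key2

section HodgeLinear
variable (ε : Fin (d + 1) → ℤˣ)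

/-- Raising of indices as a linear map. -/
def sharpL {p : ℕ} : Covec d m p →ₗ[ℝ] Multivec d m p where
  toFun := sharp ε
  map_add' α β := by
    ext γ
    rw [sharp_apply, add_apply, sharp_apply, sharp_apply, ← mul_add,
      ← Finset.sum_add_distrib]
    simp only [ContinuousAlternatingMap.add_apply, mul_add, add_mul]
  map_smul' c α := by
    ext γ
    rw [sharp_apply, smul_apply, sharp_apply, RingHom.id_apply, smul_eq_mul,
      Finset.mul_sum, Finset.mul_sum, Finset.mul_sum]
    refine Finset.sum_congr rfl fun J _ => ?_
    rw [ContinuousAlternatingMap.smul_apply, smul_eq_mul]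
    ring

/-- The Hodge star as a linear map. -/
def hodgeL {p l : ℕ} (h : p + l = d + 1) : Covec d m p →ₗ[ℝ] Covec d m l where
  toFun := hodge ε h
  map_add' α β := by
    change contract h (sharpL ε (α + β)) _ = contract h (sharpL ε α) _ + contract h (sharpL ε β) _
    rw [map_add, contract_add_left]
  map_smul' c α := by
    change contract h (sharpL ε (c • α)) _ = c • contract h (sharpL ε α) _
    rw [map_smul, contract_smul_left]

theorem hodgeL_apply {p l : ℕ} (h : p + l = d + 1) (α : Covec d m p) :
    hodgeL ε h α = hodge ε h α := rfl

theorem isHorizontal_hodge {p l : ℕ} (h : p + l = d + 1) (α : Covec d m p) :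
    IsHorizontal (hodge ε h α) := isHorizontal_volForm.contract _

theorem hodge_dxList {p l : ℕ} (h : p + l = d + 1) (I : Fin p → Fin (d + 1)) :
    hodge ε h (dxList I : Covec d m p) =
      signProd ε I • contract h (decomposable (baseVecs I)) (volForm d m) := by
  rw [hodge, sharp_dxList, contract_smul_left]

theorem dxList_of_not_injective {k : ℕ} {I : Fin k → Fin (d + 1)} (hI : ¬ Function.Injective I) :
    (dxList I : Covec d m k) = 0 := by
  refine (isHorizontal_dxList I).ext isHorizontal_zero fun K => ?_
  -- Pairing the covector with itself makes the sum of the squares of its values equal to k! times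
  -- its value on the list `I`, which vanishes because `I` repeats an index. So every value is zero.
  have h := sum_dxList_mul (1 : Fin (d + 1) → ℤˣ) I (dxList I : Covec d m k)
  have h1 : (dxList I : Covec d m k) (baseVecs I) = 0 :=
    ContinuousAlternatingMap.map_eq_zero_of_not_injective _ _ fun hinj =>
      hI fun i j hij => hinj (by simp only [baseVecs, hij])
  rw [h1, mul_zero, mul_zero] at h
  have h2 : ∀ J : Fin k → Fin (d + 1), signProd 1 J = 1 := by
    intro J
    simp [signProd]
  simp only [h2, one_mul] at h
  have := (Finset.sum_eq_zero_iff_of_nonneg (fun J _ => mul_self_nonneg _)).mp h K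
    (Finset.mem_univ K)
  exact mul_self_eq_zero.mp this

theorem contract_baseVecs_of_not_injective {k l N : ℕ} (h : k + l = N) {I : Fin k → Fin (d + 1)}
    (hI : ¬ Function.Injective I) (η : Covec d m N) :
    contract h (decomposable (baseVecs I)) η = 0 := by
  ext v
  rw [contract_decomposable_apply]
  refine η.map_eq_zero_of_not_injective _ fun hinj => hI fun i j hij => ?_
  have := @hinj ⟨i.val, by omega⟩ ⟨j.val, by omega⟩ (by simp [appendVec_eq, baseVecs, hij])
  exact Fin.ext (by simpa using congrArg Fin.val this)

/-- For a complement `J` of `I`, contraction with ω gives ± dx^J and the star returns ± dx^I. The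
orientation sign occurs twice, and the metric sign of `J` is σ times that of `I`. -/
theorem hodge_contract_baseVecs {k l : ℕ} (h : k + l = d + 1) (h' : l + k = d + 1)
    (I : Fin k → Fin (d + 1)) :
    hodge ε h' (contract h (decomposable (baseVecs I)) (volForm d m)) =
      ((-1) ^ (k * l) * signProd ε (id : Fin (d + 1) → Fin (d + 1)) * signProd ε I) •
        dxList I := by
  by_cases hI : Function.Injective I
  · obtain ⟨J, hJ, hIJ, hcov⟩ := exists_complement h hI
    rw [contract_baseVecs_volForm h hJ hcov, ← hodgeL_apply, map_smul, hodgeL_apply,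
      hodge_dxList]
    have hIcov : ∀ μ, (∀ j, J j ≠ μ) → ∃ i, I i = μ := by
      intro μ hμ
      by_contra! hne
      obtain ⟨j, hj⟩ := hcov μ hne
      exact hμ j hj
    rw [contract_baseVecs_volForm h' hI hIcov,
      volForm_appendIdx_comm h h', smul_smul, smul_smul]
    congr 1
    have h1 := volForm_baseVecs_mul_self (m := m) (appendIdx_injective h hI hJ hIJ)
    have h2 : signProd ε (id : Fin (d + 1) → Fin (d + 1)) = signProd ε I * signProd ε J := by
      rw [← signProd_appendIdx ε h]
      exact (Function.Bijective.prod_comp (Finite.injective_iff_bijective.mp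
        (appendIdx_injective h hI hJ hIJ)) fun μ => (((ε μ : ℤˣ) : ℤ) : ℝ)).symm
    have h3 := signProd_mul_self ε I
    rw [h2]
    linear_combination ((-1) ^ (k * l) * signProd ε J) * h1 -
      ((-1) ^ (k * l) * signProd ε J) * h3
  · rw [contract_baseVecs_of_not_injective h hI, dxList_of_not_injective hI, smul_zero,
      ← hodgeL_apply, map_zero]

theorem IsHorizontal.induction {k : ℕ} {P : Covec d m k → Prop}
    (dx : ∀ I, P (dxList I)) (add : ∀ α β, P α → P β → P (α + β))
    (smul : ∀ (c : ℝ) α, P α → P (c • α)) {α : Covec d m k} (hα : IsHorizontal α) : P α := by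
  have h0 : P 0 := by
    have := smul 0 _ (dx fun _ => 0)
    rwa [zero_smul] at this
  rw [hα.eq_sum]
  exact Finset.sum_induction _ P add h0 fun I _ => smul _ _ (dx I)

theorem signProd_id_mul_self :
    signProd ε (id : Fin (d + 1) → Fin (d + 1)) * signProd ε id = 1 := signProd_mul_self ε id

theorem hodge_hodge {k l : ℕ} (h : k + l = d + 1) (h' : l + k = d + 1) {α : Covec d m k}
    (hα : IsHorizontal α) :
    hodge ε h' (hodge ε h α) =
      ((-1) ^ (k * l) * signProd ε (id : Fin (d + 1) → Fin (d + 1))) • α := by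
  simp only [← hodgeL_apply]
  refine IsHorizontal.induction (P := fun α => hodgeL ε h' (hodgeL ε h α) =
    ((-1) ^ (k * l) * signProd ε (id : Fin (d + 1) → Fin (d + 1))) • α) (fun I => ?_)
    (fun α β hα hβ => ?_) (fun c α hα => ?_) hα
  · rw [hodgeL_apply, hodgeL_apply, hodge_dxList, ← hodgeL_apply, map_smul, hodgeL_apply,
      hodge_contract_baseVecs, smul_smul]
    congr 1
    have h3 := signProd_mul_self ε I
    linear_combination ((-1) ^ (k * l) * signProd ε (id : Fin (d + 1) → Fin (d + 1))) * h3
  · rw [map_add, map_add, hα, hβ, smul_add]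
  · rw [map_smul, map_smul, hα, smul_comm]

/-- The multivector `φ` on the base with `φ ⌟ ω = α`. -/
def volDual {k l : ℕ} (h : k + l = d + 1) : Covec d m l →ₗ[ℝ] Multivec d m k :=
  ((-1) ^ (k * l) * signProd ε (id : Fin (d + 1) → Fin (d + 1))) •
    (sharpL ε).comp (hodgeL ε (by omega : l + k = d + 1))

/-- The star is contraction of the raised covector with ω, so applying it twice exhibits α as φ ⌟ ω
up to the sign built into `volDual`. -/
theorem contract_volDual {k l : ℕ} (h : k + l = d + 1) {α : Covec d m l} (hα : IsHorizontal α) :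
    contract h (volDual ε h α) (volForm d m) = α := by
  have h1 := hodge_hodge ε (by omega : l + k = d + 1) h hα
  have h2 : contract h (volDual ε h α) (volForm d m) =
      ((-1) ^ (k * l) * signProd ε (id : Fin (d + 1) → Fin (d + 1))) •
        hodge ε h (hodge ε (by omega : l + k = d + 1) α) := rfl
  rw [h2, h1, smul_smul, mul_comm l k]
  have h3 := signProd_id_mul_self ε
  have h4 : ((-1 : ℝ) ^ (k * l)) * (-1) ^ (k * l) = 1 := by
    rw [← mul_pow]; norm_num
  have : ((-1 : ℝ) ^ (k * l) * signProd ε (id : Fin (d + 1) → Fin (d + 1))) *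
      ((-1) ^ (k * l) * signProd ε id) = 1 := by
    linear_combination (signProd ε (id : Fin (d + 1) → Fin (d + 1)) * signProd ε id) * h4 + h3
  rw [this, one_smul]

end HodgeLinear

/-- Horizontal covectors see only the base part of a multivector; its coefficients are the values on
dx^I divided by k!. -/
theorem exists_base_expansion {k : ℕ} (φ : Multivec d m k) :
    ∃ c : (Fin k → Fin (d + 1)) → ℝ, ∀ α : Covec d m k, IsHorizontal α →
      φ α = (∑ I, c I • decomposable (baseVecs I)) α := by
  refine ⟨fun I => ((Nat.factorial k : ℝ)⁻¹) * φ (dxList I), fun α hα => ?_⟩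
  conv_lhs => rw [hα.eq_sum]
  rw [map_sum, sum_apply]
  refine Finset.sum_congr rfl fun I _ => ?_
  rw [map_smul, smul_apply, decomposable_apply, smul_eq_mul, smul_eq_mul]
  ring

theorem contract_congr_of_horizontal {k l N : ℕ} (h : k + l = N) {φ ψ : Multivec d m k}
    (hφ : ∀ α : Covec d m k, IsHorizontal α → φ α = ψ α) {η : Covec d m N}
    (hη : IsHorizontal η) : contract h φ η = contract h ψ η := by
  ext v
  exact hφ _ (hη.evalLast v)

/-! ### The exterior product and the co-exterior product as an interior product -/

theorem wedge_apply {a b N : ℕ} (h : a + b = N) (α : Covec d m a) (β : Covec d m b)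
    (v : Fin N → Coord d m) :
    wedge h α β v = LinearMap.mul' ℝ ℝ
      (α.toAlternatingMap.domCoprod β.toAlternatingMap
        fun i => v ((finSumFinEquiv.trans (finCongr h)) i)) := rfl

/-- The exterior product as a bilinear map. -/
def wedgeL {a b N : ℕ} (h : a + b = N) : Covec d m a →ₗ[ℝ] Covec d m b →ₗ[ℝ] Covec d m N := by
  refine LinearMap.mk₂ ℝ (wedge h) ?_ ?_ ?_ ?_
  · intro α α' β
    ext v
    rw [ContinuousAlternatingMap.add_apply, wedge_apply, wedge_apply, wedge_apply, ← map_add,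
      ← AlternatingMap.domCoprod'_apply, ← AlternatingMap.domCoprod'_apply,
      ← AlternatingMap.domCoprod'_apply, ContinuousAlternatingMap.toAlternatingMap_add,
      TensorProduct.add_tmul, map_add, AlternatingMap.add_apply]
  · intro c α β
    ext v
    rw [ContinuousAlternatingMap.smul_apply, wedge_apply, wedge_apply, ← map_smul,
      ← AlternatingMap.domCoprod'_apply, ← AlternatingMap.domCoprod'_apply,
      ContinuousAlternatingMap.toAlternatingMap_smul,
      ← TensorProduct.smul_tmul', map_smul, AlternatingMap.smul_apply]
  · intro α β β'
    ext v
    rw [ContinuousAlternatingMap.add_apply, wedge_apply, wedge_apply, wedge_apply, ← map_add,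
      ← AlternatingMap.domCoprod'_apply, ← AlternatingMap.domCoprod'_apply,
      ← AlternatingMap.domCoprod'_apply, ContinuousAlternatingMap.toAlternatingMap_add,
      TensorProduct.tmul_add, map_add, AlternatingMap.add_apply]
  · intro c α β
    ext v
    rw [ContinuousAlternatingMap.smul_apply, wedge_apply, wedge_apply, ← map_smul,
      ← AlternatingMap.domCoprod'_apply, ← AlternatingMap.domCoprod'_apply,
      ContinuousAlternatingMap.toAlternatingMap_smul,
      TensorProduct.tmul_smul, map_smul, AlternatingMap.smul_apply]

theorem wedgeL_apply {a b N : ℕ} (h : a + b = N) (α : Covec d m a) (β : Covec d m b) :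
    wedgeL h α β = wedge h α β := rfl

/-- The shuffle product of two alternatizations is the alternatization of the tensor product, so
both sides become the same sum over permutations. -/
theorem wedge_dxList {a b N : ℕ} (h : a + b = N) (I : Fin a → Fin (d + 1))
    (J : Fin b → Fin (d + 1)) :
    wedge h (dxList I : Covec d m a) (dxList J) = dxList (appendIdx h I J) := by
  subst h
  ext v
  rw [wedge_apply]
  have h1 : ∀ {k : ℕ} (K : Fin k → Fin (d + 1)), (dxList K : Covec d m k).toAlternatingMap =
      MultilinearMap.alternatization
        ((MultilinearMap.mkPiAlgebra ℝ (Fin k) ℝ).compLinearMap fun i =>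
        (LinearMap.proj (K i)).comp
          (LinearMap.fst ℝ (Fin (d + 1) → ℝ) ((Fin m → ℝ) × (Fin m → Fin (d + 1) → ℝ)))) :=
    fun K => rfl
  rw [h1, h1, ← MultilinearMap.domCoprod_alternization, MultilinearMap.alternatization_apply,
    map_sum, dxList_apply, ← Equiv.sum_comp (finSumFinEquiv (m := a) (n := b)).permCongr]
  refine Finset.sum_congr rfl fun σ _ => ?_
  rw [Equiv.Perm.sign_permCongr, Units.smul_def, map_zsmul, zsmul_eq_mul]
  congr 1
  rw [MultilinearMap.domDomCongr_apply, MultilinearMap.domCoprod_apply, LinearMap.mul'_apply,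
    Fin.prod_univ_add]
  simp [appendIdx]

/-- The stars turn the factors into multiples of dx^I and dx^J, whose wedge is dx^{IJ}; the inverse
star turns this into a multiple of (e_I ∧ e_J) ⌟ ω, an iterated contraction. -/
theorem coExterior_contract_baseVecs (ε : Fin (d + 1) → ℤˣ) {a b r : ℕ} (ha : a ≤ d + 1)
    (hb : b ≤ d + 1) (h : a + b = d + 1 + r) (I : Fin (d + 1 - a) → Fin (d + 1))
    (J : Fin (d + 1 - b) → Fin (d + 1)) :
    coExterior ε ha hb h
        (contract (by omega : (d + 1 - a) + a = d + 1) (decomposable (baseVecs I)) (volForm d m))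
        (contract (by omega : (d + 1 - b) + b = d + 1) (decomposable (baseVecs J)) (volForm d m)) =
      (signProd ε (id : Fin (d + 1) → Fin (d + 1)) * (-1) ^ ((d + 1 - a) * a + (d + 1 - b) * b +
          r * (d + 1 - r) + (d + 1 - a) * (d + 1 - b))) •
        contract (by omega : (d + 1 - a) + r = b) (decomposable (baseVecs I))
        (contract (by omega : (d + 1 - b) + b = d + 1) (decomposable (baseVecs J))
          (volForm d m)) := by
  rw [coExterior, hodge_contract_baseVecs, hodge_contract_baseVecs, ← wedgeL_apply, map_smul,
    map_smul, LinearMap.smul_apply, wedgeL_apply, wedge_dxList, hodgeInv, ← hodgeL_apply,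
    map_smul, map_smul, hodgeL_apply, hodge_dxList, signProd_appendIdx, baseVecs_appendIdx]
  rw [contract_contract (by omega : (d + 1 - b) + b = d + 1) (by omega : (d + 1 - a) + r = b)
    (by omega : (d + 1 - a) + a = d + 1) (by omega : (d + 1 - b) + r = a)]
  have hm : (decomposable (appendVec (by omega : (d + 1 - a) + (d + 1 - b) = d + 1 - r)
      (baseVecs I) (baseVecs J)) : Multivec d m (d + 1 - r)) =
      mwedge (by omega : (d + 1 - a) + (d + 1 - b) = d + 1 - r) (decomposable (baseVecs I))
        (decomposable (baseVecs J)) := by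
    ext α
    rw [mwedge_apply, decomposable_apply, decomposable_apply, contract_decomposable_apply]
  rw [hm, contract_mwedge (by omega : (d + 1 - a) + a = d + 1) (by omega : (d + 1 - b) + r = a)]
  simp only [smul_smul]
  congr 1
  have h1 := signProd_mul_self ε I
  have h2 := signProd_mul_self ε J
  have h3 := signProd_id_mul_self ε
  have h4 : ((-1 : ℝ) ^ ((d + 1 - a) * (d + 1 - b))) * (-1) ^ ((d + 1 - a) * (d + 1 - b)) = 1 := by
    rw [← mul_pow]; norm_num
  have h5 : ∏ μ, (((ε μ : ℤˣ) : ℤ) : ℝ) = signProd ε id := rfl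
  rw [h5, mul_comm (d + 1 - b) (d + 1 - a)]
  simp only [pow_add]
  -- All factors are signs. Once they are opaque, only the fact that the relevant ones square to one
  -- is needed.
  generalize (-1 : ℝ) ^ ((d + 1 - a) * (d + 1 - b)) = x at *
  generalize (-1 : ℝ) ^ ((d + 1 - a) * a) = y at *
  generalize (-1 : ℝ) ^ ((d + 1 - b) * b) = z at *
  generalize (-1 : ℝ) ^ (r * (d + 1 - r)) = w at *
  generalize signProd ε (id : Fin (d + 1) → Fin (d + 1)) = s at *
  generalize signProd ε I = i at *
  generalize signProd ε J = j at *
  linear_combination (y * z * w * s * s * s * j * j) * h1 + (y * z * w * s * s * s) * h2 +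
    (y * z * w * s) * h3 - (y * z * w * s) * h4

theorem coExterior_eq_linear (ε : Fin (d + 1) → ℤˣ) {a b r : ℕ} (ha : a ≤ d + 1)
    (hb : b ≤ d + 1) (h : a + b = d + 1 + r) :
    ∃ L : Covec d m a →ₗ[ℝ] Covec d m b →ₗ[ℝ] Covec d m r,
      ∀ α β, coExterior ε ha hb h α β = L α β := by
  refine ⟨LinearMap.compr₂ ((wedgeL (by omega : (d + 1 - a) + (d + 1 - b) = d + 1 - r)).compl₁₂
    (hodgeL ε (by omega : a + (d + 1 - a) = d + 1)) (hodgeL ε (by omega : b + (d + 1 - b) = d + 1)))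
    ((((∏ μ, (((ε μ : ℤˣ) : ℤ) : ℝ)) * (-1) ^ (r * (d + 1 - r)))) •
      hodgeL ε (by omega : (d + 1 - r) + r = d + 1)), fun α β => rfl⟩

/-- The co-exterior product with a horizontal covector is an interior product. -/
theorem exists_coExterior_contract (ε : Fin (d + 1) → ℤˣ) {a b r : ℕ} (ha : a ≤ d + 1)
    (hb : b ≤ d + 1) (h : a + b = d + 1 + r) : ∃ s : ℝ, s ≠ 0 ∧
      ∀ (φ : Multivec d m (d + 1 - a)) (β : Covec d m b), IsHorizontal β →
        coExterior ε ha hb h (contract (by omega : (d + 1 - a) + a = d + 1) φ (volForm d m)) β =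
          s • contract (by omega : (d + 1 - a) + r = b) φ β := by
  refine ⟨signProd ε (id : Fin (d + 1) → Fin (d + 1)) * (-1) ^ ((d + 1 - a) * a +
    (d + 1 - b) * b + r * (d + 1 - r) + (d + 1 - a) * (d + 1 - b)), ?_, ?_⟩
  rotate_left
  · intro φ β hβ
    obtain ⟨L, hL⟩ := coExterior_eq_linear (m := m) ε ha hb h
    obtain ⟨c, hc⟩ := exists_base_expansion φ
    rw [contract_congr_of_horizontal _ hc isHorizontal_volForm,
      contract_congr_of_horizontal _ hc hβ]
    -- Being horizontal, `β` is itself a contraction of ω, so bilinearity reduces the claim to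
    -- coordinate multivectors.
    obtain ⟨e, he⟩ := exists_base_expansion (volDual ε (by omega : (d + 1 - b) + b = d + 1) β)
    rw [← contract_volDual ε (by omega : (d + 1 - b) + b = d + 1) hβ,
      contract_congr_of_horizontal _ he isHorizontal_volForm]
    rw [hL]
    simp only [contract_sum_left, contract_smul_left, map_sum, map_smul,
      LinearMap.sum_apply, LinearMap.smul_apply, contract_sum_right, contract_smul_right,
      Finset.smul_sum, ← hL, coExterior_contract_baseVecs]
    refine Finset.sum_congr rfl fun I _ => Finset.sum_congr rfl fun J _ => ?_
    simp only [smul_smul]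
    congr 1
    ring
  · have h3 := signProd_id_mul_self ε
    refine mul_ne_zero (fun h0 => ?_) (pow_ne_zero _ (by norm_num))
    rw [h0] at h3
    norm_num at h3

/-! ### Vertical vectors and components of vertical multivectors -/

/-- Labels of the fibre coordinates `y^a` and `p_a^μ`. -/
abbrev VIdx (d m : ℕ) : Type := Fin m ⊕ Fin m × Fin (d + 1)

/-- The coordinate vectors along the fibre. -/
def vertVec : VIdx d m → Coord d m
  | .inl a => (0, Pi.single a 1, 0)
  | .inr (a, μ) => (0, 0, Pi.single a (Pi.single μ 1))

/-- The fibre coordinates. -/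
def vertCoord : VIdx d m → Coord d m →L[ℝ] ℝ
  | .inl a => LinearMap.toContinuousLinearMap
      { toFun := fun v => v.2.1 a, map_add' := fun _ _ => rfl, map_smul' := fun _ _ => rfl }
  | .inr (a, μ) => LinearMap.toContinuousLinearMap
      { toFun := fun v => v.2.2 a μ, map_add' := fun _ _ => rfl, map_smul' := fun _ _ => rfl }

theorem vertCoord_inl (a : Fin m) (v : Coord d m) : vertCoord (.inl a) v = v.2.1 a := rfl

theorem vertCoord_inr (a : Fin m) (μ : Fin (d + 1)) (v : Coord d m) :
    vertCoord (.inr (a, μ)) v = v.2.2 a μ := rfl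

theorem isVerticalVector_vertVec (A : VIdx d m) : IsVerticalVector (vertVec A) := by
  rcases A with a | ⟨a, μ⟩ <;> rfl

theorem vertCoord_vertVec (A B : VIdx d m) :
    vertCoord A (vertVec B) = if A = B then 1 else 0 := by
  rcases A with a | ⟨a, μ⟩ <;> rcases B with b | ⟨b, ν⟩
  · simp [vertCoord_inl, vertVec, Pi.single_apply]
  · simp [vertCoord_inl, vertVec]
  · simp [vertCoord_inr, vertVec]
  · by_cases h : a = b
    · subst h
      simp [vertCoord_inr, vertVec, Pi.single_apply]
    · simp [vertCoord_inr, vertVec, h]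

theorem IsVerticalVector.eq_sum {v : Coord d m} (hv : IsVerticalVector v) :
    v = ∑ A, vertCoord A v • vertVec A := by
  refine Prod.ext ?_ (Prod.ext ?_ ?_)
  · rw [show v.1 = 0 from hv, Prod.fst_sum]
    refine (Finset.sum_eq_zero fun A _ => ?_).symm
    rw [Prod.smul_fst, show (vertVec A : Coord d m).1 = 0 from isVerticalVector_vertVec A,
      smul_zero]
  · funext a
    simp [Prod.snd_sum, Prod.fst_sum, Fintype.sum_sum_type, vertVec, vertCoord_inl,
      Finset.sum_apply, Pi.single_apply]
  · funext a μ
    simp only [Prod.snd_sum, Fintype.sum_sum_type, vertVec,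
      Finset.sum_apply, Prod.snd_add, Pi.add_apply, Prod.smul_snd, Pi.smul_apply]
    rw [Fintype.sum_prod_type, Finset.sum_eq_zero fun _ _ => by simp, zero_add,
      Finset.sum_eq_single a, Finset.sum_eq_single μ]
    · simp [vertCoord_inr]
    · intro ν _ hν
      simp [Pi.single_eq_of_ne hν.symm]
    · simp
    · intro b _ hb
      simp [Pi.single_eq_of_ne hb.symm]
    · simp

theorem insertVec_add {l N : ℕ} (h : 1 + l = N) (v w : Coord d m) (η : Covec d m N) :
    insertVec h (v + w) η = insertVec h v η + insertVec h w η := by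
  obtain rfl : N = l + 1 := by omega
  ext u
  rw [ContinuousAlternatingMap.add_apply, insertVec_apply', insertVec_apply', insertVec_apply']
  exact ContinuousAlternatingMap.cons_add _ _ _ _

theorem insertVec_smul {l N : ℕ} (h : 1 + l = N) (c : ℝ) (v : Coord d m) (η : Covec d m N) :
    insertVec h (c • v) η = c • insertVec h v η := by
  obtain rfl : N = l + 1 := by omega
  ext u
  rw [ContinuousAlternatingMap.smul_apply, insertVec_apply', insertVec_apply']
  exact ContinuousAlternatingMap.cons_smul _ _ _ _

theorem IsVerticalVector.induction {P : Coord d m → Prop} (base : ∀ A, P (vertVec A))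
    (add : ∀ v w, P v → P w → P (v + w)) (smul : ∀ (c : ℝ) v, P v → P (c • v)) (zero : P 0)
    {v : Coord d m} (hv : IsVerticalVector v) : P v := by
  rw [hv.eq_sum]
  exact Finset.sum_induction _ P add zero fun A _ => smul _ _ (base A)

theorem insertVec_zero {l N : ℕ} (h : 1 + l = N) (η : Covec d m N) :
    insertVec h 0 η = 0 := by
  have := insertVec_smul h 0 0 η
  rwa [zero_smul, zero_smul] at this

theorem IsHorizontal.insertVec_eq_zero {l N : ℕ} {h : 1 + l = N} {η : Covec d m N}
    (hη : IsHorizontal η) {v : Coord d m} (hv : IsVerticalVector v) : insertVec h v η = 0 := by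
  ext u
  rw [insertVec_apply]
  refine hη _ ⟨0, by omega⟩ ?_
  rwa [appendVec_eq, dif_pos (by simp)]

/-- Coordinate directions span the vertical vectors, and a transposition brings a vertical argument
to the first slot. -/
theorem isHorizontal_of_insertVec {l N : ℕ} (h : 1 + l = N) {η : Covec d m N}
    (hη : ∀ A, insertVec h (vertVec A) η = 0) : IsHorizontal η := by
  have hη' : ∀ v, IsVerticalVector v → insertVec h v η = 0 := fun v hv =>
    IsVerticalVector.induction (P := fun v => insertVec h v η = 0) hη
      (fun v w hv hw => by rw [insertVec_add, hv, hw, add_zero])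
      (fun c v hv => by rw [insertVec_smul, hv, smul_zero]) (insertVec_zero h η) hv
  have h0 : ∀ x : Fin N → Coord d m, IsVerticalVector (x ⟨0, by omega⟩) → η x = 0 := by
    intro x hx
    rw [eq_appendVec_cons h x, ← insertVec_apply, hη' _ hx]
    rfl
  intro x i hi
  by_cases hi0 : i = ⟨0, by omega⟩
  · exact h0 x (hi0 ▸ hi)
  · have h1 := η.toAlternatingMap.map_swap x hi0
    have h2 : η (x ∘ Equiv.swap i ⟨0, by omega⟩) = 0 := by
      refine h0 _ ?_
      rwa [Function.comp_apply, Equiv.swap_apply_right]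
    exact neg_eq_zero.mp (h1.symm.trans h2)

/-- The projection of vectors to the base directions. -/
def baseProj (d m : ℕ) : Coord d m →L[ℝ] Coord d m :=
  (ContinuousLinearMap.inl ℝ _ _).comp (ContinuousLinearMap.fst ℝ _ _)

theorem IsHorizontal.comp_baseProj {k : ℕ} {α : Covec d m k} (hα : IsHorizontal α) :
    α.compContinuousLinearMap (baseProj d m) = α := by
  ext v
  exact hα.apply_congr fun i => rfl

/-- The exterior product `φ ∧ α` with a one-form. -/
def formWedge {k N : ℕ} (h : 1 + k = N) (φ : Coord d m →L[ℝ] ℝ) : Covec d m k →ₗ[ℝ] Covec d m N where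
  toFun α := mkCovec ((ContinuousAlternatingMap.alternatizeUncurryFin
    (φ.smulRight α)).toAlternatingMap.domDomCongr (finCongr (by omega : k + 1 = N)))
  map_add' α β := by
    have : φ.smulRight (α + β) = φ.smulRight α + φ.smulRight β :=
      ContinuousLinearMap.ext fun v => smul_add (φ v) α β
    rw [this, ContinuousAlternatingMap.alternatizeUncurryFin_add]
    rfl
  map_smul' c α := by
    have : φ.smulRight (c • α) = c • φ.smulRight α :=
      ContinuousLinearMap.ext fun v => smul_comm (φ v) c α
    rw [this, ContinuousAlternatingMap.alternatizeUncurryFin_smul]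
    rfl

/-- Separates the term differentiated along `v` from those in which `v` is an argument of the form;
the latter drop out for vertical `v` and horizontal values of `L`, which gives e_A ⌟ dG = ∂_A G. -/
theorem insertVec_alternatize {q : ℕ} (L : Coord d m →L[ℝ] Covec d m (q + 1)) (v : Coord d m)
    (u : Fin (q + 1) → Coord d m) :
    insertVec (Nat.add_comm 1 (q + 1)) v (ContinuousAlternatingMap.alternatizeUncurryFin L) u =
      L v u - ∑ i : Fin (q + 1), (-1) ^ i.val *
        insertVec (Nat.add_comm 1 q) v (L (u i)) (i.removeNth u) := by
  rw [insertVec_apply', ContinuousAlternatingMap.alternatizeUncurryFin_apply, Fin.sum_univ_succ]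
  simp only [Fin.val_zero, pow_zero, one_smul, Fin.cons_zero, Fin.removeNth_zero, Fin.tail_cons,
    Fin.cons_succ, sub_eq_add_neg]
  congr 1
  rw [← Finset.sum_neg_distrib]
  refine Finset.sum_congr rfl fun i _ => ?_
  rw [insertVec_apply', Fin.val_succ, pow_succ, mul_neg_one, zsmul_eq_mul]
  have : (i.succ.removeNth (Fin.cons v u : Fin (q + 1 + 1) → Coord d m)) =
      Fin.cons v (i.removeNth u) := by
    funext j
    refine Fin.cases ?_ (fun j => ?_) j
    · simp [Fin.removeNth]
    · simp [Fin.removeNth]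
  rw [this]
  push_cast
  ring

theorem insertVec_alternatize_of_isHorizontal {q : ℕ} {L : Coord d m →L[ℝ] Covec d m q}
    {v : Coord d m} (hL : ∀ w, IsHorizontal (L w)) (hv : IsVerticalVector v) :
    insertVec (Nat.add_comm 1 q) v (ContinuousAlternatingMap.alternatizeUncurryFin L) = L v := by
  ext u
  rcases q with _ | q
  · rw [insertVec_apply', ContinuousAlternatingMap.alternatizeUncurryFin_apply, Fin.sum_univ_succ]
    simp
  · rw [insertVec_alternatize]
    simp only [(hL _).insertVec_eq_zero hv]
    simp

theorem insertVec_formWedge {k N : ℕ} (h : 1 + k = N) (φ : Coord d m →L[ℝ] ℝ) {α : Covec d m k}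
    (hα : IsHorizontal α) {v : Coord d m} (hv : IsVerticalVector v) :
    insertVec h v (formWedge h φ α) = φ v • α := by
  obtain rfl : N = k + 1 := by omega
  exact insertVec_alternatize_of_isHorizontal (L := φ.smulRight α) (fun w => hα.smul _) hv

/-- The component `X_A` of a vertical multivector. -/
def slice {k N : ℕ} (h : 1 + k = N) (A : VIdx d m) : Multivec d m N →L[ℝ] Multivec d m k :=
  LinearMap.toContinuousLinearMap (E := Multivec d m N) (F' := Multivec d m k)
    { toFun := fun X => X.comp (LinearMap.toContinuousLinearMap (formWedge h (vertCoord A)))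
      map_add' := fun _ _ => rfl
      map_smul' := fun _ _ => rfl }

/-- A covector has at most one vertical leg. -/
def IsSemiHorizontal {N : ℕ} (η : Covec d m N) : Prop :=
  ∀ (v : Fin N → Coord d m) (i j : Fin N), i ≠ j → IsVerticalVector (v i) →
    IsVerticalVector (v j) → η v = 0

theorem IsSemiHorizontal.insertVec {l N : ℕ} {h : 1 + l = N} {η : Covec d m N}
    (hη : IsSemiHorizontal η) {v : Coord d m} (hv : IsVerticalVector v) :
    IsHorizontal (insertVec h v η) := fun u i hu => by
  rw [insertVec_apply]
  refine hη _ ⟨0, by omega⟩ ⟨1 + i.val, by omega⟩ (by simp only [ne_eq, Fin.ext_iff]; omega) ?_ ?_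
  · rwa [appendVec_eq, dif_pos (by simp)]
  · rw [appendVec_eq, dif_neg (by simp)]
    simpa using hu

/-- Subtracting ∑ dz^A ∧ (e_A ⌟ η), with z^A the fibre coordinates, from η leaves a horizontal
covector, which a vertical multivector kills. -/
theorem isVertical_apply_eq_sum {k N : ℕ} (h : 1 + k = N) {X : Multivec d m N}
    (hX : IsVertical X) {η : Covec d m N}
    (hη : ∀ A, IsHorizontal (insertVec h (vertVec A) η)) :
    X η = ∑ A, slice h A X (insertVec h (vertVec A) η) := by
  have h1 : IsHorizontal (η - ∑ A, formWedge h (vertCoord A) (insertVec h (vertVec A) η)) := by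
    refine isHorizontal_of_insertVec h fun B => ?_
    have h2 : ∀ ζ ζ' : Covec d m N, insertVec h (vertVec B) (ζ - ζ') =
        insertVec h (vertVec B) ζ - insertVec h (vertVec B) ζ' := fun ζ ζ' =>
      contract_sub_right _ _ _ _
    rw [h2, sub_eq_zero]
    have h3 : ∀ ζ : VIdx d m → Covec d m N, insertVec h (vertVec B) (∑ A, ζ A) =
        ∑ A, insertVec h (vertVec B) (ζ A) := fun ζ => contract_sum_right _ _ _ _
    rw [h3, Finset.sum_congr rfl fun A _ =>
      insertVec_formWedge h (vertCoord A) (hη A) (isVerticalVector_vertVec B)]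
    simp only [vertCoord_vertVec, ite_smul, one_smul, zero_smul]
    simp
  have h4 := hX _ h1
  rw [map_sub, sub_eq_zero, map_sum] at h4
  exact h4

theorem insertVec_evalLast {k k' l N N' : ℕ} (h : k + l = N) (hk : 1 + k' = k) (h1 : 1 + N' = N)
    (h' : k' + l = N') (w : Coord d m) (η : Covec d m N) (v : Fin l → Coord d m) :
    insertVec hk w (evalLast h η v) = evalLast h' (insertVec h1 w η) v :=
  (evalLast_contract h1 h' h hk (decomposable fun _ => w) η v).symm

theorem contract_eq_sum_slice {k k' l N N' : ℕ} (h : k + l = N) (hk : 1 + k' = k)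
    (h1 : 1 + N' = N) (h' : k' + l = N') {X : Multivec d m k} (hX : IsVertical X)
    {η : Covec d m N} (hη : ∀ A, IsHorizontal (insertVec h1 (vertVec A) η)) :
    contract h X η = ∑ A, contract h' (slice hk A X) (insertVec h1 (vertVec A) η) := by
  ext v
  rw [ContinuousAlternatingMap.sum_apply, contract_apply, isVertical_apply_eq_sum hk hX]
  · refine Finset.sum_congr rfl fun A _ => ?_
    rw [contract_apply, insertVec_evalLast h hk h1 h']
  · intro A
    rw [insertVec_evalLast h hk h1 h']
    exact (hη A).evalLast v

/-- The vertical multivector with given components. -/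
def ofComponents {k N : ℕ} (h : 1 + k = N) : (VIdx d m → Multivec d m k) →L[ℝ] Multivec d m N :=
  LinearMap.toContinuousLinearMap (E := VIdx d m → Multivec d m k) (F' := Multivec d m N)
    { toFun := fun W => LinearMap.toContinuousLinearMap
        { toFun := fun α => ∑ A, push (baseProj d m) (W A) (insertVec h (vertVec A) α)
          map_add' := fun α β => by
            rw [← Finset.sum_add_distrib]
            refine Finset.sum_congr rfl fun A _ => ?_
            rw [insertVec, contract_add_right, map_add]
            rfl
          map_smul' := fun c α => by
            rw [RingHom.id_apply, Finset.smul_sum]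
            refine Finset.sum_congr rfl fun A _ => ?_
            rw [insertVec, contract_smul_right, map_smul]
            rfl }
      map_add' := fun W W' => by
        ext α
        exact Finset.sum_add_distrib
      map_smul' := fun c W => by
        ext α
        exact (Finset.smul_sum (r := c)).symm }

theorem ofComponents_apply {k N : ℕ} (h : 1 + k = N) (W : VIdx d m → Multivec d m k)
    (α : Covec d m N) :
    ofComponents h W α = ∑ A, push (baseProj d m) (W A) (insertVec h (vertVec A) α) := rfl

theorem isVertical_ofComponents {k N : ℕ} (h : 1 + k = N) (W : VIdx d m → Multivec d m k) :
    IsVertical (ofComponents h W) := fun α hα => by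
  rw [ofComponents_apply]
  refine Finset.sum_eq_zero fun A _ => ?_
  rw [hα.insertVec_eq_zero (isVerticalVector_vertVec A), map_zero]

theorem contract_ofComponents {k k' l N N' : ℕ} (h : k + l = N) (hk : 1 + k' = k)
    (h1 : 1 + N' = N) (h' : k' + l = N') (W : VIdx d m → Multivec d m k')
    {η : Covec d m N} (hη : ∀ A, IsHorizontal (insertVec h1 (vertVec A) η)) :
    contract h (ofComponents hk W) η = ∑ A, contract h' (W A) (insertVec h1 (vertVec A) η) := by
  ext v
  rw [ContinuousAlternatingMap.sum_apply, contract_apply, ofComponents_apply]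
  refine Finset.sum_congr rfl fun A _ => ?_
  rw [contract_apply, insertVec_evalLast h hk h1 h', push_apply,
    ((hη A).evalLast v).comp_baseProj]

/-! ### The polysymplectic form -/

theorem isSemiHorizontal_wedge_one {N : ℕ} (h : 1 + d = N) (α : Covec d m 1) {β : Covec d m d}
    (hβ : IsHorizontal β) : IsSemiHorizontal (wedge h α β) := by
  subst h
  intro v i j hij hi hj
  rw [wedge_apply]
  -- Up to the nonzero factor 1!·d! the wedge is a sum over all permutations. In each term the
  -- one-form takes only one argument, so the horizontal factor receives a vertical one.
  have h1 := MultilinearMap.domCoprod_alternization_eq α.toAlternatingMap β.toAlternatingMap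
  have h2 := congrArg (LinearMap.mul' ℝ ℝ) (DFunLike.congr_fun h1
    (fun i => v ((finSumFinEquiv.trans (finCongr rfl)) i)))
  rw [AlternatingMap.smul_apply, map_nsmul, MultilinearMap.alternatization_apply, map_sum,
    Finset.sum_eq_zero] at h2
  · have h3 : (Fintype.card (Fin 1)).factorial * (Fintype.card (Fin d)).factorial ≠ 0 := by
      positivity
    exact (smul_eq_zero.mp h2.symm).resolve_left h3
  · intro σ _
    rw [Units.smul_def, map_zsmul, MultilinearMap.domDomCongr_apply, MultilinearMap.domCoprod_apply,
      LinearMap.mul'_apply]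
    have key : ∀ i : Fin (1 + d), IsVerticalVector (v i) → (∃ b : Fin d,
        finSumFinEquiv (σ (Sum.inr b)) = i) → β (fun b => v (finSumFinEquiv (σ (Sum.inr b)))) = 0 := by
      rintro i hi ⟨b, hb⟩
      exact hβ _ b (by rw [hb]; exact hi)
    have hb : β (fun b => v (finSumFinEquiv (σ (Sum.inr b)))) = 0 := by
      rcases hi' : σ.symm (finSumFinEquiv.symm i) with a | b
      · rcases hj' : σ.symm (finSumFinEquiv.symm j) with a' | b
        · obtain rfl : a = a' := Subsingleton.elim _ _
          have := σ.symm.injective (hi'.trans hj'.symm)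
          exact absurd (finSumFinEquiv.symm.injective this) hij
        · refine key j hj ⟨b, ?_⟩
          rw [← hj']
          simp
      · refine key i hi ⟨b, ?_⟩
        rw [← hi']
        simp
    refine (congrArg _ (congrArg _ hb)).trans ?_
    rw [mul_zero, smul_zero]

theorem isHorizontal_omegaLower (μ : Fin (d + 1)) : IsHorizontal (omegaLower μ : Covec d m d) :=
  isHorizontal_volForm.contract _

/-- The canonical form depends linearly on the point. -/
def canonicalFormL (d m : ℕ) : Coord d m →L[ℝ] Covec d m (d + 1) :=
  ∑ a : Fin m, ∑ μ : Fin (d + 1),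
    (vertCoord (.inr (a, μ))).smulRight (wedge (Nat.add_comm 1 d) (dy a) (omegaLower μ))

theorem canonicalForm_eq : canonicalForm d m = canonicalFormL d m := by
  funext u
  simp only [canonicalForm, canonicalFormL, sum_apply, ContinuousLinearMap.smulRight_apply]
  rfl

theorem isSemiHorizontal_canonicalFormL (u : Coord d m) :
    IsSemiHorizontal (canonicalFormL d m u) := by
  intro v i j hij hi hj
  simp only [canonicalFormL, sum_apply, ContinuousLinearMap.smulRight_apply,
    ContinuousAlternatingMap.sum_apply, ContinuousAlternatingMap.smul_apply]
  refine Finset.sum_eq_zero fun a _ => Finset.sum_eq_zero fun μ _ => ?_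
  rw [isSemiHorizontal_wedge_one (Nat.add_comm 1 d) (dy a) (isHorizontal_omegaLower μ) v i j hij
    hi hj, smul_zero]

/-- The canonical form is linear in the point, so its derivative is itself and Ω has constant
coefficients in natural coordinates. -/
theorem polysymplecticForm_eq (u : Coord d m) :
    polysymplecticForm d m u =
      ContinuousAlternatingMap.alternatizeUncurryFin (canonicalFormL d m) := by
  rw [polysymplecticForm, extDeriv, canonicalForm_eq, ContinuousLinearMap.fderiv]

/-- The components `e_A ⌟ e_B ⌟ Ω` of the polysymplectic form. -/
def polyComp (B A : VIdx d m) : Covec d m d :=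
  insertVec (Nat.add_comm 1 d) (vertVec A) (insertVec (Nat.add_comm 1 (d + 1)) (vertVec B)
    (polysymplecticForm d m 0))

theorem polysymplecticForm_const (u : Coord d m) :
    polysymplecticForm d m u = polysymplecticForm d m 0 := by
  rw [polysymplecticForm_eq, polysymplecticForm_eq]

theorem polyComp_antisymm (A B : VIdx d m) : polyComp B A = -polyComp A B :=
  insertVec_insertVec _ _ _ _ _

theorem isHorizontal_polyComp (B A : VIdx d m) : IsHorizontal (polyComp B A) := by
  intro u i hu
  have h1 : ∀ v w, IsHorizontal (insertVec (Nat.add_comm 1 d) (vertVec v) (canonicalFormL d m w)) :=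
    fun v w => (isSemiHorizontal_canonicalFormL w).insertVec (isVerticalVector_vertVec v)
  rw [polyComp, polysymplecticForm_eq, insertVec_apply', insertVec_alternatize, Fin.sum_univ_succ,
    Finset.sum_eq_zero, add_zero]
  -- In the two surviving terms Ω differentiates along e_B or e_A, and the canonical form meets the
  -- other of these together with the vertical `u i`.
  · have h2 := h1 A (vertVec B) u i hu
    have h3 := h1 B (vertVec A) u i hu
    rw [insertVec_apply'] at h2
    simp only [Fin.cons_zero, Fin.removeNth_zero, Fin.tail_cons]
    rw [h2, h3]
    simp
  · intro j _
    -- In the remaining terms e_A is still an argument, so the canonical form meets both e_B and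
    -- e_A.
    rw [h1 B _ _ _ (show IsVerticalVector _ from ?_), mul_zero]
    · exact (⟨0, by have := j.2; omega⟩ : Fin d)
    · have : (j.succ.removeNth (Fin.cons (vertVec A) u : Fin (d + 1) → Coord d m))
          ⟨0, by have := j.2; omega⟩ = vertVec A := by
        have hd : 0 < d := by have := j.2; omega
        obtain ⟨e, rfl⟩ : ∃ e, d = e + 1 := ⟨d - 1, by omega⟩
        simp [Fin.removeNth]
      rw [this]
      exact isVerticalVector_vertVec A

/-! ### Calculus of interior products -/

theorem contDiffOn_contract {k l N : ℕ} (h : k + l = N) {U : Set (Coord d m)}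
    {X : Coord d m → Multivec d m k} {η : Coord d m → Covec d m N}
    (hX : ContDiffOn ℝ ∞ X U) (hη : ContDiffOn ℝ ∞ η U) :
    ContDiffOn ℝ ∞ (fun u => contract h (X u) (η u)) U :=
  ((contractL h).contDiff.comp_contDiffOn hX).clm_apply hη

theorem hasFDerivAt_contract {k l N : ℕ} (h : k + l = N) {u : Coord d m}
    {X : Coord d m → Multivec d m k} {η : Coord d m → Covec d m N}
    (hX : DifferentiableAt ℝ X u) (hη : DifferentiableAt ℝ η u) :
    DifferentiableAt ℝ (fun u => contract h (X u) (η u)) u ∧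
    ∀ w, fderiv ℝ (fun u => contract h (X u) (η u)) u w =
      contract h (fderiv ℝ X u w) (η u) + contract h (X u) (fderiv ℝ η u w) := by
  have := (contractL h).hasFDerivAt_of_bilinear hX.hasFDerivAt hη.hasFDerivAt
  refine ⟨this.differentiableAt, fun w => ?_⟩
  have h2 := DFunLike.congr_fun this.fderiv w
  exact h2.trans (add_comm (contract h (X u) (fderiv ℝ η u w)) (contract h (fderiv ℝ X u w) (η u)))

theorem fderiv_apply_component {k : ℕ} {u : Coord d m} {X : Coord d m → VIdx d m → Multivec d m k}
    (hX : DifferentiableAt ℝ X u) (A : VIdx d m) :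
    DifferentiableAt ℝ (fun u => X u A) u ∧
      ∀ w, fderiv ℝ (fun u => X u A) u w = fderiv ℝ X u w A := by
  have := (ContinuousLinearMap.proj (R := ℝ) (φ := fun _ : VIdx d m => Multivec d m k)
    A).hasFDerivAt.comp u hX.hasFDerivAt
  exact ⟨this.differentiableAt, fun w => DFunLike.congr_fun this.fderiv w⟩

/-- The sum `∑_A X_A ⌟ g_A` over the fibre directions. -/
def fibreContract {k l N : ℕ} (h : k + l = N) (X : VIdx d m → Multivec d m k)
    (g : VIdx d m → Covec d m N) : Covec d m l := ∑ A, contract h (X A) (g A)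

/-- The derivatives of a form along the fibre. -/
def fibreDeriv {q : ℕ} (G : Coord d m → Covec d m q) (u : Coord d m) (A : VIdx d m) : Covec d m q :=
  fderiv ℝ G u (vertVec A)

theorem contDiffOn_fibreContract {k l N : ℕ} (h : k + l = N) {U : Set (Coord d m)}
    {X : Coord d m → VIdx d m → Multivec d m k} {g : Coord d m → VIdx d m → Covec d m N}
    (hX : ContDiffOn ℝ ∞ X U) (hg : ContDiffOn ℝ ∞ g U) :
    ContDiffOn ℝ ∞ (fun u => fibreContract h (X u) (g u)) U :=
  ContDiffOn.sum fun A _ => contDiffOn_contract h (contDiffOn_pi.mp hX A) (contDiffOn_pi.mp hg A)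

theorem contDiffOn_fibreDeriv {q : ℕ} {U : Set (Coord d m)} (hU : IsOpen U)
    {G : Coord d m → Covec d m q} (hG : ContDiffOn ℝ ∞ G U) :
    ContDiffOn ℝ ∞ (fibreDeriv G) U :=
  contDiffOn_pi.mpr fun _ => (hG.fderiv_of_isOpen hU (by simp)).clm_apply contDiffOn_const

theorem fderiv_fibreContract {k l N : ℕ} (h : k + l = N) {u : Coord d m}
    {X : Coord d m → VIdx d m → Multivec d m k} {g : Coord d m → VIdx d m → Covec d m N}
    (hX : DifferentiableAt ℝ X u) (hg : DifferentiableAt ℝ g u) (w : Coord d m) :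
    fderiv ℝ (fun u => fibreContract h (X u) (g u)) u w =
      fibreContract h (fderiv ℝ X u w) (g u) + fibreContract h (X u) (fderiv ℝ g u w) := by
  have hgA : ∀ A, DifferentiableAt ℝ (fun u => g u A) u ∧
      ∀ w, fderiv ℝ (fun u => g u A) u w = fderiv ℝ g u w A := fun A => by
    have := (ContinuousLinearMap.proj (R := ℝ) (φ := fun _ : VIdx d m => Covec d m N)
      A).hasFDerivAt.comp u hg.hasFDerivAt
    exact ⟨this.differentiableAt, fun w => DFunLike.congr_fun this.fderiv w⟩
  have hA := fun A => hasFDerivAt_contract h (fderiv_apply_component hX A).1 (hgA A).1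
  have hsum : fderiv ℝ (fun u => fibreContract h (X u) (g u)) u =
      ∑ A, fderiv ℝ (fun u => contract h (X u A) (g u A)) u :=
    fderiv_fun_sum fun A _ => (hA A).1
  rw [hsum, sum_apply, fibreContract, fibreContract, ← Finset.sum_add_distrib]
  refine Finset.sum_congr rfl fun A _ => ?_
  rw [(hA A).2, (fderiv_apply_component hX A).2, (hgA A).2]

theorem fderiv_fibreDeriv {q : ℕ} {G : Coord d m → Covec d m q} {U : Set (Coord d m)}
    (hU : IsOpen U) (hG : ContDiffOn ℝ ∞ G U) {u : Coord d m} (hu : u ∈ U) (w : Coord d m)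
    (A : VIdx d m) : fderiv ℝ (fibreDeriv G) u w A = fderiv ℝ (fderiv ℝ G) u w (vertVec A) := by
  have h1 : DifferentiableAt ℝ (fderiv ℝ G) u :=
    ((hG.fderiv_of_isOpen (m := ∞) hU (by simp)).contDiffAt (hU.mem_nhds hu)).differentiableAt
      (by simp)
  let Λ : (Coord d m →L[ℝ] Covec d m q) →L[ℝ] (VIdx d m → Covec d m q) :=
    ContinuousLinearMap.pi fun A => ContinuousLinearMap.apply ℝ (Covec d m q) (vertVec A)
  have h2 : HasFDerivAt (fibreDeriv G) (Λ.comp (fderiv ℝ (fderiv ℝ G) u)) u :=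
    Λ.hasFDerivAt.comp u h1.hasFDerivAt
  rw [h2.fderiv]
  rfl

theorem two_le_smooth : minSmoothness ℝ 2 ≤ (∞ : WithTop ℕ∞) := by
  rw [minSmoothness_of_isRCLikeNormedField]
  exact WithTop.coe_le_coe.2 (le_top : (2 : ℕ∞) ≤ ⊤)

theorem fderiv_fibreDeriv_symm {q : ℕ} {G : Coord d m → Covec d m q} {U : Set (Coord d m)}
    (hU : IsOpen U) (hG : ContDiffOn ℝ ∞ G U) {u : Coord d m} (hu : u ∈ U) (A B : VIdx d m) :
    fderiv ℝ (fibreDeriv G) u (vertVec A) B = fderiv ℝ (fibreDeriv G) u (vertVec B) A := by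
  rw [fderiv_fibreDeriv hU hG hu, fderiv_fibreDeriv hU hG hu]
  exact ((hG.contDiffAt (hU.mem_nhds hu)).isSymmSndFDerivAt two_le_smooth) _ _

section Linear
variable {k l N : ℕ} (h : k + l = N)

theorem fibreContract_smul_right (c : ℝ) (X : VIdx d m → Multivec d m k)
    (g : VIdx d m → Covec d m N) :
    fibreContract h X (c • g) = c • fibreContract h X g := by
  simp only [fibreContract, Pi.smul_apply, contract_smul_right, Finset.smul_sum]

theorem fibreContract_add_right (X : VIdx d m → Multivec d m k) (g g' : VIdx d m → Covec d m N) :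
    fibreContract h X (g + g') = fibreContract h X g + fibreContract h X g' := by
  simp only [fibreContract, Pi.add_apply, contract_add_right, Finset.sum_add_distrib]

theorem fibreContract_smul_left (c : ℝ) (X : VIdx d m → Multivec d m k)
    (g : VIdx d m → Covec d m N) :
    fibreContract h (c • X) g = c • fibreContract h X g := by
  simp only [fibreContract, Pi.smul_apply, contract_smul_left, Finset.smul_sum]

theorem fibreContract_sub_left (X X' : VIdx d m → Multivec d m k)
    (g : VIdx d m → Covec d m N) :
    fibreContract h (X - X') g = fibreContract h X g - fibreContract h X' g := by
  simp only [fibreContract, Pi.sub_apply, contract_sub_left, Finset.sum_sub_distrib]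

theorem contract_fibreContract {j z y : ℕ} (h2 : j + z = l) (h3 : j + y = N) (h4 : k + z = y)
    (φ : Multivec d m j) (X : VIdx d m → Multivec d m k) (g : VIdx d m → Covec d m N) :
    contract h2 φ (fibreContract h X g) =
      (-1 : ℝ) ^ (k * j) • fibreContract h4 X (fun A => contract h3 φ (g A)) := by
  simp only [fibreContract, contract_sum_right, Finset.smul_sum]
  exact Finset.sum_congr rfl fun A _ => contract_contract h h2 h3 h4 _ _ _

theorem IsHorizontal.fibreContract {g : VIdx d m → Covec d m N} (hg : ∀ A, IsHorizontal (g A))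
    (X : VIdx d m → Multivec d m k) : IsHorizontal (fibreContract h X g) :=
  isHorizontal_sum _ fun A _ => (hg A).contract _

end Linear

/-! ### Hamilton's equations in components -/

/-- Hamilton's equations for the components `X_A` of a vertical multivector field. -/
structure HamiltonEquations {k p : ℕ} (h : k + p = d) (U : Set (Coord d m))
    (X : Coord d m → VIdx d m → Multivec d m k) (F : Coord d m → Covec d m p) : Prop where
  smooth : ContDiffOn ℝ ∞ X U
  eq : ∀ u ∈ U, ∀ B, fibreDeriv F u B = (-1 : ℝ) ^ (k + 1) • fibreContract h (X u) (polyComp B)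

/-- Since Ω is constant, the derivative of X in any direction satisfies the linearized equations
with the same coefficients. -/
theorem HamiltonEquations.fderiv_eq {k p : ℕ} {h : k + p = d} {U : Set (Coord d m)}
    {X : Coord d m → VIdx d m → Multivec d m k} {F : Coord d m → Covec d m p}
    (H : HamiltonEquations h U X F) (hU : IsOpen U) (hF : ContDiffOn ℝ ∞ F U) {u : Coord d m}
    (hu : u ∈ U) (w : Coord d m) (B : VIdx d m) :
    fderiv ℝ (fibreDeriv F) u w B =
      (-1 : ℝ) ^ (k + 1) • fibreContract h (fderiv ℝ X u w) (polyComp B) := by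
  have h1 : DifferentiableAt ℝ (fibreDeriv F) u :=
    ((contDiffOn_fibreDeriv hU hF).contDiffAt (hU.mem_nhds hu)).differentiableAt (by simp)
  have h2 := ((ContinuousLinearMap.proj (R := ℝ) (φ := fun _ : VIdx d m => Covec d m p)
      B).hasFDerivAt.comp u h1.hasFDerivAt)
  have h3 : (fun u => fibreDeriv F u B) =ᶠ[nhds u]
      fun u => (-1 : ℝ) ^ (k + 1) • fibreContract h (X u) (polyComp B) := by
    filter_upwards [hU.mem_nhds hu] with v hv using H.eq v hv B
  have hX : DifferentiableAt ℝ X u :=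
    (H.smooth.contDiffAt (hU.mem_nhds hu)).differentiableAt (by simp)
  have h4 := fderiv_fibreContract h (g := fun _ => polyComp B) hX
    (differentiableAt_const _) w
  have h5 : DifferentiableAt ℝ (fun u => fibreContract h (X u) (polyComp B)) u :=
    ((contDiffOn_fibreContract h H.smooth contDiffOn_const).contDiffAt
      (hU.mem_nhds hu)).differentiableAt (by simp)
  have h6 : fderiv ℝ (fibreDeriv F) u w B = fderiv ℝ (fun u => fibreDeriv F u B) u w :=
    (DFunLike.congr_fun h2.fderiv w).symm
  rw [h6, h3.fderiv_eq, fderiv_fun_const_smul h5, smul_apply, h4]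
  congr 1
  simp [fibreContract, contract_zero_right]

/-- Both sides are the same multiple of a second fibre derivative of F. This is the coordinate form
of X preserving Ω. -/
theorem HamiltonEquations.symm {k p : ℕ} {h : k + p = d} {U : Set (Coord d m)}
    {X : Coord d m → VIdx d m → Multivec d m k} {F : Coord d m → Covec d m p}
    (H : HamiltonEquations h U X F) (hU : IsOpen U) (hF : ContDiffOn ℝ ∞ F U) {u : Coord d m}
    (hu : u ∈ U) (A B : VIdx d m) :
    fibreContract h (fderiv ℝ X u (vertVec A)) (polyComp B) =
      fibreContract h (fderiv ℝ X u (vertVec B)) (polyComp A) := by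
  have h1 := fderiv_fibreDeriv_symm hU hF hu A B
  rw [H.fderiv_eq hU hF hu, H.fderiv_eq hU hF hu] at h1
  exact smul_right_injective _ (pow_ne_zero _ (by norm_num)) h1

/-! ### Antisymmetry, closure and Jacobi identity in components -/

theorem fibreContract_antisymm {k l p q r : ℕ} (hF : k + p = d) (hG : l + q = d) (hkr : k + r = q)
    (hlr : l + r = p) (X : VIdx d m → Multivec d m k) (Y : VIdx d m → Multivec d m l) :
    fibreContract hkr X (fun A => fibreContract hG Y (polyComp A)) =
      -((-1 : ℝ) ^ (k * l) •
        fibreContract hlr Y (fun A => fibreContract hF X (polyComp A))) := by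
  simp only [fibreContract, contract_sum_right, Finset.smul_sum, ← Finset.sum_neg_distrib]
  rw [Finset.sum_comm]
  refine Finset.sum_congr rfl fun A _ => Finset.sum_congr rfl fun B _ => ?_
  -- The minus sign is the antisymmetry of Ω; the power comes from exchanging the two contractions.
  rw [polyComp_antisymm, contract_neg_right, contract_neg_right, mul_comm k l,
    contract_contract hG hkr hF hlr]

/-- The derivative of the components of a multivector field along another one. -/
def transport {k l N : ℕ} (h : l + k = N) (X : VIdx d m → Multivec d m k)
    (Y' : VIdx d m → VIdx d m → Multivec d m l) (E : VIdx d m) : Multivec d m N :=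
  ∑ B, mwedge h (Y' B E) (X B)

theorem fibreContract_transport {k l N r q s : ℕ} (h : l + k = N) (hNr : N + r = s)
    (hl : l + q = s) (hkr : k + r = q)
    (X : VIdx d m → Multivec d m k) (Y' : VIdx d m → VIdx d m → Multivec d m l)
    (g : VIdx d m → Covec d m s) :
    fibreContract hNr (transport h X Y') g =
      fibreContract hkr X (fun B => fibreContract hl (Y' B) g) := by
  simp only [fibreContract, transport, contract_sum_left, contract_sum_right]
  rw [Finset.sum_comm]
  refine Finset.sum_congr rfl fun B _ => Finset.sum_congr rfl fun E _ => ?_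
  rw [contract_mwedge hl hkr]

/-- Components of the multivector field of a bracket; `X' B` is the derivative of `X` along the
fibre direction `B`. -/
def bracketComp {k l N : ℕ} (h : k + l = N) (X : VIdx d m → Multivec d m k)
    (Y : VIdx d m → Multivec d m l) (X' : VIdx d m → VIdx d m → Multivec d m k)
    (Y' : VIdx d m → VIdx d m → Multivec d m l) : VIdx d m → Multivec d m N :=
  (-1 : ℝ) ^ (k * l) • transport h Y X' - transport (by omega) X Y'

/-- The hypotheses `hX` and `hY` exchange the direction C with the summed index of Ω, turning ∂_C X
and ∂_C Y into transports contracted with Ω_C. The first term is brought to this shape by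
antisymmetry. -/
theorem bracketComp_closure {k l N p q r : ℕ} (hF : k + p = d) (hG : l + q = d) (hkr : k + r = q)
    (hlr : l + r = p) (hN : k + l = N) (hNr : N + r = d)
    (X : VIdx d m → Multivec d m k)
    (Y : VIdx d m → Multivec d m l) (X' : VIdx d m → VIdx d m → Multivec d m k)
    (Y' : VIdx d m → VIdx d m → Multivec d m l)
    (hX : ∀ A B, fibreContract hF (X' A) (polyComp B) = fibreContract hF (X' B) (polyComp A))
    (hY : ∀ A B, fibreContract hG (Y' A) (polyComp B) = fibreContract hG (Y' B) (polyComp A))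
    (C : VIdx d m) :
    fibreContract hkr (X' C) (fun A => fibreContract hG Y (polyComp A)) +
      fibreContract hkr X (fun A => fibreContract hG (Y' C) (polyComp A)) =
    -fibreContract hNr (bracketComp hN X Y X' Y') (polyComp C) := by
  rw [bracketComp, fibreContract_sub_left, fibreContract_smul_left,
    fibreContract_transport hN hNr hF hlr, fibreContract_transport _ hNr hG hkr,
    fibreContract_antisymm hF hG hkr hlr]
  simp only [hX C, hY C]
  abel

/-- The second-derivative terms `c'` agree by symmetry and graded commutation and cancel; what
remains are the two transports. Ω plays no role here. -/
theorem jacobi_comp {k l N p q r : ℕ} (hF : k + p = d) (hG : l + q = d) (hkr : k + r = q)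
    (hlr : l + r = p) (hN : k + l = N) (hNr : N + r = d)
    (X : VIdx d m → Multivec d m k)
    (Y : VIdx d m → Multivec d m l) (X' : VIdx d m → VIdx d m → Multivec d m k)
    (Y' : VIdx d m → VIdx d m → Multivec d m l)
    (c : VIdx d m → Covec d m d) (c' : VIdx d m → VIdx d m → Covec d m d)
    (hc : ∀ A B, c' A B = c' B A) :
    -fibreContract hNr (bracketComp hN X Y X' Y') c =
      fibreContract hkr X (fun B => fibreContract hG (Y' B) c + fibreContract hG Y (c' B)) -
      (-1 : ℝ) ^ (k * l) •
        fibreContract hlr Y (fun B => fibreContract hF (X' B) c + fibreContract hF X (c' B)) := by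
  have h1 : fibreContract hkr X (fun B => fibreContract hG Y (c' B)) =
      (-1 : ℝ) ^ (k * l) • fibreContract hlr Y (fun B => fibreContract hF X (c' B)) := by
    simp only [fibreContract, contract_sum_right, Finset.smul_sum]
    rw [Finset.sum_comm]
    refine Finset.sum_congr rfl fun A _ => Finset.sum_congr rfl fun B _ => ?_
    rw [hc, mul_comm k l, contract_contract hG hkr hF hlr]
  have h2 : ∀ (g g' : VIdx d m → Covec d m q), fibreContract hkr X (fun B => g B + g' B) =
    fibreContract hkr X g + fibreContract hkr X g' := fibreContract_add_right hkr X
  have h3 : ∀ (g g' : VIdx d m → Covec d m p), fibreContract hlr Y (fun B => g B + g' B) =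
    fibreContract hlr Y g + fibreContract hlr Y g' := fibreContract_add_right hlr Y
  rw [bracketComp, fibreContract_sub_left, fibreContract_smul_left,
    fibreContract_transport hN hNr hF hlr, fibreContract_transport _ hNr hG hkr, h2, h3, h1,
    smul_add]
  abel

/-- The components of the multivector field of the bracket of two forms. -/
def bracketField {k l N : ℕ} (h : k + l = N) (X : Coord d m → VIdx d m → Multivec d m k)
    (Y : Coord d m → VIdx d m → Multivec d m l) (u : Coord d m) : VIdx d m → Multivec d m N :=
  bracketComp h (X u) (Y u) (fun B => fderiv ℝ X u (vertVec B)) (fun B => fderiv ℝ Y u (vertVec B))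

/-- The map `mwedge` as a bilinear map. -/
def mwedgeL {k l N : ℕ} (h : k + l = N) :
    Multivec d m k →L[ℝ] Multivec d m l →L[ℝ] Multivec d m N :=
  LinearMap.toContinuousBilinearMap <| LinearMap.mk₂ ℝ (mwedge h)
    (fun X X' Y => by ext α; simp [mwedge_apply, contract_add_left])
    (fun c X Y => by ext α; simp [mwedge_apply, contract_smul_left])
    (fun _ _ _ => rfl) (fun _ _ _ => rfl)

theorem contDiffOn_mwedge {k l N : ℕ} (h : k + l = N) {U : Set (Coord d m)}
    {X : Coord d m → Multivec d m k} {Y : Coord d m → Multivec d m l}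
    (hX : ContDiffOn ℝ ∞ X U) (hY : ContDiffOn ℝ ∞ Y U) :
    ContDiffOn ℝ ∞ (fun u => mwedge h (X u) (Y u)) U :=
  ((mwedgeL (d := d) (m := m) h).contDiff.comp_contDiffOn hX).clm_apply hY

theorem contDiffOn_transport {k l N : ℕ} (h : l + k = N) {U : Set (Coord d m)} (hU : IsOpen U)
    {X : Coord d m → VIdx d m → Multivec d m k} {Y : Coord d m → VIdx d m → Multivec d m l}
    (hX : ContDiffOn ℝ ∞ X U) (hY : ContDiffOn ℝ ∞ Y U) :
    ContDiffOn ℝ ∞ (fun u => transport h (X u) (fun B => fderiv ℝ Y u (vertVec B))) U :=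
  contDiffOn_pi.mpr fun E => ContDiffOn.sum fun B _ => contDiffOn_mwedge h
    (contDiffOn_pi.mp ((hY.fderiv_of_isOpen hU (by simp)).clm_apply contDiffOn_const) E)
    (contDiffOn_pi.mp hX B)

theorem contDiffOn_bracketField {k l N : ℕ} (h : k + l = N) {U : Set (Coord d m)} (hU : IsOpen U)
    {X : Coord d m → VIdx d m → Multivec d m k} {Y : Coord d m → VIdx d m → Multivec d m l}
    (hX : ContDiffOn ℝ ∞ X U) (hY : ContDiffOn ℝ ∞ Y U) :
    ContDiffOn ℝ ∞ (bracketField h X Y) U :=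
  ((contDiffOn_transport h hU hY hX).const_smul _).sub (contDiffOn_transport _ hU hX hY)

/-- The local expression `(-1)^{k+1} ∑_A X_A ⌟ ∂_A G` of a bracket. -/
def localBracket {k r q : ℕ} (h : k + r = q) (X : Coord d m → VIdx d m → Multivec d m k)
    (G : Coord d m → Covec d m q) (u : Coord d m) : Covec d m r :=
  (-1 : ℝ) ^ (k + 1) • fibreContract h (X u) (fibreDeriv G u)

theorem fibreDeriv_localBracket {k r q : ℕ} (h : k + r = q) {U : Set (Coord d m)} (hU : IsOpen U)
    {X : Coord d m → VIdx d m → Multivec d m k} {G : Coord d m → Covec d m q}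
    (hX : ContDiffOn ℝ ∞ X U) (hG : ContDiffOn ℝ ∞ G U) {u : Coord d m} (hu : u ∈ U)
    (C : VIdx d m) :
    fibreDeriv (localBracket h X G) u C = (-1 : ℝ) ^ (k + 1) •
      (fibreContract h (fderiv ℝ X u (vertVec C)) (fibreDeriv G u) +
        fibreContract h (X u) (fderiv ℝ (fibreDeriv G) u (vertVec C))) := by
  have hG' := contDiffOn_fibreDeriv hU hG
  have h1 : DifferentiableAt ℝ X u := (hX.contDiffAt (hU.mem_nhds hu)).differentiableAt (by simp)
  have h2 : DifferentiableAt ℝ (fibreDeriv G) u :=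
    (hG'.contDiffAt (hU.mem_nhds hu)).differentiableAt (by simp)
  have h3 : DifferentiableAt ℝ (fun u => fibreContract h (X u) (fibreDeriv G u)) u :=
    ((contDiffOn_fibreContract h hX hG').contDiffAt (hU.mem_nhds hu)).differentiableAt (by simp)
  have h4 : fderiv ℝ (localBracket h X G) u =
      (-1 : ℝ) ^ (k + 1) • fderiv ℝ (fun u => fibreContract h (X u) (fibreDeriv G u)) u :=
    fderiv_fun_const_smul h3 _
  rw [fibreDeriv, h4, smul_apply, fderiv_fibreContract h h1 h2]

theorem fibreDeriv_congr {q : ℕ} {G G' : Coord d m → Covec d m q} {U : Set (Coord d m)}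
    (hU : IsOpen U) (h : ∀ u ∈ U, G u = G' u) {u : Coord d m} (hu : u ∈ U) :
    fibreDeriv G u = fibreDeriv G' u := by
  have : G =ᶠ[nhds u] G' := by filter_upwards [hU.mem_nhds hu] with v hv using h v hv
  funext A
  rw [fibreDeriv, fibreDeriv, this.fderiv_eq]

/-- Hamilton's equations for a bracket. -/
theorem HamiltonEquations.bracket {k l N p q r : ℕ} {hF : k + p = d} {hG : l + q = d}
    (hkr : k + r = q) (hN : k + l = N) (hNr : N + r = d)
    {U : Set (Coord d m)} (hU : IsOpen U)
    {X : Coord d m → VIdx d m → Multivec d m k} {F : Coord d m → Covec d m p}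
    {Y : Coord d m → VIdx d m → Multivec d m l} {G : Coord d m → Covec d m q}
    (HX : HamiltonEquations hF U X F) (HY : HamiltonEquations hG U Y G)
    (hFs : ContDiffOn ℝ ∞ F U) (hGs : ContDiffOn ℝ ∞ G U) :
    HamiltonEquations hNr U (bracketField hN X Y) (localBracket hkr X G) := by
  refine ⟨contDiffOn_bracketField hN hU HX.smooth HY.smooth, fun u hu C => ?_⟩
  have h1 : fibreDeriv G u = (-1 : ℝ) ^ (l + 1) • fun B => fibreContract hG (Y u) (polyComp B) :=
    funext fun B => HY.eq u hu B
  have h2 : fderiv ℝ (fibreDeriv G) u (vertVec C) =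
      (-1 : ℝ) ^ (l + 1) • fun B => fibreContract hG (fderiv ℝ Y u (vertVec C)) (polyComp B) :=
    funext fun B => HY.fderiv_eq hU hGs hu _ B
  rw [fibreDeriv_localBracket hkr hU HX.smooth hGs hu, h1, h2, fibreContract_smul_right,
    fibreContract_smul_right, ← smul_add]
  -- Hamilton's equations for G have turned ∂G and its derivative into contractions with Ω. The
  -- minus sign from closure combines with (-1)^{k+1}(-1)^{l+1} to the required (-1)^{N+1}.
  have h3 := bracketComp_closure hF hG hkr (by omega : l + r = p) hN hNr (X u) (Y u)
    (fun B => fderiv ℝ X u (vertVec B)) (fun B => fderiv ℝ Y u (vertVec B))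
    (fun A B => HX.symm hU hFs hu A B) (fun A B => HY.symm hU hGs hu A B) C
  rw [h3, bracketField, smul_smul, smul_neg, ← neg_smul]
  congr 1
  subst hN
  ring

/-- Antisymmetry of the bracket. -/
theorem localBracket_antisymm {k l p q r : ℕ} {hF : k + p = d} {hG : l + q = d}
    (hkr : k + r = q) (hlr : l + r = p) {U : Set (Coord d m)}
    {X : Coord d m → VIdx d m → Multivec d m k} {F : Coord d m → Covec d m p}
    {Y : Coord d m → VIdx d m → Multivec d m l} {G : Coord d m → Covec d m q}
    (HX : HamiltonEquations hF U X F) (HY : HamiltonEquations hG U Y G) {u : Coord d m}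
    (hu : u ∈ U) :
    localBracket hkr X G u = -((-1 : ℝ) ^ (k * l) • localBracket hlr Y F u) := by
  have h1 : fibreDeriv G u = (-1 : ℝ) ^ (l + 1) • fun B => fibreContract hG (Y u) (polyComp B) :=
    funext fun B => HY.eq u hu B
  have h2 : fibreDeriv F u = (-1 : ℝ) ^ (k + 1) • fun B => fibreContract hF (X u) (polyComp B) :=
    funext fun B => HX.eq u hu B
  rw [localBracket, localBracket, h1, h2, fibreContract_smul_right, fibreContract_smul_right,
    fibreContract_antisymm hF hG hkr hlr]
  simp only [smul_neg, smul_smul]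
  congr 2
  ring

/-- The Jacobi identity for the action of a bracket on a form of degree `n - 1`. -/
theorem localBracket_jacobi {k l N p q r : ℕ} (hF : k + p = d) (hG : l + q = d)
    (hkr : k + r = q) (hlr : l + r = p) (hN : k + l = N) (hNr : N + r = d)
    {U : Set (Coord d m)} (hU : IsOpen U)
    {X : Coord d m → VIdx d m → Multivec d m k} {Y : Coord d m → VIdx d m → Multivec d m l}
    {C : Coord d m → Covec d m d}
    (hX : ContDiffOn ℝ ∞ X U) (hY : ContDiffOn ℝ ∞ Y U) (hC : ContDiffOn ℝ ∞ C U)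
    {u : Coord d m} (hu : u ∈ U) :
    localBracket hNr (bracketField hN X Y) C u =
      localBracket hkr X (localBracket hG Y C) u -
        (-1 : ℝ) ^ (k * l) • localBracket hlr Y (localBracket hF X C) u := by
  have h1 := jacobi_comp hF hG hkr hlr hN hNr (X u) (Y u)
    (fun B => fderiv ℝ X u (vertVec B)) (fun B => fderiv ℝ Y u (vertVec B)) (fibreDeriv C u)
    (fun A => fderiv ℝ (fibreDeriv C) u (vertVec A)) (fderiv_fibreDeriv_symm hU hC hu)
  have h2 : fibreDeriv (localBracket hG Y C) u = (-1 : ℝ) ^ (l + 1) • fun B =>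
      fibreContract hG (fderiv ℝ Y u (vertVec B)) (fibreDeriv C u) +
        fibreContract hG (Y u) (fderiv ℝ (fibreDeriv C) u (vertVec B)) :=
    funext fun B => fibreDeriv_localBracket hG hU hY hC hu B
  have h3 : fibreDeriv (localBracket hF X C) u = (-1 : ℝ) ^ (k + 1) • fun B =>
      fibreContract hF (fderiv ℝ X u (vertVec B)) (fibreDeriv C u) +
        fibreContract hF (X u) (fderiv ℝ (fibreDeriv C) u (vertVec B)) :=
    funext fun B => fibreDeriv_localBracket hF hU hX hC hu B
  rw [localBracket, localBracket, localBracket, h2, h3, fibreContract_smul_right,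
    fibreContract_smul_right, bracketField]
  have h4 := congrArg (fun z => (-1 : ℝ) ^ N • z) h1
  simp only [smul_neg, smul_sub, ← neg_smul, smul_smul] at h4
  have h5 : (-1 : ℝ) ^ (N + 1) = -(-1) ^ N := by ring
  rw [h5, h4]
  simp only [smul_smul]
  congr 2
  · subst hN
    ring
  · subst hN
    ring

/-! ### Hamiltonian multivector fields in coordinates -/

theorem isHorizontal_fderiv {q : ℕ} {U : Set (Coord d m)} (hU : IsOpen U)
    {G : Coord d m → Covec d m q} (hG : ContDiffOn ℝ ∞ G U) (hGh : ∀ u ∈ U, IsHorizontal (G u))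
    {u : Coord d m} (hu : u ∈ U) (w : Coord d m) : IsHorizontal (fderiv ℝ G u w) := by
  intro v i hv
  have h1 : DifferentiableAt ℝ G u := (hG.contDiffAt (hU.mem_nhds hu)).differentiableAt (by simp)
  have h2 := ((decomposable v).hasFDerivAt.comp u h1.hasFDerivAt)
  have h3 : (fun u => G u v) =ᶠ[nhds u] fun _ => (0 : ℝ) := by
    filter_upwards [hU.mem_nhds hu] with x hx using hGh x hx v i hv
  have h4 : fderiv ℝ (fun u => G u v) u = 0 := by
    rw [h3.fderiv_eq]
    simp
  have h5 : fderiv ℝ (fun u => G u v) u w = fderiv ℝ G u w v := DFunLike.congr_fun h2.fderiv w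
  rw [← h5, h4]
  rfl

theorem insertVec_extDeriv {q : ℕ} {U : Set (Coord d m)} (hU : IsOpen U)
    {G : Coord d m → Covec d m q} (hG : ContDiffOn ℝ ∞ G U) (hGh : ∀ u ∈ U, IsHorizontal (G u))
    {u : Coord d m} (hu : u ∈ U) (A : VIdx d m) :
    insertVec (Nat.add_comm 1 q) (vertVec A) (extDeriv G u) = fibreDeriv G u A :=
  insertVec_alternatize_of_isHorizontal (isHorizontal_fderiv hU hG hGh hu)
    (isVerticalVector_vertVec A)

theorem isHorizontal_fibreDeriv {q : ℕ} {U : Set (Coord d m)} (hU : IsOpen U)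
    {G : Coord d m → Covec d m q} (hG : ContDiffOn ℝ ∞ G U) (hGh : ∀ u ∈ U, IsHorizontal (G u))
    {u : Coord d m} (hu : u ∈ U) (A : VIdx d m) : IsHorizontal (fibreDeriv G u A) :=
  isHorizontal_fderiv hU hG hGh hu _

/-- The interior product of a vertical multivector field with the differential of a horizontal form
only involves derivatives along the fibre. -/
theorem contract_extDeriv {k k' q r : ℕ} (h : k' + r = q + 1) (hk : 1 + k = k') (hkr : k + r = q)
    {U : Set (Coord d m)} (hU : IsOpen U)
    {G : Coord d m → Covec d m q} (hG : ContDiffOn ℝ ∞ G U) (hGh : ∀ u ∈ U, IsHorizontal (G u))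
    {u : Coord d m} (hu : u ∈ U) {X : Multivec d m k'} (hX : IsVertical X) :
    contract h X (extDeriv G u) = fibreContract hkr (fun A => slice hk A X) (fibreDeriv G u) := by
  have hins := insertVec_extDeriv hU hG hGh hu
  rw [contract_eq_sum_slice h hk (Nat.add_comm 1 q) hkr hX, fibreContract]
  · simp only [hins]
  · intro A
    rw [hins]
    exact isHorizontal_fibreDeriv hU hG hGh hu A

/-- Hamilton's equation at a point, in components. -/
theorem isHorizontal_contract_sub_iff {k k' p : ℕ} (h : k' + (p + 1) = d + 1 + 1) (hk : 1 + k = k')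
    (hp : k + p = d) {U : Set (Coord d m)} (hU : IsOpen U)
    {F : Coord d m → Covec d m p} (hF : ContDiffOn ℝ ∞ F U) (hFh : ∀ u ∈ U, IsHorizontal (F u))
    {u : Coord d m} (hu : u ∈ U) {X : Multivec d m k'} {W : VIdx d m → Multivec d m k}
    (hXW : ∀ B, contract (by omega : k' + p = d + 1) X
      (insertVec (Nat.add_comm 1 (d + 1)) (vertVec B) (polysymplecticForm d m 0)) =
        fibreContract hp W (polyComp B)) :
    IsHorizontal (contract h X (polysymplecticForm d m u) - extDeriv F u) ↔
      ∀ B, fibreDeriv F u B = (-1 : ℝ) ^ (k + 1) • fibreContract hp W (polyComp B) := by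
  -- A covector is horizontal when all vertical insertions vanish; moving e_B past X, of degree k+1,
  -- gives the sign.
  have key : ∀ B, insertVec (Nat.add_comm 1 p) (vertVec B)
      (contract h X (polysymplecticForm d m u) - extDeriv F u) =
      (-1 : ℝ) ^ (k + 1) • fibreContract hp W (polyComp B) - fibreDeriv F u B := by
    intro B
    rw [insertVec, contract_sub_right, ← insertVec, ← insertVec, insertVec_extDeriv hU hF hFh hu,
      insertVec_contract h (Nat.add_comm 1 p) (Nat.add_comm 1 (d + 1))
        (by omega : k' + p = d + 1), polysymplecticForm_const, hXW, ← hk, add_comm 1 k]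
  constructor
  · intro H B
    have := H.insertVec_eq_zero (h := Nat.add_comm 1 p) (isVerticalVector_vertVec B)
    rw [key, sub_eq_zero] at this
    exact this.symm
  · intro H
    refine isHorizontal_of_insertVec (Nat.add_comm 1 p) fun B => ?_
    rw [key, H, sub_self]

theorem contract_insertVec_polysymplecticForm_slice {k k' p : ℕ} (hk : 1 + k = k')
    (hp : k + p = d) (h : k' + p = d + 1) {X : Multivec d m k'} (hX : IsVertical X)
    (B : VIdx d m) :
    contract h X (insertVec (Nat.add_comm 1 (d + 1)) (vertVec B) (polysymplecticForm d m 0)) =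
      fibreContract hp (fun A => slice hk A X) (polyComp B) :=
  contract_eq_sum_slice h hk (Nat.add_comm 1 d) hp hX fun A => isHorizontal_polyComp B A

theorem contract_insertVec_polysymplecticForm_ofComponents {k k' p : ℕ} (hk : 1 + k = k')
    (hp : k + p = d) (h : k' + p = d + 1) (W : VIdx d m → Multivec d m k)
    (B : VIdx d m) :
    contract h (ofComponents hk W)
      (insertVec (Nat.add_comm 1 (d + 1)) (vertVec B) (polysymplecticForm d m 0)) =
      fibreContract hp W (polyComp B) :=
  contract_ofComponents h hk (Nat.add_comm 1 d) hp W fun A => isHorizontal_polyComp B A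

/-! ### The Leibniz rule and associativity of the co-exterior product -/

theorem isHorizontal_coExterior (ε : Fin (d + 1) → ℤˣ) {a b r : ℕ} (ha : a ≤ d + 1)
    (hb : b ≤ d + 1) (h : a + b = d + 1 + r) (α : Covec d m a) (β : Covec d m b) :
    IsHorizontal (coExterior ε ha hb h α β) :=
  (isHorizontal_hodge ε _ _).smul _

theorem coExterior_smul_left (ε : Fin (d + 1) → ℤˣ) {a b r : ℕ} (ha : a ≤ d + 1)
    (hb : b ≤ d + 1) (h : a + b = d + 1 + r) (c : ℝ) (α : Covec d m a) (β : Covec d m b) :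
    coExterior ε ha hb h (c • α) β = c • coExterior ε ha hb h α β := by
  obtain ⟨L, hL⟩ := coExterior_eq_linear (m := m) ε ha hb h
  rw [hL, hL, map_smul, LinearMap.smul_apply]

theorem coExterior_smul_right (ε : Fin (d + 1) → ℤˣ) {a b r : ℕ} (ha : a ≤ d + 1)
    (hb : b ≤ d + 1) (h : a + b = d + 1 + r) (c : ℝ) (α : Covec d m a) (β : Covec d m b) :
    coExterior ε ha hb h α (c • β) = c • coExterior ε ha hb h α β := by
  obtain ⟨L, hL⟩ := coExterior_eq_linear (m := m) ε ha hb h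
  rw [hL, hL, map_smul]

theorem coExterior_sum_right (ε : Fin (d + 1) → ℤˣ) {a b r : ℕ} (ha : a ≤ d + 1)
    (hb : b ≤ d + 1) (h : a + b = d + 1 + r) {κ : Type*} (s : Finset κ) (α : Covec d m a)
    (β : κ → Covec d m b) :
    coExterior ε ha hb h α (∑ i ∈ s, β i) = ∑ i ∈ s, coExterior ε ha hb h α (β i) := by
  obtain ⟨L, hL⟩ := coExterior_eq_linear (m := m) ε ha hb h
  simp only [hL, map_sum]

theorem contDiffOn_coExterior (ε : Fin (d + 1) → ℤˣ) {a b r : ℕ} (ha : a ≤ d + 1)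
    (hb : b ≤ d + 1) (h : a + b = d + 1 + r) {U : Set (Coord d m)}
    {f : Coord d m → Covec d m a} {C : Coord d m → Covec d m b}
    (hf : ContDiffOn ℝ ∞ f U) (hC : ContDiffOn ℝ ∞ C U) :
    ContDiffOn ℝ ∞ (fun u => coExterior ε ha hb h (f u) (C u)) U := by
  obtain ⟨L, hL⟩ := coExterior_eq_linear (m := m) ε ha hb h
  simp only [hL]
  exact ((LinearMap.toContinuousBilinearMap L).contDiff.comp_contDiffOn hf).clm_apply hC

/-- With α = φ ⌟ ω and β = ψ ⌟ ω both sides are multiples of φ ⌟ (ψ ⌟ γ), as α • β is a multiple of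
(ψ ∧ φ) ⌟ ω. -/
theorem exists_coExterior_assoc (ε : Fin (d + 1) → ℤˣ) {a b c ab bc r : ℕ} (ha : a ≤ d + 1)
    (hb : b ≤ d + 1) (hc : c ≤ d + 1) (hab : ab ≤ d + 1) (hbc : bc ≤ d + 1)
    (h1 : b + c = d + 1 + bc) (h2 : a + bc = d + 1 + r) (h3 : a + b = d + 1 + ab)
    (h4 : ab + c = d + 1 + r) :
    ∃ s : ℝ, ∀ (α : Covec d m a) (β : Covec d m b) (γ : Covec d m c), IsHorizontal α →
      IsHorizontal β → IsHorizontal γ →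
      coExterior ε ha hbc h2 α (coExterior ε hb hc h1 β γ) =
        s • coExterior ε hab hc h4 (coExterior ε ha hb h3 α β) γ := by
  obtain ⟨s1, hs1, H1⟩ := exists_coExterior_contract (m := m) ε hb hc h1
  obtain ⟨s2, hs2, H2⟩ := exists_coExterior_contract (m := m) ε ha hbc h2
  obtain ⟨s3, hs3, H3⟩ := exists_coExterior_contract (m := m) ε ha hb h3
  obtain ⟨s4, hs4, H4⟩ := exists_coExterior_contract (m := m) ε hab hc h4
  refine ⟨s1 * s2 * (s3 * s4)⁻¹, fun α β γ hα hβ hγ => ?_⟩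
  have hφ := contract_volDual ε (by omega : (d + 1 - a) + a = d + 1) hα
  have hψ := contract_volDual ε (by omega : (d + 1 - b) + b = d + 1) hβ
  generalize volDual ε (by omega : (d + 1 - a) + a = d + 1) α = φ at hφ
  generalize volDual ε (by omega : (d + 1 - b) + b = d + 1) β = ψ at hψ
  rw [← hφ, H3 _ _ hβ, H2 _ _ (isHorizontal_coExterior ε _ _ _ _ _), ← hψ, H1 _ _ hγ,
    ← contract_mwedge (by omega : (d + 1 - b) + b = d + 1) (by omega : (d + 1 - a) + ab = b)
      (by omega : (d + 1 - ab) + ab = d + 1) (by omega : (d + 1 - b) + (d + 1 - a) = d + 1 - ab),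
    coExterior_smul_left, H4 _ _ hγ,
    contract_mwedge (by omega : (d + 1 - b) + bc = c) (by omega : (d + 1 - a) + r = bc),
    contract_smul_right, smul_smul, smul_smul, smul_smul]
  congr 1
  field_simp

/-- The Leibniz rule for the bracket and the co-exterior product. -/
theorem exists_localBracket_coExterior (ε : Fin (d + 1) → ℤˣ) {a b r k a' b' r' : ℕ}
    (ha : a ≤ d + 1) (hb : b ≤ d + 1) (ha' : a' ≤ d + 1) (hb' : b' ≤ d + 1)
    (hab : a + b = d + 1 + r) (hab₁ : a' + b = d + 1 + r') (hab₂ : a + b' = d + 1 + r')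
    (hka : k + a' = a) (hkb : k + b' = b) (hkr : k + r' = r) :
    ∃ s t : ℝ, ∀ (U : Set (Coord d m)), IsOpen U →
      ∀ (X : Coord d m → VIdx d m → Multivec d m k) (f : Coord d m → Covec d m a)
        (C : Coord d m → Covec d m b),
      ContDiffOn ℝ ∞ f U → ContDiffOn ℝ ∞ C U →
      (∀ u ∈ U, IsHorizontal (f u)) → (∀ u ∈ U, IsHorizontal (C u)) → ∀ u ∈ U,
      localBracket hkr X (fun u => coExterior ε ha hb hab (f u) (C u)) u =
        s • coExterior ε ha' hb hab₁ (localBracket hka X f u) (C u) +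
        t • coExterior ε ha hb' hab₂ (f u) (localBracket hkb X C u) := by
  obtain ⟨s0, hs0, H0⟩ := exists_coExterior_contract (m := m) ε ha hb hab
  obtain ⟨s1, hs1, H1⟩ := exists_coExterior_contract (m := m) ε ha' hb hab₁
  obtain ⟨s2, hs2, H2⟩ := exists_coExterior_contract (m := m) ε ha hb' hab₂
  -- The `s`-factors convert between co-exterior and interior products; the power of -1 comes from
  -- moving X_A past the multivector φ of f.
  refine ⟨s0 * s1⁻¹, s0 * s2⁻¹ * (-1) ^ (k * (d + 1 - a)), fun U hU X f C hf hC hfh hCh u hu => ?_⟩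
  let φ : Coord d m → Multivec d m (d + 1 - a) := fun u =>
    volDual ε (by omega : (d + 1 - a) + a = d + 1) (f u)
  have hφs : ContDiffOn ℝ ∞ φ U :=
    (LinearMap.toContinuousLinearMap (volDual (m := m) ε
      (by omega : (d + 1 - a) + a = d + 1))).contDiff.comp_contDiffOn hf
  have hφ : ∀ u ∈ U, f u = contract (by omega : (d + 1 - a) + a = d + 1) (φ u) (volForm d m) :=
    fun u hu => (contract_volDual ε (by omega : (d + 1 - a) + a = d + 1) (hfh u hu)).symm
  have hφd : DifferentiableAt ℝ φ u :=
    (hφs.contDiffAt (hU.mem_nhds hu)).differentiableAt (by simp)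
  have hCd : DifferentiableAt ℝ C u :=
    (hC.contDiffAt (hU.mem_nhds hu)).differentiableAt (by simp)
  have hK := hasFDerivAt_contract (by omega : (d + 1 - a) + r = b) hφd hCd
  have e1 : fibreDeriv (fun u => coExterior ε ha hb hab (f u) (C u)) u =
      s0 • fun A => contract (by omega : (d + 1 - a) + r = b) (fderiv ℝ φ u (vertVec A)) (C u) +
        contract (by omega : (d + 1 - a) + r = b) (φ u) (fibreDeriv C u A) := by
    have : ∀ u ∈ U, coExterior ε ha hb hab (f u) (C u) =
        s0 • contract (by omega : (d + 1 - a) + r = b) (φ u) (C u) := fun u hu => by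
      rw [hφ u hu, H0 _ _ (hCh u hu)]
    rw [fibreDeriv_congr hU this hu]
    funext A
    rw [fibreDeriv, fderiv_fun_const_smul hK.1, smul_apply, hK.2]
    rfl
  have e2 : fibreDeriv f u = fun A =>
      contract (by omega : (d + 1 - a) + a = d + 1) (fderiv ℝ φ u (vertVec A)) (volForm d m) := by
    rw [fibreDeriv_congr hU hφ hu]
    funext A
    rw [fibreDeriv, (hasFDerivAt_contract (by omega : (d + 1 - a) + a = d + 1) hφd
      (differentiableAt_const _)).2]
    simp [contract_zero_right]
  -- Up to the sign in `localBracket`, this is the multivector of the bracket with f; contracting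
  -- the same ψ with C gives the first Leibniz term.
  let ψ : Multivec d m (d + 1 - a') := ∑ A, mwedge (by omega : (d + 1 - a) + k = d + 1 - a')
    (fderiv ℝ φ u (vertVec A)) (X u A)
  have e3 : fibreContract hka (X u) (fibreDeriv f u) =
      contract (by omega : (d + 1 - a') + a' = d + 1) ψ (volForm d m) := by
    rw [e2, contract_sum_left, fibreContract]
    exact Finset.sum_congr rfl fun A _ => (contract_mwedge _ _ _ _ _ _ _).symm
  have e4 : fibreContract hkr (X u) (fun A => contract (by omega : (d + 1 - a) + r = b)
      (fderiv ℝ φ u (vertVec A)) (C u)) =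
      contract (by omega : (d + 1 - a') + r' = b) ψ (C u) := by
    rw [contract_sum_left, fibreContract]
    exact Finset.sum_congr rfl fun A _ => (contract_mwedge _ _ _ _ _ _ _).symm
  have e5 : fibreContract hkr (X u) (fun A => contract (by omega : (d + 1 - a) + r = b)
      (φ u) (fibreDeriv C u A)) = (-1 : ℝ) ^ (k * (d + 1 - a)) •
      contract (by omega : (d + 1 - a) + r' = b') (φ u)
        (fibreContract hkb (X u) (fibreDeriv C u)) := by
    rw [contract_fibreContract hkb (by omega : (d + 1 - a) + r' = b')
      (by omega : (d + 1 - a) + r = b) hkr, smul_smul, ← mul_pow]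
    norm_num
  have e6 := H1 ψ (C u) (hCh u hu)
  have e7 := H2 (φ u) (fibreContract hkb (X u) (fibreDeriv C u))
    (IsHorizontal.fibreContract hkb (isHorizontal_fibreDeriv hU hC hCh hu) (X u))
  have e8 : ∀ g g' : VIdx d m → Covec d m r, fibreContract hkr (X u) (fun A => g A + g' A) =
    fibreContract hkr (X u) g + fibreContract hkr (X u) g' := fibreContract_add_right hkr (X u)
  rw [localBracket, localBracket, localBracket, e1, fibreContract_smul_right, e8, e4, e5, e3,
    coExterior_smul_left, coExterior_smul_right, e6, hφ u hu, e7]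
  simp only [smul_add, smul_smul]
  congr 2
  · field_simp
  · field_simp

/-! ### Smooth families of covectors and multivectors -/

/-- Evaluation embeds covectors in the dual of multivectors, where smoothness is tested on
decomposables; a linear left inverse brings it back. -/
theorem contDiffOn_covec {k : ℕ} {U : Set (Coord d m)} {G : Coord d m → Covec d m k}
    (hG : ∀ v, ContDiffOn ℝ ∞ (fun u => G u v) U) : ContDiffOn ℝ ∞ G U := by
  let j : Covec d m k →ₗ[ℝ] (Multivec d m k →L[ℝ] ℝ) :=
    (ContinuousLinearMap.apply ℝ ℝ : Covec d m k →L[ℝ] (Covec d m k →L[ℝ] ℝ) →L[ℝ] ℝ)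
  have hj : LinearMap.ker j = ⊥ := LinearMap.ker_eq_bot.mpr fun α β h => by
    ext v
    exact DFunLike.congr_fun h (decomposable v)
  obtain ⟨g, hg⟩ := j.exists_leftInverse_of_injective hj
  have h1 : ContDiffOn ℝ ∞ (fun u => j (G u)) U := by
    refine contDiffOn_clm_apply.mpr fun X => ?_
    induction X using multivec_induction with
    | dec w => exact hG w
    | add X Y hX hY => exact hX.add hY
    | smul c X hX => exact hX.const_smul c
  have h2 : G = fun u => LinearMap.toContinuousLinearMap g (j (G u)) :=
    funext fun u => (LinearMap.congr_fun hg (G u)).symm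
  rw [h2]
  exact (LinearMap.toContinuousLinearMap g).contDiff.comp_contDiffOn h1

theorem contDiffOn_compContinuousLinearMap {k : ℕ} {U : Set (Coord d m)}
    {A : Coord d m → Coord d m →L[ℝ] Coord d m} (hA : ContDiffOn ℝ ∞ A U) (α : Covec d m k) :
    ContDiffOn ℝ ∞ (fun u => α.compContinuousLinearMap (A u)) U :=
  contDiffOn_covec fun v => α.contDiff.comp_contDiffOn
    (contDiffOn_pi.mpr fun i => hA.clm_apply (contDiffOn_const (c := v i)))

theorem contDiffOn_push {k : ℕ} {U : Set (Coord d m)}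
    {A : Coord d m → Coord d m →L[ℝ] Coord d m} {X : Coord d m → Multivec d m k}
    (hA : ContDiffOn ℝ ∞ A U) (hX : ContDiffOn ℝ ∞ X U) :
    ContDiffOn ℝ ∞ (fun u => push (A u) (X u)) U :=
  contDiffOn_clm_apply.mpr fun α => hX.clm_apply (contDiffOn_compContinuousLinearMap hA α)

theorem compContinuousLinearMap_comp {k : ℕ} (α : Covec d m k)
    (A B : Coord d m →L[ℝ] Coord d m) :
    α.compContinuousLinearMap (A.comp B) =
      (α.compContinuousLinearMap A).compContinuousLinearMap B := rfl

theorem push_push {k : ℕ} (A B : Coord d m →L[ℝ] Coord d m) (X : Multivec d m k) :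
    push A (push B X) = push (A.comp B) X := rfl

/-! ### Linear maps preserving the vertical vectors -/

/-- The linear map `A` maps vertical vectors to vertical vectors. -/
def PreservesVertical (A : Coord d m →L[ℝ] Coord d m) : Prop :=
  ∀ v, IsVerticalVector v → IsVerticalVector (A v)

theorem IsHorizontal.compContinuousLinearMap {k : ℕ} {α : Covec d m k} (hα : IsHorizontal α)
    {A : Coord d m →L[ℝ] Coord d m} (hA : PreservesVertical A) :
    IsHorizontal (α.compContinuousLinearMap A) := fun v i hv => hα (A ∘ v) i (hA (v i) hv)

theorem IsVertical.push {k : ℕ} {X : Multivec d m k} (hX : IsVertical X)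
    {A : Coord d m →L[ℝ] Coord d m} (hA : PreservesVertical A) :
    IsVertical (push A X) := fun _ hα => hX _ (hα.compContinuousLinearMap hA)

theorem compContinuousLinearMap_cancel {k : ℕ} {A B : Coord d m →L[ℝ] Coord d m}
    (hAB : A.comp B = ContinuousLinearMap.id ℝ _) (α : Covec d m k) :
    (α.compContinuousLinearMap A).compContinuousLinearMap B = α := by
  rw [← compContinuousLinearMap_comp, hAB]
  rfl

theorem IsVertical.contract_eq_zero {k l N : ℕ} {h : k + l = N} {X : Multivec d m k}
    (hX : IsVertical X) {η : Covec d m N} (hη : IsHorizontal η) : contract h X η = 0 := by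
  ext v
  exact hX _ (hη.evalLast v)

theorem IsVertical.isHorizontal_contract {k p N : ℕ} (h : k + (p + 1) = N + 1)
    {X : Multivec d m k} (hX : IsVertical X)
    {η : Covec d m (N + 1)}
    (hη : ∀ A, IsHorizontal (insertVec (Nat.add_comm 1 N) (vertVec A) η)) :
    IsHorizontal (contract h X η) := by
  refine isHorizontal_of_insertVec (Nat.add_comm 1 p) fun A => ?_
  rw [insertVec_contract h _ (Nat.add_comm 1 N) (by omega : k + p = N),
    hX.contract_eq_zero (hη A), smul_zero]

/-! ### Coordinate changes -/

section Change

variable {Z : Type*} [TopologicalSpace Z] [ChartedSpace (Coord d m) Z]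

/-- The change of coordinates from the chart `e` to the chart `e'`. -/
abbrev change (e e' : atlas (Coord d m) Z) : OpenPartialHomeomorph (Coord d m) (Coord d m) :=
  e.1.symm ≫ₕ e'.1

theorem mem_change_source {e e' : atlas (Coord d m) Z} {u : Coord d m} :
    u ∈ (change e e').source ↔ u ∈ e.1.target ∧ e.1.symm u ∈ e'.1.source := by
  rw [OpenPartialHomeomorph.trans_source]
  rfl

theorem change_change {e e' : atlas (Coord d m) Z} (e'' : atlas (Coord d m) Z) {u : Coord d m}
    (hu : u ∈ (change e e').source) : change e' e'' (change e e' u) = change e e'' u := by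
  rw [mem_change_source] at hu
  simp [hu.2]

theorem change_self {e : atlas (Coord d m) Z} {u : Coord d m} (hu : u ∈ e.1.target) :
    change e e u = u := e.1.right_inv hu

theorem symm_change {e e' : atlas (Coord d m) Z} {u : Coord d m}
    (hu : u ∈ (change e e').source) : e'.1.symm (change e e' u) = e.1.symm u :=
  e'.1.left_inv (mem_change_source.1 hu).2

theorem change_mem_target {e e' : atlas (Coord d m) Z} {u : Coord d m}
    (hu : u ∈ (change e e').source) : change e e' u ∈ e'.1.target :=
  e'.1.map_source (mem_change_source.1 hu).2

theorem change_mem_source {e e' e'' : atlas (Coord d m) Z} {u : Coord d m}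
    (hu : u ∈ (change e e').source) (hu' : u ∈ (change e e'').source) :
    change e e' u ∈ (change e' e'').source := by
  rw [mem_change_source, symm_change hu]
  exact ⟨change_mem_target hu, (mem_change_source.1 hu').2⟩

theorem mem_change_self_source {e : atlas (Coord d m) Z} {u : Coord d m} (hu : u ∈ e.1.target) :
    u ∈ (change e e).source :=
  mem_change_source.2 ⟨hu, e.1.map_target hu⟩

theorem fderiv_change_self {e : atlas (Coord d m) Z} {u : Coord d m} (hu : u ∈ e.1.target) :
    fderiv ℝ (change e e) u = ContinuousLinearMap.id ℝ _ := by
  rw [← fderiv_id]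
  refine Filter.EventuallyEq.fderiv_eq ?_
  filter_upwards [e.1.open_target.mem_nhds hu] with v hv using change_self hv

theorem IsSmoothMultivec.push_eq {k : ℕ} {X : MultivecFamily d m Z k} (hX : IsSmoothMultivec X)
    {e e' : atlas (Coord d m) Z} {u : Coord d m} (hu : u ∈ (change e e').source) :
    X e' (change e e' u) = push (fderiv ℝ (change e e') u) (X e u) := by
  ext α
  exact hX.compat e e' u hu α

variable [PolymomentumPhaseSpace d m Z]

theorem contDiffOn_change (e e' : atlas (Coord d m) Z) :
    ContDiffOn ℝ ∞ (change e e') (change e e').source := by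
  have h1 := contMDiffOn_symm_of_mem_maximalAtlas (I := 𝓘(ℝ, Coord d m)) (n := ∞)
    (IsManifold.subset_maximalAtlas e.2)
  have h2 := contMDiffOn_of_mem_maximalAtlas (I := 𝓘(ℝ, Coord d m)) (n := ∞)
    (IsManifold.subset_maximalAtlas e'.2)
  rw [← contMDiffOn_iff_contDiffOn]
  exact h2.comp (h1.mono fun u hu => (mem_change_source.1 hu).1) fun u hu =>
    (mem_change_source.1 hu).2

theorem contDiffAt_change {e e' : atlas (Coord d m) Z} {u : Coord d m}
    (hu : u ∈ (change e e').source) : ContDiffAt ℝ ∞ (change e e') u :=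
  (contDiffOn_change e e').contDiffAt ((change e e').open_source.mem_nhds hu)

theorem contDiffOn_fderiv_change (e e' : atlas (Coord d m) Z) :
    ContDiffOn ℝ ∞ (fderiv ℝ (change e e')) (change e e').source :=
  (contDiffOn_change e e').fderiv_of_isOpen (change e e').open_source (by simp)

theorem fderiv_change_comp {e e' e'' : atlas (Coord d m) Z} {u : Coord d m}
    (hu : u ∈ (change e e').source) (hu' : u ∈ (change e e'').source) :
    (fderiv ℝ (change e' e'') (change e e' u)).comp (fderiv ℝ (change e e') u) =
      fderiv ℝ (change e e'') u := by
  have h1 := (contDiffAt_change hu).differentiableAt (by simp)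
  have h2 := (contDiffAt_change (change_mem_source hu hu')).differentiableAt (by simp)
  rw [← fderiv_comp u h2 h1]
  refine Filter.EventuallyEq.fderiv_eq ?_
  filter_upwards [(change e e').open_source.mem_nhds hu] with v hv using change_change e'' hv

theorem fderiv_change_comp_inverse {e e' : atlas (Coord d m) Z} {u : Coord d m}
    (hu : u ∈ (change e e').source) :
    (fderiv ℝ (change e' e) (change e e' u)).comp (fderiv ℝ (change e e') u) =
      ContinuousLinearMap.id ℝ _ := by
  have h := (mem_change_source.1 hu).1
  rw [fderiv_change_comp hu (mem_change_self_source h), fderiv_change_self h]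

theorem fderiv_change_inverse_comp {e e' : atlas (Coord d m) Z} {u : Coord d m}
    (hu : u ∈ (change e e').source) :
    (fderiv ℝ (change e e') u).comp (fderiv ℝ (change e' e) (change e e' u)) =
      ContinuousLinearMap.id ℝ _ := by
  have h := (mem_change_source.1 hu).1
  have h' := change_mem_source hu (mem_change_self_source h)
  have := fderiv_change_comp_inverse h'
  rwa [change_change e hu, change_self h] at this

theorem isNaturalChange {e e' : atlas (Coord d m) Z} {u : Coord d m}
    (hu : u ∈ (change e e').source) : IsNaturalChange (change e e') u :=
  PolymomentumPhaseSpace.natural e.1 e.2 e'.1 e'.2 u hu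

theorem preservesVertical_change {e e' : atlas (Coord d m) Z} {u : Coord d m}
    (hu : u ∈ (change e e').source) : PreservesVertical (fderiv ℝ (change e e') u) :=
  (isNaturalChange hu).base

theorem isHorizontal_compContinuousLinearMap_change_iff {k : ℕ} {e e' : atlas (Coord d m) Z}
    {u : Coord d m} (hu : u ∈ (change e e').source) {α : Covec d m k} :
    IsHorizontal (α.compContinuousLinearMap (fderiv ℝ (change e e') u)) ↔ IsHorizontal α := by
  refine ⟨fun h => ?_, fun h => h.compContinuousLinearMap (preservesVertical_change hu)⟩
  have h' := change_mem_source hu (mem_change_self_source (mem_change_source.1 hu).1)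
  have := h.compContinuousLinearMap (preservesVertical_change h')
  rwa [compContinuousLinearMap_cancel (fderiv_change_inverse_comp hu)] at this

theorem comp_change_injective {k : ℕ} {e e' : atlas (Coord d m) Z}
    {u : Coord d m} (hu : u ∈ (change e e').source) {α β : Covec d m k}
    (h : α.compContinuousLinearMap (fderiv ℝ (change e e') u) =
      β.compContinuousLinearMap (fderiv ℝ (change e e') u)) : α = β := by
  rw [← compContinuousLinearMap_cancel (fderiv_change_inverse_comp hu) α, h,
    compContinuousLinearMap_cancel (fderiv_change_inverse_comp hu) β]

theorem IsSmoothForm.extDeriv_compat {k : ℕ} {F : FormFamily d m Z k} (hF : IsSmoothForm F)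
    {e e' : atlas (Coord d m) Z} {u : Coord d m} (hu : u ∈ (change e e').source) :
    extDeriv (F e) u =
      (extDeriv (F e') (change e e' u)).compContinuousLinearMap (fderiv ℝ (change e e') u) := by
  rw [← extDeriv_pullback (((hF.smooth e').contDiffAt (e'.1.open_target.mem_nhds
    (change_mem_target hu))).differentiableAt (by simp)) (contDiffAt_change hu) two_le_smooth]
  refine Filter.EventuallyEq.extDeriv_eq ?_
  filter_upwards [(change e e').open_source.mem_nhds hu] with v hv using hF.compat e e' v hv

theorem contDiffOn_extDeriv {k : ℕ} {U : Set (Coord d m)} (hU : IsOpen U)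
    {G : Coord d m → Covec d m k} (hG : ContDiffOn ℝ ∞ G U) : ContDiffOn ℝ ∞ (extDeriv G) U :=
  (ContinuousAlternatingMap.alternatizeUncurryFinCLM ℝ (Coord d m) ℝ).contDiff.comp_contDiffOn
    (hG.fderiv_of_isOpen hU (by simp))

/-- The polysymplectic class is preserved by coordinate changes. -/
theorem isHorizontal_contract_polysymplecticForm_sub {k p : ℕ} (h : k + (p + 1) = d + 1 + 1)
    {e e' : atlas (Coord d m) Z} {u : Coord d m} (hu : u ∈ (change e e').source)
    {X : Multivec d m k} (hX : IsVertical X) :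
    IsHorizontal (contract h X (((polysymplecticForm d m (change e e' u)).compContinuousLinearMap
      (fderiv ℝ (change e e') u)) - polysymplecticForm d m u)) := by
  have hU := (change e e').open_source
  have hΘ : ContDiff ℝ ∞ (canonicalForm d m) := by
    rw [canonicalForm_eq]
    exact (canonicalFormL d m).contDiff
  let θ : Coord d m → Covec d m (d + 1) := fun v =>
    (canonicalForm d m (change e e' v)).compContinuousLinearMap (fderiv ℝ (change e e') v)
  have hθ : ContDiffOn ℝ ∞ θ (change e e').source := by
    refine contDiffOn_covec fun w => ?_
    have h1 : ContDiffOn ℝ ∞ (fun v => canonicalForm d m (change e e' v)) (change e e').source :=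
      hΘ.comp_contDiffOn (contDiffOn_change e e')
    have h2 : ContDiffOn ℝ ∞ (fun v => decomposable fun i => fderiv ℝ (change e e') v (w i))
        (change e e').source :=
      contDiffOn_clm_apply.mpr fun α => α.contDiff.comp_contDiffOn (contDiffOn_pi.mpr fun i =>
        (contDiffOn_fderiv_change e e').clm_apply (contDiffOn_const (c := w i)))
    exact h2.clm_apply h1
  -- Since d commutes with pullback, the defect of Ω is the differential of the defect of Θ, which
  -- is horizontal by naturality of the charts.
  have h1 : (polysymplecticForm d m (change e e' u)).compContinuousLinearMap
      (fderiv ℝ (change e e') u) - polysymplecticForm d m u =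
      extDeriv (θ - canonicalForm d m) u := by
    rw [extDeriv, fderiv_sub ((hθ.contDiffAt (hU.mem_nhds hu)).differentiableAt (by simp))
      (hΘ.differentiable (by simp) u), ← ContinuousAlternatingMap.alternatizeUncurryFinCLM_apply,
      map_sub, ContinuousAlternatingMap.alternatizeUncurryFinCLM_apply,
      ContinuousAlternatingMap.alternatizeUncurryFinCLM_apply, ← extDeriv, ← extDeriv,
      polysymplecticForm, polysymplecticForm,
      ← extDeriv_pullback (hΘ.differentiable (by simp) _) (contDiffAt_change hu) two_le_smooth]
  rw [h1]
  refine hX.isHorizontal_contract h fun A => ?_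
  have h2 : ContDiffOn ℝ ∞ (θ - canonicalForm d m) (change e e').source := hθ.sub hΘ.contDiffOn
  have h3 : ∀ v ∈ (change e e').source, IsHorizontal ((θ - canonicalForm d m) v) :=
    fun v hv => (isNaturalChange hv).canonical
  rw [insertVec_extDeriv hU h2 h3 hu]
  exact isHorizontal_fibreDeriv hU h2 h3 hu A

/-- Hamilton's equation is preserved by coordinate changes. -/
theorem hamilton_eq_change {k p : ℕ} (h : k + (p + 1) = d + 1 + 1)
    {F : FormFamily d m Z p} (hF : IsSmoothForm F)
    {e e' : atlas (Coord d m) Z} {u : Coord d m} (hu : u ∈ (change e e').source)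
    {X : Multivec d m k} (hX : IsVertical X)
    (H : IsHorizontal (contract h X (polysymplecticForm d m u) - extDeriv (F e) u)) :
    IsHorizontal (contract h (push (fderiv ℝ (change e e') u) X)
      (polysymplecticForm d m (change e e' u)) - extDeriv (F e') (change e e' u)) := by
  rw [← isHorizontal_compContinuousLinearMap_change_iff hu]
  -- The terms with Ω at `u` cancel, leaving the pullback of Hamilton's equation in the chart `e'`.
  have h1 := (isHorizontal_contract_polysymplecticForm_sub h hu hX).add H
  rw [contract_sub_right, sub_add_sub_cancel, hF.extDeriv_compat hu, ← contract_push] at h1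
  exact h1

end Change

/-! ### Additivity and locality of the coordinate bracket -/

theorem fibreDeriv_sum {q : ℕ} {κ : Type*} (s : Finset κ) {G : κ → Coord d m → Covec d m q}
    {U : Set (Coord d m)} (hU : IsOpen U) (hG : ∀ i, ContDiffOn ℝ ∞ (G i) U) {u : Coord d m}
    (hu : u ∈ U) : fibreDeriv (fun u => ∑ i ∈ s, G i u) u = ∑ i ∈ s, fibreDeriv (G i) u := by
  funext A
  rw [fibreDeriv, fderiv_fun_sum fun i _ =>
    ((hG i).contDiffAt (hU.mem_nhds hu)).differentiableAt (by simp), Finset.sum_apply,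
    sum_apply]
  rfl

theorem localBracket_sum {k r q : ℕ} (h : k + r = q) {κ : Type*} (s : Finset κ)
    {G : κ → Coord d m → Covec d m q} {U : Set (Coord d m)} (hU : IsOpen U)
    (hG : ∀ i, ContDiffOn ℝ ∞ (G i) U) {u : Coord d m} (hu : u ∈ U)
    (X : Coord d m → VIdx d m → Multivec d m k) :
    localBracket h X (fun u => ∑ i ∈ s, G i u) u = ∑ i ∈ s, localBracket h X (G i) u := by
  simp only [localBracket, fibreDeriv_sum s hU hG hu, ← Finset.smul_sum, fibreContract,
    Finset.sum_apply, contract_sum_right]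
  rw [Finset.sum_comm]

theorem localBracket_congr {k r q : ℕ} (h : k + r = q) {G G' : Coord d m → Covec d m q}
    {U : Set (Coord d m)} (hU : IsOpen U) (hG : ∀ u ∈ U, G u = G' u) {u : Coord d m} (hu : u ∈ U)
    (X : Coord d m → VIdx d m → Multivec d m k) :
    localBracket h X G u = localBracket h X G' u := by
  rw [localBracket, localBracket, fibreDeriv_congr hU hG hu]

section Forms

variable {Z : Type*} [TopologicalSpace Z] [ChartedSpace (Coord d m) Z]

/-! ### Operations on horizontal forms -/

theorem IsHorizontalForm.smul {k : ℕ} {F : FormFamily d m Z k} (hF : IsHorizontalForm F) (c : ℝ) :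
    IsHorizontalForm (fun e u => c • F e u) where
  left :=
    { smooth := fun e => (hF.1.smooth e).const_smul c
      compat := fun e e' u hu => by
        rw [hF.1.compat e e' u hu]
        rfl }
  right := fun e u hu => (hF.2 e u hu).smul c

theorem IsHorizontalForm.add {k : ℕ} {F G : FormFamily d m Z k} (hF : IsHorizontalForm F)
    (hG : IsHorizontalForm G) : IsHorizontalForm (fun e u => F e u + G e u) where
  left :=
    { smooth := fun e => (hF.1.smooth e).add (hG.1.smooth e)
      compat := fun e e' u hu => by
        rw [hF.1.compat e e' u hu, hG.1.compat e e' u hu]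
        rfl }
  right := fun e u hu => (hF.2 e u hu).add (hG.2 e u hu)

theorem isHorizontalForm_sum {k : ℕ} {κ : Type*} (s : Finset κ) {F : κ → FormFamily d m Z k}
    (hF : ∀ i, IsHorizontalForm (F i)) : IsHorizontalForm (fun e u => ∑ i ∈ s, F i e u) where
  left :=
    { smooth := fun e => ContDiffOn.sum fun i _ => (hF i).1.smooth e
      compat := fun e e' u hu => by
        rw [Finset.sum_congr rfl fun i _ => (hF i).1.compat e e' u hu]
        ext v
        simp only [ContinuousAlternatingMap.compContinuousLinearMap_apply,
          ContinuousAlternatingMap.sum_apply] }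
  right := fun e u hu => isHorizontal_sum s fun i _ => (hF i).2 e u hu

/-- Coordinate changes preserve ω but not the metric. Compatibility holds because the product is φ ⌟
C up to a constant whenever φ ⌟ ω = f, and the push-forward of φ represents f in the new chart. -/
theorem isHorizontalForm_coExterior [PolymomentumPhaseSpace d m Z] (ε : Fin (d + 1) → ℤˣ)
    {a b r : ℕ} (ha : a ≤ d + 1) (hb : b ≤ d + 1) (h : a + b = d + 1 + r)
    {f : FormFamily d m Z a} {C : FormFamily d m Z b} (hf : IsHorizontalForm f)
    (hC : IsHorizontalForm C) :
    IsHorizontalForm (fun e u => coExterior ε ha hb h (f e u) (C e u)) where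
  left :=
    { smooth := fun e => contDiffOn_coExterior ε ha hb h (hf.1.smooth e) (hC.1.smooth e)
      compat := fun e e' u hu => by
        obtain ⟨s, -, hs⟩ := exists_coExterior_contract (m := m) ε ha hb h
        have hu1 := (mem_change_source.1 hu).1
        have hu2 := change_mem_target hu
        have hφ := contract_volDual ε (by omega : (d + 1 - a) + a = d + 1) (hf.2 e u hu1)
        generalize volDual ε (by omega : (d + 1 - a) + a = d + 1) (f e u) = φ at hφ
        have hφ' : contract (by omega : (d + 1 - a) + a = d + 1)
            (push (fderiv ℝ (change e e') u) φ) (volForm d m) = f e' (change e e' u) := by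
          refine comp_change_injective hu ?_
          rw [contract_push, (isNaturalChange hu).volume, hφ, hf.1.compat e e' u hu]
        rw [← hφ, ← hφ', hs _ _ (hC.2 e u hu1), hs _ _ (hC.2 e' _ hu2), hC.1.compat e e' u hu,
          ← contract_push]
        rfl }
  right := fun _ _ _ => isHorizontal_coExterior ε ha hb h _ _

/-! ### The bracket in coordinates -/

theorem IsHamiltonianForm.isHamiltonianField {p : ℕ} {hp : p ≤ d} {F : FormFamily d m Z p}
    (hF : IsHamiltonianForm hp F) : IsHamiltonianField hp (hamiltonianField hp F) F := by
  rw [hamiltonianField, dif_pos hF.2]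
  exact hF.2.choose_spec

/-- The components along the fibre of a multivector field of degree `n - p`. -/
def components {p : ℕ} (hp : p ≤ d) (X : MultivecFamily d m Z (d + 1 - p))
    (e : atlas (Coord d m) Z) (u : Coord d m) (A : VIdx d m) : Multivec d m (d - p) :=
  slice (by omega : 1 + (d - p) = d + 1 - p) A (X e u)

theorem IsHamiltonianField.hamiltonEquations {p : ℕ} {hp : p ≤ d}
    {X : MultivecFamily d m Z (d + 1 - p)} {F : FormFamily d m Z p} (hX : IsHamiltonianField hp X F)
    (hF : IsHorizontalForm F) (e : atlas (Coord d m) Z) :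
    HamiltonEquations (Nat.sub_add_cancel hp) e.1.target (components hp X e) (F e) where
  smooth := contDiffOn_pi.mpr fun A => (slice _ A).contDiff.comp_contDiffOn (hX.isSmooth.smooth e)
  eq := fun u hu => (isHorizontal_contract_sub_iff _ (by omega : 1 + (d - p) = d + 1 - p)
    (Nat.sub_add_cancel hp) e.1.open_target (hF.1.smooth e) (hF.2 e) hu
    (contract_insertVec_polysymplecticForm_slice _ _ _ (hX.vertical e u hu))).1 (hX.eq e u hu)

theorem IsHamiltonianForm.hamiltonEquations {p : ℕ} {hp : p ≤ d} {F : FormFamily d m Z p}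
    (hF : IsHamiltonianForm hp F) (e : atlas (Coord d m) Z) :
    HamiltonEquations (Nat.sub_add_cancel hp) e.1.target
      (components hp (hamiltonianField hp F) e) (F e) :=
  hF.isHamiltonianField.hamiltonEquations hF.1 e

theorem pgBracket_eq_localBracket {p q r : ℕ} {hp : p ≤ d} (h : p + q = d + r)
    {F : FormFamily d m Z p} (hF : IsHamiltonianForm hp F) {K : FormFamily d m Z q}
    (hK : IsHorizontalForm K) {e : atlas (Coord d m) Z} {u : Coord d m} (hu : u ∈ e.1.target) :
    pgBracket hp h F K e u = localBracket (by omega : (d - p) + r = q)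
      (components hp (hamiltonianField hp F) e) (K e) u := by
  rw [pgBracket, localBracket, contract_extDeriv _ (by omega : 1 + (d - p) = d + 1 - p)
    (by omega : (d - p) + r = q) e.1.open_target (hK.1.smooth e) (hK.2 e) hu
    (hF.isHamiltonianField.vertical e u hu)]
  -- The components have degree one less than X_F; `p ≤ d` keeps the truncated subtractions
  -- consistent.
  exact congrArg (fun k => (-1 : ℝ) ^ k • _) (by omega : d + 1 - p = (d - p) + 1)

/-- `K` need not be Hamiltonian: compatibility is naturality of d and of contraction. This lets F
act on the coefficients f^j of a weakly vanishing form. -/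
theorem isHorizontalForm_pgBracket [PolymomentumPhaseSpace d m Z] {p q r : ℕ} {hp : p ≤ d}
    (h : p + q = d + r) {F : FormFamily d m Z p} (hF : IsHamiltonianForm hp F)
    {K : FormFamily d m Z q} (hK : IsHorizontalForm K) : IsHorizontalForm (pgBracket hp h F K) where
  left :=
    { smooth := fun e => (contDiffOn_contract _ (hF.isHamiltonianField.isSmooth.smooth e)
        (contDiffOn_extDeriv e.1.open_target (hK.1.smooth e))).const_smul _
      compat := fun e e' u hu => by
        rw [pgBracket, pgBracket, hK.1.extDeriv_compat hu, ← contract_push,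
          ← hF.isHamiltonianField.isSmooth.push_eq hu]
        rfl }
  right := fun e u hu => by
    rw [pgBracket_eq_localBracket h hF hK hu]
    exact (IsHorizontal.fibreContract _ (isHorizontal_fibreDeriv e.1.open_target (hK.1.smooth e)
      (hK.2 e) hu) _).smul _

/-! ### Weak vanishing -/

section Weak

variable {ε : Fin (d + 1) → ℤˣ} {ι : Type*} [Fintype ι] {C : ι → FormFamily d m Z d}

theorem WeaklyVanishes.sub_smul {p : ℕ} {hp : p ≤ d} {K L M : FormFamily d m Z p}
    (hK : WeaklyVanishes ε C hp K) (hL : WeaklyVanishes ε C hp L) (c : ℝ)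
    (hM : ∀ e, ∀ u ∈ e.1.target, M e u = K e u - c • L e u) : WeaklyVanishes ε C hp M := by
  obtain ⟨f, hf, hfK⟩ := hK
  obtain ⟨g, hg, hgL⟩ := hL
  refine ⟨fun j e u => f j e u + (-c) • g j e u, fun j => (hf j).add ((hg j).smul (-c)),
    fun e u hu => ?_⟩
  rw [hM e u hu, hfK e u hu, hgL e u hu, Finset.smul_sum, ← Finset.sum_sub_distrib]
  refine Finset.sum_congr rfl fun j _ => ?_
  obtain ⟨L, hL⟩ := coExterior_eq_linear (m := m) ε (Nat.succ_le_succ hp) (Nat.le_succ d)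
    (by omega : (p + 1) + d = d + 1 + p)
  simp only [hL, map_add, map_smul, LinearMap.add_apply, LinearMap.smul_apply]
  rw [neg_smul, sub_eq_add_neg]

variable [PolymomentumPhaseSpace d m Z]

/-- The bracket of a first-class form with a weakly vanishing form vanishes weakly. -/
theorem IsFirstClass.weaklyVanishes_pgBracket (hC : ∀ j, IsHorizontalForm (C j)) {p q r : ℕ}
    {hp : p ≤ d} (hq : q ≤ d) (hr : p + q = d + r) (hr' : r ≤ d) {F : FormFamily d m Z p}
    (hF : IsFirstClass ε C hp F) {K : FormFamily d m Z q} (hKh : IsHorizontalForm K)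
    (hK : WeaklyVanishes ε C hq K) :
    WeaklyVanishes ε C hr' (pgBracket hp hr F K) := by
  obtain ⟨f, hf, hfK⟩ := hK
  choose g hg hgF using hF.2
  obtain ⟨s, t, hst⟩ := exists_localBracket_coExterior (m := m) ε
    (Nat.succ_le_succ hq : q + 1 ≤ d + 1) (Nat.le_succ d) (by omega : r + 1 ≤ d + 1)
    (by omega : p ≤ d + 1) (by omega : (q + 1) + d = d + 1 + q)
    (by omega : (r + 1) + d = d + 1 + r) (by omega : (q + 1) + p = d + 1 + r)
    (by omega : (d - p) + (r + 1) = q + 1) (Nat.sub_add_cancel hp) (by omega : (d - p) + r = q)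
  obtain ⟨s', hs'⟩ := exists_coExterior_assoc (m := m) ε (Nat.succ_le_succ hq : q + 1 ≤ d + 1)
    (Nat.succ_le_succ hp : p + 1 ≤ d + 1) (Nat.le_succ d) (by omega : r + 1 ≤ d + 1)
    (by omega : p ≤ d + 1) (by omega : (p + 1) + d = d + 1 + p)
    (by omega : (q + 1) + p = d + 1 + r) (by omega : (q + 1) + (p + 1) = d + 1 + (r + 1))
    (by omega : (r + 1) + d = d + 1 + r)
  -- F also acts on the coefficients, of degree q+1, which may be as large as n.
  have hr1 : p + (q + 1) = d + (r + 1) := by omega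
  -- The new coefficient of C_j collects the Leibniz term differentiating f^j and, by associativity,
  -- the C_j-part of every f^i • {F, C_i}; `g i j` is the coefficient of C_j in {F, C_i}.
  refine ⟨fun j e u => s • pgBracket hp hr1 F (f j) e u + (t * s') • ∑ i, coExterior ε
      (Nat.succ_le_succ hq) (Nat.succ_le_succ hp) (by omega : (q + 1) + (p + 1) = d + 1 + (r + 1))
      (f i e u) (g i j e u), fun j => ?_, fun e u hu => ?_⟩
  · exact ((isHorizontalForm_pgBracket hr1 hF.1 (hf j)).smul s).add
      ((isHorizontalForm_sum _ fun i => isHorizontalForm_coExterior ε _ _ _ (hf i) (hg i j)).smul _)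
  · have hU := e.1.open_target
    rw [pgBracket_eq_localBracket hr hF.1 hKh hu, localBracket_congr _ hU (hfK e) hu,
      localBracket_sum _ _ hU (fun j => contDiffOn_coExterior ε _ _ _ ((hf j).1.smooth e)
        ((hC j).1.smooth e)) hu]
    have h1 : ∀ j, localBracket (by omega : (d - p) + r = q)
        (components hp (hamiltonianField hp F) e) (fun u => coExterior ε (Nat.succ_le_succ hq)
          (Nat.le_succ d) (by omega : (q + 1) + d = d + 1 + q) (f j e u) (C j e u)) u =
        s • coExterior ε (by omega : r + 1 ≤ d + 1) (Nat.le_succ d)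
          (by omega : (r + 1) + d = d + 1 + r) (pgBracket hp hr1 F (f j) e u) (C j e u) +
        ∑ i, (t * s') • coExterior ε (by omega : r + 1 ≤ d + 1) (Nat.le_succ d)
          (by omega : (r + 1) + d = d + 1 + r) (coExterior ε (Nat.succ_le_succ hq)
            (Nat.succ_le_succ hp) (by omega : (q + 1) + (p + 1) = d + 1 + (r + 1))
            (f j e u) (g j i e u)) (C i e u) := fun j => by
      rw [hst e.1.target hU _ (f j e) (C j e) ((hf j).1.smooth e) ((hC j).1.smooth e) ((hf j).2 e)
        ((hC j).2 e) u hu, ← pgBracket_eq_localBracket hr1 hF.1 (hf j) hu,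
        ← pgBracket_eq_localBracket (Nat.add_comm p d) hF.1 (hC j) hu, hgF j e u hu,
        coExterior_sum_right, Finset.smul_sum]
      congr 1
      refine Finset.sum_congr rfl fun i _ => ?_
      rw [hs' _ _ _ ((hf j).2 e u hu) ((hg j i).2 e u hu) ((hC i).2 e u hu), smul_smul]
    rw [Finset.sum_congr rfl fun j _ => h1 j, Finset.sum_add_distrib, Finset.sum_comm,
      ← Finset.sum_add_distrib]
    refine Finset.sum_congr rfl fun j _ => ?_
    obtain ⟨L, hL⟩ := coExterior_eq_linear (m := m) ε (by omega : r + 1 ≤ d + 1) (Nat.le_succ d)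
      (by omega : (r + 1) + d = d + 1 + r)
    simp only [hL, map_add, map_smul, map_sum, LinearMap.add_apply, LinearMap.smul_apply,
      LinearMap.sum_apply, Finset.smul_sum]

end Weak

end Forms

section Glue

variable {Z : Type*} [TopologicalSpace Z] [ChartedSpace (Coord d m) Z]

/-! ### Gluing of Hamiltonian multivector fields -/

theorem push_smul {k : ℕ} (A : Coord d m →L[ℝ] Coord d m) (c : ℝ) (X : Multivec d m k) :
    push A (c • X) = c • push A X := rfl

theorem push_sum {k : ℕ} (A : Coord d m →L[ℝ] Coord d m) {κ : Type*} (s : Finset κ)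
    (X : κ → Multivec d m k) : push A (∑ i ∈ s, X i) = ∑ i ∈ s, push A (X i) := by
  ext α
  simp only [push_apply, sum_apply]

theorem isVertical_sum {k : ℕ} {κ : Type*} (s : Finset κ) (c : κ → ℝ) {X : κ → Multivec d m k}
    (hX : ∀ i ∈ s, IsVertical (X i)) : IsVertical (∑ i ∈ s, c i • X i) := fun α hα => by
  rw [sum_apply]
  exact Finset.sum_eq_zero fun i hi => by rw [smul_apply, hX i hi α hα, smul_zero]

/-- The expression in the chart `e` of the multivector with expression `W i` in the chart `i`. -/
def transfer {k : ℕ} (W : MultivecFamily d m Z k) (i e : atlas (Coord d m) Z) (u : Coord d m) :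
    Multivec d m k :=
  push (fderiv ℝ (change i e) (change e i u)) (W i (change e i u))

variable [PolymomentumPhaseSpace d m Z]

theorem contDiffOn_transfer {k : ℕ} {W : MultivecFamily d m Z k}
    (hW : ∀ i, ContDiffOn ℝ ∞ (W i) i.1.target) (i e : atlas (Coord d m) Z) :
    ContDiffOn ℝ ∞ (transfer W i e) (change e i).source := by
  have h1 := contDiffOn_change e i
  refine contDiffOn_push ((contDiffOn_fderiv_change i e).comp h1 fun u hu => ?_)
    ((hW i).comp h1 fun u hu => change_mem_target hu)
  exact change_mem_source hu (mem_change_self_source (mem_change_source.1 hu).1)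

/-- The chain rule for coordinate changes: each single `W i`, read in all charts, is tensorial even
if the family `W` is not. -/
theorem transfer_change {k : ℕ} (W : MultivecFamily d m Z k) {i e e' : atlas (Coord d m) Z}
    {u : Coord d m} (hu : u ∈ (change e e').source) (hi : u ∈ (change e i).source) :
    transfer W i e' (change e e' u) = push (fderiv ℝ (change e e') u) (transfer W i e u) := by
  have hu0 := mem_change_self_source (mem_change_source.1 hu).1
  have h1 := fderiv_change_comp (change_mem_source hi hu0) (change_mem_source hi hu)
  rw [change_change e hi, change_self (mem_change_source.1 hu).1] at h1
  rw [transfer, transfer, push_push, h1, change_change i hu]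

/-- A form is Hamiltonian as soon as its restrictions to the charts are. -/
theorem exists_isHamiltonianField [T2Space Z] [SecondCountableTopology Z] {p : ℕ} (hp : p ≤ d)
    {F : FormFamily d m Z p} (hF : IsSmoothForm F) {W : MultivecFamily d m Z (d + 1 - p)}
    (hW : ∀ e, ContDiffOn ℝ ∞ (W e) e.1.target)
    (hWv : ∀ e, ∀ u ∈ e.1.target, IsVertical (W e u))
    (hWF : ∀ e, ∀ u ∈ e.1.target, IsHorizontal
      (contract (by omega : (d + 1 - p) + (p + 1) = d + 1 + 1) (W e u) (polysymplecticForm d m u)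
        - extDeriv (F e) u)) :
    ∃ X : MultivecFamily d m Z (d + 1 - p), IsHamiltonianField hp X F := by
  have : LocallyCompactSpace Z := ChartedSpace.locallyCompactSpace (Coord d m) Z
  obtain ⟨ρ, hρ⟩ := SmoothPartitionOfUnity.exists_isSubordinate 𝓘(ℝ, Coord d m)
    (isClosed_univ (X := Z)) (fun i : atlas (Coord d m) Z => i.1.source)
    (fun i => i.1.open_source) fun z _ => Set.mem_iUnion.2
      ⟨⟨chartAt (Coord d m) z, chart_mem_atlas _ z⟩, mem_chart_source _ z⟩
  have hsrc : ∀ {z : Z} {i}, i ∈ ρ.finsupport z → z ∈ i.1.source := fun {z i} hi =>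
    hρ i (subset_tsupport _ ((ρ.mem_finsupport z).1 hi))
  have hmem : ∀ {e i : atlas (Coord d m) Z} {u}, u ∈ e.1.target →
      i ∈ ρ.finsupport (e.1.symm u) → u ∈ (change e i).source := fun hu hi =>
    mem_change_source.2 ⟨hu, hsrc hi⟩
  have hback : ∀ {e i : atlas (Coord d m) Z} {u}, u ∈ (change e i).source →
      change e i u ∈ (change i e).source ∧ change i e (change e i u) = u := fun hu =>
    ⟨change_mem_source hu (mem_change_self_source (mem_change_source.1 hu).1), by
      rw [change_change _ hu, change_self (mem_change_source.1 hu).1]⟩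
  refine ⟨fun e u => ∑ i ∈ ρ.finsupport (e.1.symm u), ρ i (e.1.symm u) • transfer W i e u,
    ⟨fun e u₀ hu₀ => ?_, fun e e' u hu α => ?_⟩, fun e u hu => ?_, fun e u hu => ?_⟩
  -- The index set of the sum varies with the point. Near `u₀` it is replaced by the fixed finite
  -- set of indices whose topological support contains the point; the added terms have weight zero.
  · refine ContDiffAt.contDiffWithinAt ?_
    have hsymm : ContMDiffAt 𝓘(ℝ, Coord d m) 𝓘(ℝ, Coord d m) ∞ e.1.symm u₀ :=
      (contMDiffOn_symm_of_mem_maximalAtlas (IsManifold.subset_maximalAtlas e.2)).contMDiffAt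
        (e.1.open_target.mem_nhds hu₀)
    have hev : (fun u => ∑ i ∈ ρ.finsupport (e.1.symm u), ρ i (e.1.symm u) • transfer W i e u)
        =ᶠ[nhds u₀] fun u => ∑ i ∈ ρ.fintsupport (e.1.symm u₀),
          ρ i (e.1.symm u) • transfer W i e u := by
      filter_upwards [hsymm.continuousAt (ρ.eventually_finsupport_subset (e.1.symm u₀))] with u hu
      refine Finset.sum_subset hu fun i _ hi => ?_
      have : ρ i (e.1.symm u) = 0 := by
        simpa using hi
      rw [this, zero_smul]
    refine ContDiffAt.congr_of_eventuallyEq ?_ hev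
    refine ContDiffAt.sum fun i hi => ?_
    have h1 : ContDiffAt ℝ ∞ (fun u => ρ i (e.1.symm u)) u₀ := by
      rw [← contMDiffAt_iff_contDiffAt]
      exact ((ρ i).contMDiff.contMDiffAt (x := e.1.symm u₀)).comp u₀ hsymm
    have hi' := hρ i ((ρ.mem_fintsupport_iff _ i).1 hi)
    exact h1.smul ((contDiffOn_transfer hW i e).contDiffAt
      ((change e i).open_source.mem_nhds (mem_change_source.2 ⟨hu₀, hi'⟩)))
  · rw [← push_apply]
    refine DFunLike.congr_fun ?_ α
    rw [push_sum, symm_change hu]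
    refine Finset.sum_congr rfl fun i hi => ?_
    rw [transfer_change W hu (hmem (mem_change_source.1 hu).1 hi), push_smul]
  · exact isVertical_sum _ _ fun i hi => (hWv i _ (change_mem_target (hmem hu hi))).push
      (preservesVertical_change (hback (hmem hu hi)).1)
  -- The weights sum to one, so dF is the same weighted sum and Hamilton's equation is checked term
  -- by term.
  · have h1 : extDeriv (F e) u =
        ∑ i ∈ ρ.finsupport (e.1.symm u), ρ i (e.1.symm u) • extDeriv (F e) u := by
      rw [← Finset.sum_smul, ρ.sum_finsupport _ (Set.mem_univ _), one_smul]
    rw [h1, contract_sum_left, ← Finset.sum_sub_distrib]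
    refine isHorizontal_sum _ fun i hi => ?_
    rw [contract_smul_left, ← smul_sub]
    have h2 := hamilton_eq_change _ hF (hback (hmem hu hi)).1
      (hWv i _ (change_mem_target (hmem hu hi))) (hWF i _ (change_mem_target (hmem hu hi)))
    rw [(hback (hmem hu hi)).2] at h2
    exact h2.smul _

/-- The bracket of Hamiltonian forms is Hamiltonian. -/
theorem isHamiltonianForm_pgBracket [T2Space Z] [SecondCountableTopology Z] {p q r : ℕ}
    {hp : p ≤ d} {hq : q ≤ d} (hr : p + q = d + r) (hr' : r ≤ d) {F : FormFamily d m Z p}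
    {G : FormFamily d m Z q}
    (hF : IsHamiltonianForm hp F) (hG : IsHamiltonianForm hq G) :
    IsHamiltonianForm hr' (pgBracket hp hr F G) ∧
      ∀ e, HamiltonEquations (Nat.sub_add_cancel hr') e.1.target
        (bracketField (by omega : (d - p) + (d - q) = d - r)
          (components hp (hamiltonianField hp F) e) (components hq (hamiltonianField hq G) e))
        (pgBracket hp hr F G e) := by
  have hH := isHorizontalForm_pgBracket hr hF hG.1
  have hE : ∀ e, HamiltonEquations (Nat.sub_add_cancel hr') e.1.target
        (bracketField (by omega : (d - p) + (d - q) = d - r)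
          (components hp (hamiltonianField hp F) e) (components hq (hamiltonianField hq G) e))
        (pgBracket hp hr F G e) := fun e => by
    have h := (hF.hamiltonEquations e).bracket (by omega : (d - p) + r = q)
      (by omega : (d - p) + (d - q) = d - r) (Nat.sub_add_cancel hr') e.1.open_target
      (hG.hamiltonEquations e) (hF.1.1.smooth e) (hG.1.1.smooth e)
    refine ⟨h.smooth, fun u hu B => ?_⟩
    rw [fibreDeriv_congr e.1.open_target (fun u hu => pgBracket_eq_localBracket hr hF hG.1 hu) hu]
    exact h.eq u hu B
  -- No transformation law is claimed for these chartwise fields; gluing supplies a global one.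
  refine ⟨⟨hH, exists_isHamiltonianField hr' hH.1 (W := fun e u =>
    ofComponents (by omega : 1 + (d - r) = d + 1 - r)
      (bracketField (by omega : (d - p) + (d - q) = d - r)
        (components hp (hamiltonianField hp F) e) (components hq (hamiltonianField hq G) e) u))
    (fun e => (ofComponents (by omega : 1 + (d - r) = d + 1 - r)).contDiff.comp_contDiffOn
      (hE e).smooth)
    (fun e u _ => isVertical_ofComponents _ _) fun e u hu => ?_⟩, hE⟩
  exact (isHorizontal_contract_sub_iff _ (by omega : 1 + (d - r) = d + 1 - r)
    (Nat.sub_add_cancel hr') e.1.open_target (hH.1.smooth e) (hH.2 e) hu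
    (contract_insertVec_polysymplecticForm_ofComponents _ _ _ _)).2 ((hE e).eq u hu)

/-- The Jacobi identity for the bracket with a form of degree `n - 1`. -/
theorem pgBracket_jacobi [T2Space Z] [SecondCountableTopology Z] {p q r : ℕ}
    {hp : p ≤ d} {hq : q ≤ d} (hr : p + q = d + r) (hr' : r ≤ d) {F : FormFamily d m Z p}
    {G : FormFamily d m Z q} {C : FormFamily d m Z d} (hF : IsHamiltonianForm hp F)
    (hG : IsHamiltonianForm hq G) (hC : IsHamiltonianForm le_rfl C) (e : atlas (Coord d m) Z)
    {u : Coord d m} (hu : u ∈ e.1.target) :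
    pgBracket hr' (Nat.add_comm r d) (pgBracket hp hr F G) C e u =
      pgBracket hp hr F (pgBracket hq (Nat.add_comm q d) G C) e u -
        (-1 : ℝ) ^ ((d - p) * (d - q)) • pgBracket hq (by omega : q + p = d + r) G
          (pgBracket hp (Nat.add_comm p d) F C) e u := by
  obtain ⟨hH, hE⟩ := isHamiltonianForm_pgBracket hr hr' hF hG
  have hU := e.1.open_target
  -- Antisymmetry is used twice to replace the chosen field of the bracket by the explicit
  -- commutator: both give minus the bracket of C with {F, G}, up to one sign. This is where C must
  -- be Hamiltonian.
  rw [pgBracket_eq_localBracket _ hH hC.1 hu,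
    localBracket_antisymm _ (by omega : (d - d) + r = r) (hH.hamiltonEquations e)
      (hC.hamiltonEquations e) hu,
    ← localBracket_antisymm (Nat.sub_add_cancel hr') _ (hE e) (hC.hamiltonEquations e) hu,
    localBracket_jacobi (Nat.sub_add_cancel hp) (Nat.sub_add_cancel hq)
      (by omega : (d - p) + r = q) (by omega : (d - q) + r = p) _ _ hU
      (hF.hamiltonEquations e).smooth (hG.hamiltonEquations e).smooth (hC.1.1.smooth e) hu,
    pgBracket_eq_localBracket hr hF (isHorizontalForm_pgBracket _ hG hC.1) hu,
    pgBracket_eq_localBracket _ hG (isHorizontalForm_pgBracket _ hF hC.1) hu,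
    localBracket_congr _ hU (fun v hv => pgBracket_eq_localBracket _ hG hC.1 hv) hu,
    localBracket_congr _ hU (fun v hv => pgBracket_eq_localBracket _ hF hC.1 hv) hu]

end Glue

end DeDonderWeyl

end

/-! ### First-class forms are closed under the bracket -/

theorem proposition3p1 {d m : ℕ} {Z : Type*} [TopologicalSpace Z] [T2Space Z]
    [SecondCountableTopology Z] [ChartedSpace (DeDonderWeyl.Coord d m) Z]
    [DeDonderWeyl.PolymomentumPhaseSpace d m Z]
    (ε : Fin (d + 1) → ℤˣ) {ι : Type*} [Fintype ι]
    (C : ι → DeDonderWeyl.FormFamily d m Z d)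
    (hC : ∀ j, DeDonderWeyl.IsHamiltonianForm le_rfl (C j))
    {p q r : ℕ} (hp : p ≤ d) (hq : q ≤ d) (hr : p + q = d + r)
    (F : DeDonderWeyl.FormFamily d m Z p) (G : DeDonderWeyl.FormFamily d m Z q)
    (hF : DeDonderWeyl.IsFirstClass ε C hp F) (hG : DeDonderWeyl.IsFirstClass ε C hq G) :
    DeDonderWeyl.IsFirstClass ε C (by omega : r ≤ d) (DeDonderWeyl.pgBracket hp hr F G) := by
  have hCh := fun j => (hC j).1
  refine ⟨(DeDonderWeyl.isHamiltonianForm_pgBracket hr (by omega) hF.1 hG.1).1, fun j => ?_⟩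
  -- By Jacobi the bracket with C_j is {F, {G, C_j}} minus a sign times {G, {F, C_j}}. The inner
  -- brackets vanish weakly by hypothesis, so the outer ones do as well.
  exact (hF.weaklyVanishes_pgBracket hCh hq hr _
    (DeDonderWeyl.isHorizontalForm_pgBracket _ hG.1 (hCh j)) (hG.2 j)).sub_smul
    (hG.weaklyVanishes_pgBracket hCh hp (by omega : q + p = d + r) _
      (DeDonderWeyl.isHorizontalForm_pgBracket _ hF.1 (hCh j)) (hF.2 j)) _ fun e u hu =>
    DeDonderWeyl.pgBracket_jacobi hr _ hF.1 hG.1 (hC j) e hu
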